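/- Let $n\ge 2$ and let $k\ge 2$ be even. For $c\in\mathbb R$ put $g(w)=c-1/w$ and $w_s=g^{s-1}(c)$ for $1\le s\le n-1$. Let $c$ belong to the set $C_n$ of all numbers $c=\pm2\cos(j\pi/n)$, $0<j<n$, $\gcd(j,n)=1$, for which $w_1\cdots w_{n-2}=1$. (Then $g$ has period $n$ and $w_{n-1}=0$.) Let $a_\ell\in\mathbb C$ be arbitrary for even $\ell$ with $2\le \ell\le k-2$, and let $$f(x,y)=\Bigl(y,\,-x+cy+\sum_{\ell=2,\ \ell\text{ even}}^{k-2}\frac{a_\ell}{y^\ell}+\frac1{y^k}\Bigr),$$ regarded as a birational map of $\mathbb P^2\supset\mathbb C^2\ni(x,y)=[1:x:y]$. Let $\Sigma_0=\{x_0=0\}$ be the line at infinity, and define numbers $b_i$ by $$\sum_{i\ge0}b_iy^i=\frac{y^k}{1+\sum_{\ell}a_\ell y^{k-\ell}+cy^{k+1}}.$$ Let $\pi:\mathcal X\to\mathbb P^2$ be the following iterated blowup. First blow up the $n$ distinct points $e_2=[0:0:1]$ (for $s=0$) and $f^se_2=[0:1:w_s]$ (for $1\le s\le n-1$) of $\Sigma_0$;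 let $\mathcal F^1_s$ be the exceptional curve over the $s$-th point, and use near it the coordinates $(\xi_1,x_1)$ given by $(\xi_1,x_1)\mapsto[\xi_1:\xi_1x_1:1]$ if $s=0$ and $(\xi_1,x_1)\mapsto[\xi_1:1:w_s+\xi_1x_1]$ if $s\ge1$, so that $\mathcal F^1_s=\{\xi_1=0\}$. Then, for $j=1,\dots,2k$ successively and for every $0\le s\le n-1$, blow up the point $(\xi_j,x_j)=(\beta_{s,j},0)$ of $\mathcal F^j_s$, where $\beta_{s,j}=(w_1\cdots w_{s-1})^{j-2}\,b_{j-1}$ (the product being $1$ for $s=0,1$); let $\mathcal F^{j+1}_s$ be the new exceptional curve, and use near it the coordinates with $(\xi_j,x_j)=(\xi_{j+1}x_{j+1}+\beta_{s,j},\,x_{j+1})$, so that $\mathcal F^{j+1}_s=\{x_{j+1}=0\}$. Denote the strict transforms in $\mathcal X$ of $\Sigma_0$ and of the $\mathcal F^j_s$ by the same letters. Then $f$ induces a holomorphic automorphism $f_{\mathcal X}$ of $\mathcal X$, with $\pi\circ f_{\mathcal X}=f\circ\pi$. Let $$\mathcal P=\Sigma_0\cup\bigcup\mathcal F^j_s\subset\mathcal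 X,$$ where the union is over all $0\le s\le n-1$ and over $j=1$ and $3\le j\le 2k-1$. Then every point $p\in\mathcal P$ is fixed by $f_{\mathcal X}^{2n}$, and $f_{\mathcal X}^{2n}$ is tangent to the identity at $p$, that is, the differential of $f_{\mathcal X}^{2n}$ at $p$ is the identity of the tangent space $T_p\mathcal X$. -/

import Mathlib

open Set Filter
open scoped Topology Manifold ContDiff LinearAlgebra.Projectivization

/-- A Hausdorff complex surface, presented by a holomorphic atlas: a set of points together with
injective parametrizations `par i : dom i → carrier` of open sets `dom i ⊆ ℂ²` which cover it,
whose coordinate changes are holomorphic (`compat`), and which separate points (`sep`). -/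
structure ComplexSurface where
  carrier : Type
  ι : Type
  dom : ι → Set (ℂ × ℂ)
  par : ι → ℂ × ℂ → carrier
  isOpen_dom : ∀ i, IsOpen (dom i)
  injOn : ∀ i, InjOn (par i) (dom i)
  cover : ∀ x, ∃ i, ∃ z ∈ dom i, par i z = x
  compat : ∀ i j, ∀ z ∈ dom i, ∀ w ∈ dom j, par i z = par j w →
    ∃ G : ℂ × ℂ → ℂ × ℂ, G z = w ∧ ContDiffAt ℂ ω G z ∧ ∀ᶠ z' in 𝓝 z, par j (G z') = par i z'
  sep : ∀ i j, ∀ z ∈ dom i, ∀ w ∈ dom j, par i z ≠ par j w →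
    ∀ᶠ q : (ℂ × ℂ) × (ℂ × ℂ) in 𝓝 (z, w), par i q.1 ≠ par j q.2

namespace ComplexSurface

variable (M : ComplexSurface)

/-- The chart `carrier → ℂ²` inverse to the `i`-th parametrization. -/
noncomputable def chart (i : M.ι) : PartialEquiv M.carrier (ℂ × ℂ) :=
  ((M.injOn i).toPartialEquiv (M.par i) (M.dom i)).symm

theorem chart_par (i : M.ι) {z : ℂ × ℂ} (hz : z ∈ M.dom i) : M.chart i (M.par i z) = z :=
  ((M.injOn i).toPartialEquiv (M.par i) (M.dom i)).left_inv hz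

theorem transition (i j : M.ι) {z : ℂ × ℂ} (hz : z ∈ ((M.chart i).symm.trans (M.chart j)).source) :
    ((M.chart i).symm.trans (M.chart j)).source ∈ 𝓝 z ∧
      ContDiffAt ℂ ω ((M.chart i).symm.trans (M.chart j)) z := by
  have key : ∀ y, y ∈ ((M.chart i).symm.trans (M.chart j)).source ↔
      y ∈ M.dom i ∧ M.par i y ∈ M.par j '' M.dom j := fun y => Iff.rfl
  obtain ⟨hzi, w, hw, hwz⟩ := (key z).1 hz
  obtain ⟨G, hG, hGd, hGe⟩ := M.compat i j z hzi w hw hwz.symm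
  have hGc : ∀ᶠ z' in 𝓝 z, G z' ∈ M.dom j :=
    hGd.continuousAt (by rw [hG]; exact (M.isOpen_dom j).mem_nhds hw)
  refine ⟨?_, hGd.congr_of_eventuallyEq ?_⟩
  · filter_upwards [hGe, hGc, (M.isOpen_dom i).mem_nhds hzi] with y h1 h2 h3
    exact (key y).2 ⟨h3, G y, h2, h1⟩
  · filter_upwards [hGe, hGc] with y h1 h2
    change M.chart j (M.par i y) = G y
    rw [← h1, M.chart_par j h2]

/-- The atlas of a complex surface. -/
noncomputable def core : ChartedSpaceCore (ℂ × ℂ) M.carrier where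
  atlas := range M.chart
  chartAt x := M.chart (M.cover x).choose
  mem_chart_source x := (M.cover x).choose_spec
  chart_mem_atlas x := mem_range_self _
  open_source := by
    rintro _ _ ⟨i, rfl⟩ ⟨j, rfl⟩
    exact isOpen_iff_mem_nhds.2 fun z hz => (M.transition i j hz).1
  continuousOn_toFun := by
    rintro _ _ ⟨i, rfl⟩ ⟨j, rfl⟩ z hz
    exact (M.transition i j hz).2.continuousAt.continuousWithinAt

noncomputable instance : TopologicalSpace M.carrier := M.core.toTopologicalSpace

noncomputable instance : ChartedSpace (ℂ × ℂ) M.carrier := M.core.toChartedSpace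

instance : IsManifold 𝓘(ℂ, ℂ × ℂ) ω M.carrier := by
  refine isManifold_of_contDiffOn _ _ _ ?_
  intro e e' he he' z hz
  obtain ⟨_, ⟨_, rfl⟩, hh⟩ := he
  obtain ⟨_, ⟨⟨i, rfl⟩, rfl⟩, rfl⟩ := hh
  obtain ⟨_, ⟨_, rfl⟩, hh⟩ := he'
  obtain ⟨_, ⟨⟨j, rfl⟩, rfl⟩, rfl⟩ := hh
  exact (M.transition i j hz.1).2.contDiffWithinAt

instance : T2Space M.carrier := by
  refine ⟨fun x y hxy => ?_⟩
  obtain ⟨i, z, hz, rfl⟩ := M.cover x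
  obtain ⟨j, w, hw, rfl⟩ := M.cover y
  obtain ⟨U, hU, V, hV, hUV⟩ := mem_nhds_prod_iff.1 (M.sep i j z hz w hw hxy)
  have nb : ∀ (i : M.ι) (z : ℂ × ℂ), z ∈ M.dom i → ∀ U ∈ 𝓝 z, M.par i '' U ∈ 𝓝 (M.par i z) := by
    intro i z hz U hU
    let e := M.core.openPartialHomeomorph (M.chart i) (mem_range_self i)
    exact e.symm.image_mem_nhds (x := z) hz hU
  have h1 := nb i z hz U hU
  have h2 := nb j w hw V hV
  obtain ⟨U1, hU1, oU, mU⟩ := mem_nhds_iff.1 h1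
  obtain ⟨V1, hV1, oV, mV⟩ := mem_nhds_iff.1 h2
  refine ⟨U1, V1, oU, oV, mU, mV, Set.disjoint_left.2 fun p hp hq => ?_⟩
  obtain ⟨a, ha, rfl⟩ := hU1 hp
  obtain ⟨b, hb, hab⟩ := hV1 hq
  exact hUV (mk_mem_prod ha hb) hab.symm

end ComplexSurface

/-- Homogeneous coordinates of the three standard affine charts of `ℙ²`:
`[1 : x : y]`, `[t : 1 : y]` and `[t : x : 1]`. -/
def stdVec (i : Fin 3) (z : ℂ × ℂ) : Fin 3 → ℂ :=
  match i with
  | 0 => ![1, z.1, z.2]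
  | 1 => ![z.1, 1, z.2]
  | 2 => ![z.1, z.2, 1]

/-- The two affine coordinates read off from a normalized homogeneous vector. -/
def dropCoord (i : Fin 3) (v : Fin 3 → ℂ) : ℂ × ℂ :=
  match i with
  | 0 => (v 1, v 2)
  | 1 => (v 0, v 2)
  | 2 => (v 0, v 1)

theorem stdVec_self (i : Fin 3) (z : ℂ × ℂ) : stdVec i z i = 1 := by
  fin_cases i <;> simp [stdVec]

theorem stdVec_ne (i : Fin 3) (z : ℂ × ℂ) : stdVec i z ≠ 0 := fun h => by
  have := stdVec_self i z
  simp [h] at this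

theorem dropCoord_stdVec (i : Fin 3) (z : ℂ × ℂ) : dropCoord i (stdVec i z) = z := by
  fin_cases i <;> simp [stdVec, dropCoord]

theorem stdVec_dropCoord (i : Fin 3) (v : Fin 3 → ℂ) (h : v i = 1) :
    stdVec i (dropCoord i v) = v := by
  fin_cases i <;> (ext l; fin_cases l <;> simp_all [stdVec, dropCoord])

theorem stdVec_contDiff (i l : Fin 3) : ContDiff ℂ ω (fun z => stdVec i z l) := by
  fin_cases i <;> fin_cases l <;> simp [stdVec] <;> fun_prop

/-- The point of `ℙ²` with affine coordinates `z` in the `i`-th standard chart. -/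
noncomputable def stdPar (i : Fin 3) (z : ℂ × ℂ) : ℙ ℂ (Fin 3 → ℂ) :=
  Projectivization.mk ℂ (stdVec i z) (stdVec_ne i z)

theorem stdPar_eq_iff (i j : Fin 3) (z w : ℂ × ℂ) :
    stdPar i z = stdPar j w ↔ ∃ a : ℂ, a • stdVec j w = stdVec i z :=
  Projectivization.mk_eq_mk_iff' ..

theorem stdPar_eq_iff' (i j : Fin 3) (z w : ℂ × ℂ) :
    stdPar i z = stdPar j w ↔
      ∀ l, stdVec i z j * stdVec j w l = stdVec i z l := by
  rw [stdPar_eq_iff]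
  constructor
  · rintro ⟨a, ha⟩ l
    rw [← ha]; simp [stdVec_self]
  · intro h
    exact ⟨stdVec i z j, funext h⟩

/-- The complex projective plane with its three standard charts. -/
noncomputable def projPlane : ComplexSurface where
  carrier := ℙ ℂ (Fin 3 → ℂ)
  ι := Fin 3
  dom _ := univ
  par := stdPar
  isOpen_dom _ := isOpen_univ
  injOn i := by
    intro z _ w _ h
    have h := (stdPar_eq_iff' i i z w).1 h
    simp only [stdVec_self, one_mul] at h
    rw [← dropCoord_stdVec i z, ← dropCoord_stdVec i w, funext h]
  cover := by
    intro x
    induction x using Projectivization.ind with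
    | h v hv =>
      obtain ⟨i, hi⟩ := Function.ne_iff.1 hv
      refine ⟨i, dropCoord i ((v i)⁻¹ • v), mem_univ _, ?_⟩
      refine (Projectivization.mk_eq_mk_iff' ..).2 ⟨(v i)⁻¹, ?_⟩
      rw [stdVec_dropCoord]
      simpa using inv_mul_cancel₀ hi
  compat := by
    intro i j z _ w _ h
    have h := (stdPar_eq_iff' i j z w).1 h
    have h0 : stdVec i z j ≠ 0 := by
      intro h0
      refine stdVec_ne i z (funext fun l => ?_)
      rw [← h l, h0, zero_mul]; rfl
    refine ⟨fun z' => dropCoord j ((stdVec i z' j)⁻¹ • stdVec i z'), ?_, ?_, ?_⟩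
    · have : stdVec i z = stdVec i z j • stdVec j w := funext fun l => (h l).symm
      have h2 : (stdVec i z j)⁻¹ • stdVec i z = stdVec j w := by
        conv_lhs => rw [this]
        simp only [Pi.smul_apply, stdVec_self, smul_eq_mul, mul_one]
        rw [smul_smul, inv_mul_cancel₀ h0, one_smul]
      simp only [h2, dropCoord_stdVec]
    · have hl : ∀ l, ContDiffAt ℂ ω (fun z' => (stdVec i z' j)⁻¹ * stdVec i z' l) z := fun l =>
        ((stdVec_contDiff i j).contDiffAt.inv h0).mul (stdVec_contDiff i l).contDiffAt
      fin_cases j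
      · exact (hl 1).prodMk (hl 2)
      · exact (hl 0).prodMk (hl 2)
      · exact (hl 0).prodMk (hl 1)
    · filter_upwards [(stdVec_contDiff i j).continuous.continuousAt.eventually_ne h0] with y hy
      refine (stdPar_eq_iff ..).2 ⟨(stdVec i y j)⁻¹, ?_⟩
      rw [stdVec_dropCoord]
      simpa using inv_mul_cancel₀ hy
  sep := by
    intro i j z _ w _ h
    rw [Ne, stdPar_eq_iff'] at h
    push Not at h
    obtain ⟨l, hl⟩ := h
    have c1 : Continuous fun q : (ℂ × ℂ) × (ℂ × ℂ) => stdVec i q.1 j * stdVec j q.2 l :=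
      ((stdVec_contDiff i j).continuous.comp continuous_fst).mul
        ((stdVec_contDiff j l).continuous.comp continuous_snd)
    have c2 : Continuous fun q : (ℂ × ℂ) × (ℂ × ℂ) => stdVec i q.1 l :=
      (stdVec_contDiff i l).continuous.comp continuous_fst
    filter_upwards [(isOpen_ne_fun c1 c2).mem_nhds hl] with q hq h'
    exact hq ((stdPar_eq_iff' ..).1 h' l)

/-- A complex surface with `n` distinct marked points: the `s`-th one has coordinates `ctr s` in
the chart with index `idx s`. -/
structure MarkedSurface (n : ℕ) extends ComplexSurface where
  idx : Fin n → ι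
  ctr : Fin n → ℂ × ℂ
  ctr_mem : ∀ s, ctr s ∈ dom (idx s)
  ctr_inj : Function.Injective fun s => par (idx s) (ctr s)

namespace MarkedSurface

variable {n : ℕ} (M : MarkedSurface n)

/-- The `s`-th marked point. -/
def pt (s : Fin n) : M.carrier := M.par (M.idx s) (M.ctr s)

/-- The point set of the blowup at the marked points: each marked point is replaced by the
projective line of directions in the coordinate plane `ℂ²` there. -/
abbrev BlowPts : Type := {x : M.carrier // ∀ s, x ≠ M.pt s} ⊕ (Fin n × ℙ ℂ (ℂ × ℂ))

/-- The blow-down map. -/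
def blowDown : M.BlowPts → M.carrier := Sum.elim (fun x => x.1) (fun e => M.pt e.1)

open Classical in
/-- The point of the blowup over `x`, where `d` picks the direction if `x` is a marked point
(and is ignored otherwise). -/
noncomputable def up (x : M.carrier) (d : ℙ ℂ (ℂ × ℂ)) : M.BlowPts :=
  if h : ∃ s, x = M.pt s then Sum.inr (h.choose, d) else Sum.inl ⟨x, fun s hs => h ⟨s, hs⟩⟩

theorem up_pt (s : Fin n) (d : ℙ ℂ (ℂ × ℂ)) : M.up (M.pt s) d = Sum.inr (s, d) := by
  have h : ∃ s', M.pt s = M.pt s' := ⟨s, rfl⟩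
  have h2 : h.choose = s := (M.ctr_inj h.choose_spec).symm
  rw [up, dif_pos h, h2]

theorem up_of_ne {x : M.carrier} (h : ∀ s, x ≠ M.pt s) (d : ℙ ℂ (ℂ × ℂ)) :
    M.up x d = Sum.inl ⟨x, h⟩ :=
  dif_neg fun ⟨s, hs⟩ => h s hs

theorem blowDown_up (x : M.carrier) (d : ℙ ℂ (ℂ × ℂ)) : M.blowDown (M.up x d) = x := by
  by_cases h : ∃ s, x = M.pt s
  · obtain ⟨s, rfl⟩ := h
    rw [up_pt]; rfl
  · rw [M.up_of_ne (fun s hs => h ⟨s, hs⟩)]; rfl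

/-- The two standard coordinate expressions of the blowdown of `0 ∈ ℂ²`:
`(a, b) ↦ (ab, b)` for `false` and `(a, b) ↦ (a, ab)` for `true`. -/
def blowCoord : Bool → ℂ × ℂ → ℂ × ℂ
  | false, q => (q.1 * q.2, q.2)
  | true, q => (q.1, q.1 * q.2)

/-- A direction vector of the image of the curve along which `blowCoord e` approaches `0`:
`(a, 1)` for `false` and `(1, b)` for `true`. -/
def blowVec : Bool → ℂ × ℂ → ℂ × ℂ
  | false, q => (q.1, 1)
  | true, q => (1, q.2)

theorem blowVec_ne (e : Bool) (q : ℂ × ℂ) : blowVec e q ≠ 0 := by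
  cases e <;> simp [blowVec, Prod.ext_iff]

/-- The direction `[a : 1]`, resp. `[1 : b]`. -/
noncomputable def blowDir (e : Bool) (q : ℂ × ℂ) : ℙ ℂ (ℂ × ℂ) :=
  Projectivization.mk ℂ (blowVec e q) (blowVec_ne e q)

/-- Indices of the charts of the blowup: the old ones, and two for each marked point. -/
abbrev BlowIdx : Type := M.ι ⊕ (Fin n × Bool)

/-- The chart of the old surface underlying a chart of the blowup. -/
def base : M.BlowIdx → M.ι := Sum.elim id (fun e => M.idx e.1)

/-- The coordinate expression of the blow-down map. -/
def sig : M.BlowIdx → ℂ × ℂ → ℂ × ℂ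
  | Sum.inl _, q => q
  | Sum.inr (s, e), q => M.ctr s + blowCoord e q

/-- The direction used over the marked points. -/
noncomputable def dir : M.BlowIdx → ℂ × ℂ → ℙ ℂ (ℂ × ℂ)
  | Sum.inl _, q => blowDir false q
  | Sum.inr (_, e), q => blowDir e q

/-- The parametrizations of the blowup. On an old chart this is the old parametrization; at a
marked point with local coordinates `(u, v)` centred there it is `(u, v) = (ab, b)`, with the
point `(a, 0)` going to the direction `[a : 1]`, or `(u, v) = (a, ab)`, with the point `(0, b)`
going to `[1 : b]`. -/
noncomputable def blowPar (i : M.BlowIdx) (q : ℂ × ℂ) : M.BlowPts :=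
  M.up (M.par (M.base i) (M.sig i q)) (M.dir i q)

/-- The domains of the parametrizations of the blowup: the part of the old chart which misses
the marked points, and the preimage under the coordinate map of the part of the old chart which
misses the other marked points. -/
def blowDom (i : M.BlowIdx) : Set (ℂ × ℂ) :=
  {q | M.sig i q ∈ M.dom (M.base i) ∧
    ∀ s, (∀ e, i ≠ Sum.inr (s, e)) → M.par (M.base i) (M.sig i q) ≠ M.pt s}

theorem blowCoord_contDiff (e : Bool) : ContDiff ℂ ω (blowCoord e) := by
  cases e
  · exact (contDiff_fst.mul contDiff_snd).prodMk contDiff_snd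
  · exact contDiff_fst.prodMk (contDiff_fst.mul contDiff_snd)

theorem sig_contDiff (i : M.BlowIdx) : ContDiff ℂ ω (M.sig i) := by
  rcases i with i | ⟨s, e⟩
  · exact contDiff_id
  · exact contDiff_const.add (blowCoord_contDiff e)

theorem eventually_ne_pt (i : M.ι) {z : ℂ × ℂ} (hz : z ∈ M.dom i) (s : Fin n)
    (h : M.par i z ≠ M.pt s) : ∀ᶠ y in 𝓝 z, M.par i y ≠ M.pt s := by
  have h2 := M.sep i (M.idx s) z hz (M.ctr s) (M.ctr_mem s) h
  have c : ContinuousAt (fun y : ℂ × ℂ => (y, M.ctr s)) z := by fun_prop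
  exact c h2

theorem blowDom_isOpen (i : M.BlowIdx) : IsOpen (M.blowDom i) := by
  rw [isOpen_iff_mem_nhds]
  rintro z ⟨hz, hz'⟩
  have hc : ContinuousAt (M.sig i) z := (M.sig_contDiff i).continuous.continuousAt
  have h1 : ∀ᶠ y in 𝓝 z, M.sig i y ∈ M.dom (M.base i) :=
    hc ((M.isOpen_dom _).mem_nhds hz)
  have h2 : ∀ᶠ y in 𝓝 z, ∀ s, (∀ e, i ≠ Sum.inr (s, e)) →
      M.par (M.base i) (M.sig i y) ≠ M.pt s := by
    rw [eventually_all]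
    intro s
    by_cases hs : ∀ e, i ≠ Sum.inr (s, e)
    · filter_upwards [hc (M.eventually_ne_pt _ hz s (hz' s hs))] with y hy _ using hy
    · exact Eventually.of_forall fun y h => absurd h hs
  exact h1.and h2

theorem blowDir_eq_same (e : Bool) (p q : ℂ × ℂ) (h : blowDir e p = blowDir e q) :
    blowVec e p = blowVec e q := by
  obtain ⟨a, ha⟩ := (Projectivization.mk_eq_mk_iff' ..).1 h
  cases e
  · simp only [blowVec, Prod.smul_mk, smul_eq_mul, mul_one, Prod.mk.injEq] at ha ⊢
    exact ⟨by rw [← ha.1, ha.2, one_mul], trivial⟩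
  · simp only [blowVec, Prod.smul_mk, smul_eq_mul, mul_one, Prod.mk.injEq] at ha ⊢
    exact ⟨trivial, by rw [← ha.2, ha.1, one_mul]⟩

theorem blowDir_eq_iff (p q : ℂ × ℂ) : blowDir false p = blowDir true q ↔ p.1 * q.2 = 1 := by
  rw [blowDir, blowDir, Projectivization.mk_eq_mk_iff']
  simp only [blowVec, Prod.smul_mk, smul_eq_mul, mul_one, Prod.mk.injEq]
  constructor
  · rintro ⟨a, h1, h2⟩; rw [← h1, h2]
  · intro h; exact ⟨p.1, rfl, h⟩

/-- A chart with a point over the `s`-th marked point is one of the two charts there, and the point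
lies on the exceptional curve. -/
theorem blow_over (i : M.BlowIdx) {z : ℂ × ℂ} (hz : z ∈ M.blowDom i) (s : Fin n)
    (h : M.par (M.base i) (M.sig i z) = M.pt s) :
    ∃ e, i = Sum.inr (s, e) ∧ blowCoord e z = 0 := by
  by_cases hs : ∀ e, i ≠ Sum.inr (s, e)
  · exact absurd h (hz.2 s hs)
  · push Not at hs
    obtain ⟨e, rfl⟩ := hs
    refine ⟨e, rfl, ?_⟩
    have := M.injOn _ hz.1 (M.ctr_mem s) h
    simpa [sig] using this

theorem blowPar_over (s : Fin n) (e : Bool) {z : ℂ × ℂ} (h : blowCoord e z = 0) :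
    M.blowPar (Sum.inr (s, e)) z = Sum.inr (s, blowDir e z) := by
  have : M.par (M.base (Sum.inr (s, e))) (M.sig (Sum.inr (s, e)) z) = M.pt s := by
    simp [base, sig, h, pt]
  rw [blowPar, this, up_pt]; rfl

theorem blowCoord_inj (e : Bool) (p q : ℂ × ℂ) (h : blowCoord e p = blowCoord e q)
    (h' : blowCoord e p = 0 → blowVec e p = blowVec e q) : p = q := by
  obtain ⟨a, b⟩ := p
  obtain ⟨a', b'⟩ := q
  cases e
  · simp only [blowCoord, blowVec, Prod.mk.injEq, Prod.mk_eq_zero, mul_eq_zero] at *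
    obtain ⟨h1, rfl⟩ := h
    by_cases hb : b = 0
    · simp_all
    · exact ⟨mul_right_cancel₀ hb h1, rfl⟩
  · simp only [blowCoord, blowVec, Prod.mk.injEq, Prod.mk_eq_zero, mul_eq_zero] at *
    obtain ⟨rfl, h1⟩ := h
    by_cases hb : a = 0
    · simp_all
    · exact ⟨rfl, mul_left_cancel₀ hb h1⟩

theorem blow_injOn (i : M.BlowIdx) : InjOn (M.blowPar i) (M.blowDom i) := by
  intro z hz w hw h
  have hx : M.par (M.base i) (M.sig i z) = M.par (M.base i) (M.sig i w) := by
    have := congrArg M.blowDown h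
    simpa only [blowPar, blowDown_up] using this
  have hs := M.injOn _ hz.1 hw.1 hx
  rcases i with i | ⟨s, e⟩
  · exact hs
  · have hc : blowCoord e z = blowCoord e w := by simpa [sig] using hs
    refine blowCoord_inj e z w hc fun h0 => ?_
    rw [M.blowPar_over s e h0, M.blowPar_over s e (hc ▸ h0)] at h
    simp only [Sum.inr.injEq, Prod.mk.injEq, true_and] at h
    exact blowDir_eq_same e z w h

theorem blow_cover (x : M.BlowPts) : ∃ i, ∃ z ∈ M.blowDom i, M.blowPar i z = x := by
  rcases x with ⟨x, hx⟩ | ⟨s, d⟩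
  · obtain ⟨i, z, hz, rfl⟩ := M.cover x
    exact ⟨Sum.inl i, z, ⟨hz, fun s _ => hx s⟩, M.up_of_ne hx _⟩
  · have hd : ∃ e z, blowCoord e z = 0 ∧ blowDir e z = d := by
      induction d using Projectivization.ind with
      | h v hv =>
        obtain ⟨u, v⟩ := v
        by_cases h : v = 0
        · have hu : u ≠ 0 := by rintro rfl; exact hv (by simp [h])
          refine ⟨true, (0, v / u), by simp [blowCoord], ?_⟩
          refine (Projectivization.mk_eq_mk_iff' ..).2 ⟨u⁻¹, ?_⟩
          simp [blowVec, hu, h]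
        · refine ⟨false, (u / v, 0), by simp [blowCoord], ?_⟩
          refine (Projectivization.mk_eq_mk_iff' ..).2 ⟨v⁻¹, ?_⟩
          simp [blowVec, h, div_eq_inv_mul]
    obtain ⟨e, z, h0, rfl⟩ := hd
    refine ⟨Sum.inr (s, e), z, ⟨?_, ?_⟩, M.blowPar_over s e h0⟩
    · simpa [sig, base, h0] using M.ctr_mem s
    · intro s' hs' h
      have : M.pt s = M.pt s' := by simpa [sig, base, h0, pt] using h
      have : s = s' := M.ctr_inj this
      exact hs' e (by rw [this])

/-- Away from the exceptional curve the coordinate expression of the blow-down is locally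
invertible. -/
theorem sig_inverse (i : M.BlowIdx) {z : ℂ × ℂ} (hz : z ∈ M.blowDom i)
    (h : ∀ s, M.par (M.base i) (M.sig i z) ≠ M.pt s) :
    ∃ τ : ℂ × ℂ → ℂ × ℂ, τ (M.sig i z) = z ∧ ContDiffAt ℂ ω τ (M.sig i z) ∧
      ∀ᶠ y in 𝓝 (M.sig i z), M.sig i (τ y) = y := by
  rcases i with i | ⟨s, e⟩
  · exact ⟨id, rfl, contDiffAt_id, Eventually.of_forall fun _ => rfl⟩
  · have h0 : blowCoord e z ≠ 0 := fun h0 => h s (by simp [base, sig, h0, pt])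
    obtain ⟨a, b⟩ := z
    cases e
    · have hb : b ≠ 0 := by rintro rfl; exact h0 (by simp [blowCoord])
      refine ⟨fun y => ((y.1 - (M.ctr s).1) / (y.2 - (M.ctr s).2), y.2 - (M.ctr s).2), ?_, ?_, ?_⟩
      · simp [sig, blowCoord, hb]
      · refine ContDiffAt.prodMk (ContDiffAt.div ?_ ?_ ?_) ?_
        · exact contDiffAt_fst.sub contDiffAt_const
        · exact contDiffAt_snd.sub contDiffAt_const
        · simpa [sig, blowCoord] using hb
        · exact contDiffAt_snd.sub contDiffAt_const
      · have hc : ContinuousAt (fun y : ℂ × ℂ => y.2 - (M.ctr s).2)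
          (M.sig (Sum.inr (s, false)) (a, b)) := by fun_prop
        filter_upwards [hc.eventually_ne (show _ ≠ (0 : ℂ) by simpa [sig, blowCoord] using hb)] with y hy
        ext
        · simp [sig, blowCoord, hy]
        · simp [sig, blowCoord]
    · have ha : a ≠ 0 := by rintro rfl; exact h0 (by simp [blowCoord])
      refine ⟨fun y => (y.1 - (M.ctr s).1, (y.2 - (M.ctr s).2) / (y.1 - (M.ctr s).1)), ?_, ?_, ?_⟩
      · simp [sig, blowCoord, ha]
      · refine ContDiffAt.prodMk ?_ (ContDiffAt.div ?_ ?_ ?_)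
        · exact contDiffAt_fst.sub contDiffAt_const
        · exact contDiffAt_snd.sub contDiffAt_const
        · exact contDiffAt_fst.sub contDiffAt_const
        · simpa [sig, blowCoord] using ha
      · have hc : ContinuousAt (fun y : ℂ × ℂ => y.1 - (M.ctr s).1)
          (M.sig (Sum.inr (s, true)) (a, b)) := by fun_prop
        filter_upwards [hc.eventually_ne (show _ ≠ (0 : ℂ) by simpa [sig, blowCoord] using ha)] with y hy
        ext
        · simp [sig, blowCoord]
        · simp [sig, blowCoord, mul_div_cancel₀ _ hy]

theorem up_congr {x x' : M.carrier} (hx : x = x') (h : ∀ s, x' ≠ M.pt s) (d d' : ℙ ℂ (ℂ × ℂ)) :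
    M.up x d = M.up x' d' := by
  subst hx
  rw [M.up_of_ne h, M.up_of_ne h]

theorem blow_compat (i j : M.BlowIdx) (z : ℂ × ℂ) (hz : z ∈ M.blowDom i) (w : ℂ × ℂ)
    (hw : w ∈ M.blowDom j) (h : M.blowPar i z = M.blowPar j w) :
    ∃ G : ℂ × ℂ → ℂ × ℂ, G z = w ∧ ContDiffAt ℂ ω G z ∧
      ∀ᶠ z' in 𝓝 z, M.blowPar j (G z') = M.blowPar i z' := by
  have hx : M.par (M.base i) (M.sig i z) = M.par (M.base j) (M.sig j w) := by
    have := congrArg M.blowDown h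
    simpa only [blowPar, blowDown_up] using this
  by_cases hs : ∃ s, M.par (M.base i) (M.sig i z) = M.pt s
  · obtain ⟨s, hs⟩ := hs
    obtain ⟨e, rfl, hez⟩ := M.blow_over i hz s hs
    obtain ⟨e', rfl, hew⟩ := M.blow_over j hw s (hx ▸ hs)
    have h' := h
    rw [M.blowPar_over s e hez, M.blowPar_over s e' hew] at h
    simp only [Sum.inr.injEq, Prod.mk.injEq, true_and] at h
    have fin : ∀ G : ℂ × ℂ → ℂ × ℂ, (∀ᶠ q in 𝓝 z, blowCoord e' (G q) = blowCoord e q ∧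
        blowDir e' (G q) = blowDir e q) →
        ∀ᶠ z' in 𝓝 z, M.blowPar (Sum.inr (s, e')) (G z') = M.blowPar (Sum.inr (s, e)) z' := by
      intro G hG
      filter_upwards [hG] with q hq
      simp only [blowPar, base, sig, dir, hq.1, hq.2, Sum.elim_inr]
    by_cases hee : e = e'
    · subst hee
      have hzw := M.blow_injOn _ hz hw h'
      exact ⟨id, hzw, contDiffAt_id, Eventually.of_forall fun _ => rfl⟩
    · obtain ⟨a, b⟩ := z
      obtain ⟨a', b'⟩ := w
      cases e
      · obtain rfl : e' = true := by simpa using hee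
        have hab := (blowDir_eq_iff _ _).1 h
        simp only [blowCoord, Prod.mk_eq_zero] at hab hez hew
        have ha : a ≠ 0 := left_ne_zero_of_mul_eq_one hab
        refine ⟨fun q => (q.1 * q.2, q.1⁻¹), ?_, ?_, fin _ ?_⟩
        · simp [hez.2, hew.1, eq_inv_of_mul_eq_one_right hab]
        · exact (contDiffAt_fst.mul contDiffAt_snd).prodMk (contDiffAt_fst.inv ha)
        · have hc : ContinuousAt (fun y : ℂ × ℂ => y.1) (a, b) := by fun_prop
          filter_upwards [hc.eventually_ne ha] with q hq
          refine ⟨?_, ((blowDir_eq_iff _ _).2 (mul_inv_cancel₀ hq)).symm⟩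
          simp only [blowCoord, Prod.mk.injEq, true_and]
          field_simp
      · obtain rfl : e' = false := by simpa using hee
        have hab := (blowDir_eq_iff _ _).1 h.symm
        simp only [blowCoord, Prod.mk_eq_zero] at hab hez hew
        have hb : b ≠ 0 := right_ne_zero_of_mul_eq_one hab
        refine ⟨fun q => (q.2⁻¹, q.1 * q.2), ?_, ?_, fin _ ?_⟩
        · simp [hez.1, hew.2, eq_inv_of_mul_eq_one_left hab]
        · exact (contDiffAt_snd.inv hb).prodMk (contDiffAt_fst.mul contDiffAt_snd)
        · have hc : ContinuousAt (fun y : ℂ × ℂ => y.2) (a, b) := by fun_prop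
          filter_upwards [hc.eventually_ne hb] with q hq
          refine ⟨?_, (blowDir_eq_iff _ _).2 (inv_mul_cancel₀ hq)⟩
          simp only [blowCoord, Prod.mk.injEq, and_true]
          field_simp
  · push Not at hs
    obtain ⟨G, hG, hGd, hGe⟩ := M.compat _ _ _ hz.1 _ hw.1 hx
    obtain ⟨τ, hτ, hτd, hτe⟩ := M.sig_inverse j hw (fun s => hx ▸ hs s)
    have hsd : ContDiffAt ℂ ω (M.sig i) z := (M.sig_contDiff i).contDiffAt
    have hcomp : ContDiffAt ℂ ω (fun q => G (M.sig i q)) z := hGd.comp z hsd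
    have hτd' : ContDiffAt ℂ ω τ (G (M.sig i z)) := by rwa [hG]
    refine ⟨fun q => τ (G (M.sig i q)), by simp only [hG, hτ], hτd'.comp z hcomp, ?_⟩
    have e1 : ∀ᶠ q in 𝓝 z, M.sig j (τ (G (M.sig i q))) = G (M.sig i q) :=
      hcomp.continuousAt (by rw [hG]; exact hτe)
    have e2 : ∀ᶠ q in 𝓝 z, M.par (M.base j) (G (M.sig i q)) = M.par (M.base i) (M.sig i q) :=
      hsd.continuousAt hGe
    have e3 : ∀ᶠ q in 𝓝 z, ∀ s, M.par (M.base i) (M.sig i q) ≠ M.pt s :=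
      eventually_all.2 fun s => hsd.continuousAt (M.eventually_ne_pt _ hz.1 s (hs s))
    filter_upwards [e1, e2, e3] with q h1 h2 h3
    exact M.up_congr (by rw [h1, h2]) h3 _ _

theorem blow_sep_mixed (s : Fin n) (z w : ℂ × ℂ) (hz : z ∈ M.blowDom (Sum.inr (s, false)))
    (hw : w ∈ M.blowDom (Sum.inr (s, true))) (h : z.1 * w.2 ≠ 1) :
    ∀ᶠ q : (ℂ × ℂ) × (ℂ × ℂ) in 𝓝 (z, w),
      M.blowPar (Sum.inr (s, false)) q.1 ≠ M.blowPar (Sum.inr (s, true)) q.2 := by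
  have hc : ContinuousAt (fun q : (ℂ × ℂ) × (ℂ × ℂ) => q.1.1 * q.2.2) (z, w) := by fun_prop
  filter_upwards [hc.eventually_ne h,
    prod_mem_nhds ((M.blowDom_isOpen _).mem_nhds hz) ((M.blowDom_isOpen _).mem_nhds hw)]
    with q hq hqd heq
  obtain ⟨⟨a, b⟩, ⟨a', b'⟩⟩ := q
  obtain ⟨hq1, hq2⟩ := hqd
  have hx := congrArg M.blowDown heq
  simp only [blowPar, blowDown_up] at hx
  have hc : blowCoord false (a, b) = blowCoord true (a', b') := by
    simpa [sig] using M.injOn _ hq1.1 hq2.1 hx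
  by_cases h0 : blowCoord false (a, b) = 0
  · rw [M.blowPar_over s false h0, M.blowPar_over s true (hc ▸ h0)] at heq
    simp only [Sum.inr.injEq, Prod.mk.injEq, true_and] at heq
    exact hq ((blowDir_eq_iff _ _).1 heq)
  · simp only [blowCoord, Prod.mk.injEq] at hc h0
    obtain ⟨h1, h2⟩ := hc
    have hb : b ≠ 0 := by rintro rfl; simp at h0
    apply hq
    apply mul_right_cancel₀ hb
    rw [one_mul]
    conv_rhs => rw [h2, ← h1]
    ring

theorem blow_sep (i j : M.BlowIdx) (z : ℂ × ℂ) (hz : z ∈ M.blowDom i) (w : ℂ × ℂ)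
    (hw : w ∈ M.blowDom j) (h : M.blowPar i z ≠ M.blowPar j w) :
    ∀ᶠ q : (ℂ × ℂ) × (ℂ × ℂ) in 𝓝 (z, w), M.blowPar i q.1 ≠ M.blowPar j q.2 := by
  by_cases hx : M.par (M.base i) (M.sig i z) = M.par (M.base j) (M.sig j w)
  · have hs : ∃ s, M.par (M.base i) (M.sig i z) = M.pt s := by
      by_contra hs
      push Not at hs
      exact h (M.up_congr hx (fun s => hx ▸ hs s) _ _)
    obtain ⟨s, hs⟩ := hs
    obtain ⟨e, rfl, hez⟩ := M.blow_over i hz s hs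
    obtain ⟨e', rfl, hew⟩ := M.blow_over j hw s (hx ▸ hs)
    by_cases hee : e = e'
    · subst hee
      have hzw : z ≠ w := by rintro rfl; exact h rfl
      filter_upwards [(isOpen_ne_fun continuous_fst continuous_snd).mem_nhds hzw,
        prod_mem_nhds ((M.blowDom_isOpen _).mem_nhds hz) ((M.blowDom_isOpen _).mem_nhds hw)]
        with q hq hqd heq
      exact hq (M.blow_injOn _ hqd.1 hqd.2 heq)
    · rw [M.blowPar_over s e hez, M.blowPar_over s e' hew] at h
      cases e
      · obtain rfl : e' = true := by simpa using hee
        refine M.blow_sep_mixed s z w hz hw fun h1 => h ?_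
        rw [(blowDir_eq_iff _ _).2 h1]
      · obtain rfl : e' = false := by simpa using hee
        have := M.blow_sep_mixed s w z hw hz fun h1 => h ?_
        · have hc : ContinuousAt (Prod.swap : (ℂ × ℂ) × (ℂ × ℂ) → _) (z, w) :=
            continuous_swap.continuousAt
          filter_upwards [hc this] with q hq using hq.symm
        · rw [(blowDir_eq_iff _ _).2 h1]
  · have hc : ContinuousAt (fun q : (ℂ × ℂ) × (ℂ × ℂ) => (M.sig i q.1, M.sig j q.2)) (z, w) :=
      (((M.sig_contDiff i).continuous.comp continuous_fst).prodMk
        ((M.sig_contDiff j).continuous.comp continuous_snd)).continuousAt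
    filter_upwards [hc (M.sep _ _ _ hz.1 _ hw.1 hx)] with q hq heq
    apply hq
    have := congrArg M.blowDown heq
    simpa only [blowPar, blowDown_up] using this

/-- The blowup of a surface at its marked points. -/
noncomputable def blowup : ComplexSurface where
  carrier := M.BlowPts
  ι := M.BlowIdx
  dom := M.blowDom
  par := M.blowPar
  isOpen_dom := M.blowDom_isOpen
  injOn := M.blow_injOn
  cover := M.blow_cover
  compat := M.blow_compat
  sep := M.blow_sep

/-- The point with coordinate `β` on the exceptional curve, in the chart `(ab, b)`, where it is
`(β, 0)`, or in the chart `(a, ab)`, where it is `(0, β)`. -/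
def onFiber : Bool → ℂ → ℂ × ℂ
  | false, β => (β, 0)
  | true, β => (0, β)

theorem blowCoord_onFiber (e : Bool) (β : ℂ) : blowCoord e (onFiber e β) = 0 := by
  cases e <;> simp [blowCoord, onFiber]

/-- The blowup of a surface at its marked points, with new marked points: the point with
coordinate `β s` on the exceptional curve over the `s`-th old one, in the chart chosen by `e`. -/
noncomputable def next (e : Bool) (β : Fin n → ℂ) : MarkedSurface n where
  toComplexSurface := M.blowup
  idx s := Sum.inr (s, e)
  ctr s := onFiber e (β s)
  ctr_mem s := by
    refine ⟨?_, ?_⟩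
    · simpa [sig, base, blowCoord_onFiber] using M.ctr_mem s
    · intro s' hs' h
      have : M.pt s = M.pt s' := by simpa [sig, base, blowCoord_onFiber, pt] using h
      have : s = s' := M.ctr_inj this
      exact hs' e (by rw [this])
  ctr_inj s s' h := by
    have h : M.blowPar (Sum.inr (s, e)) (onFiber e (β s)) =
      M.blowPar (Sum.inr (s', e)) (onFiber e (β s')) := h
    rw [M.blowPar_over s e (blowCoord_onFiber _ _),
      M.blowPar_over s' e (blowCoord_onFiber _ _)] at h
    simp only [Sum.inr.injEq, Prod.mk.injEq] at h
    exact h.1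

/-- The exceptional curve over the `s`-th marked point. -/
def exceptional (s : Fin n) : Set M.blowup.carrier := {x | ∃ d, x = Sum.inr (s, d)}

/-- The strict transform of `C`: the closure of the preimage of `C` minus the centres. -/
def strictTransform (C : Set M.carrier) : Set M.blowup.carrier :=
  closure (M.blowDown ⁻¹' (C \ range M.pt))

end MarkedSurface

/-- The points `w_s = g^{s-1}(c)`, `s ≥ 1`, of the orbit of `c` under `g(w) = c - 1/w`.
(The value at `s = 0` is not used.) -/
noncomputable def orbit (c : ℂ) (s : ℕ) : ℂ := (fun w => c - 1 / w)^[s - 1] c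

/-- The set `C_n` of all `c = ± 2 cos(jπ/n)`, where `0 < j < n` is prime to `n`, for which
`w_1 ⋯ w_{n-2} = 1`. -/
def admissible (n : ℕ) : Set ℝ :=
  {c | ∃ j : ℕ, 0 < j ∧ j < n ∧ j.Coprime n ∧
    (c = 2 * Real.cos (j * Real.pi / n) ∨ c = -(2 * Real.cos (j * Real.pi / n))) ∧
    ∏ i ∈ Finset.Icc 1 (n - 2), orbit (c : ℂ) i = 1}

theorem orbit_eq_sin (θ : ℝ) (N : ℕ) (h : ∀ s, 1 ≤ s → s < N → Real.sin (s * θ) ≠ 0) (s : ℕ)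
    (h1 : 1 ≤ s) (h2 : s < N) :
    orbit ((2 * Real.cos θ : ℝ) : ℂ) s = ((Real.sin ((s + 1) * θ) / Real.sin (s * θ) : ℝ) : ℂ) := by
  induction s, h1 using Nat.le_induction with
  | base =>
    have h0 := h 1 le_rfl h2
    simp only [Nat.cast_one, one_mul] at h0
    simp only [orbit, Nat.sub_self, Function.iterate_zero, id, Nat.cast_one, one_mul]
    congr 1
    rw [show (1 + 1) * θ = 2 * θ by ring, Real.sin_two_mul]
    field_simp
  | succ m hm ih =>
    have ih := ih (by omega)
    have h0 := h m hm (by omega)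
    have h3 := h (m + 1) (by omega) h2
    have hs : orbit ((2 * Real.cos θ : ℝ) : ℂ) (m + 1) =
        ((2 * Real.cos θ : ℝ) : ℂ) - 1 / orbit ((2 * Real.cos θ : ℝ) : ℂ) m := by
      obtain ⟨r, rfl⟩ : ∃ r, m = r + 1 := ⟨m - 1, by omega⟩
      simp only [orbit, Nat.add_sub_cancel, Function.iterate_succ_apply']
    rw [hs, ih, ← Complex.ofReal_one, ← Complex.ofReal_div, ← Complex.ofReal_sub]
    congr 1
    push_cast at h3 ⊢
    have e1 : Real.sin ((m + 1 + 1) * θ) =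
        2 * Real.cos θ * Real.sin ((m + 1) * θ) - Real.sin (m * θ) := by
      rw [show ((m : ℝ) + 1 + 1) * θ = (m + 1) * θ + θ by ring,
        show (m : ℝ) * θ = (m + 1) * θ - θ by ring, Real.sin_add, Real.sin_sub]
      ring
    rw [e1]
    field_simp

theorem orbit_injective {n : ℕ} {c : ℝ} (hc : c ∈ admissible n) {s s' : ℕ} (h1 : 1 ≤ s)
    (h2 : s < s') (h3 : s' < n) : orbit (c : ℂ) s ≠ orbit (c : ℂ) s' := by
  obtain ⟨j0, hj0, hjn0, hco0, hcc, -⟩ := hc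
  have hn : (n : ℝ) ≠ 0 := by
    have : 0 < n := by omega
    positivity
  obtain ⟨j, hj, hjn, hco, rfl⟩ : ∃ j : ℕ, 0 < j ∧ j < n ∧ j.Coprime n ∧
      c = 2 * Real.cos (j * Real.pi / n) := by
    rcases hcc with hcc | hcc
    · exact ⟨j0, hj0, hjn0, hco0, hcc⟩
    · refine ⟨n - j0, by omega, by omega, ?_, ?_⟩
      · exact (Nat.coprime_self_sub_left hjn0.le).2 hco0
      · rw [hcc, Nat.cast_sub hjn0.le,
          show ((n : ℝ) - j0) * Real.pi / n = Real.pi - j0 * Real.pi / n by field_simp,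
          Real.cos_pi_sub]
        ring
  set θ := (j : ℝ) * Real.pi / n with hθ
  have hsin : ∀ s, 1 ≤ s → s < n → Real.sin (s * θ) ≠ 0 := by
    intro s hs hsn h
    obtain ⟨m, hm⟩ := Real.sin_eq_zero_iff.1 h
    have h4 : (m : ℝ) * n = s * j := by
      have hpi := Real.pi_ne_zero
      rw [hθ] at hm
      field_simp at hm
      linarith
    have h5 : (n : ℤ) ∣ (s : ℤ) * j := ⟨m, by exact_mod_cast (by linarith : (s : ℝ) * j = n * m)⟩
    have h6 : n ∣ s * j := by exact_mod_cast h5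
    have h7 : n ∣ s := hco.symm.dvd_of_dvd_mul_right h6
    exact absurd (Nat.le_of_dvd (by omega) h7) (by omega)
  rw [orbit_eq_sin θ n hsin s h1 (by omega), orbit_eq_sin θ n hsin s' (by omega) h3]
  intro h
  have h := Complex.ofReal_injective h
  rw [div_eq_div_iff (hsin s h1 (by omega)) (hsin s' (by omega) h3)] at h
  have h8 := hsin 1 le_rfl (by omega)
  have h9 := hsin (s' - s) (by omega) (by omega)
  rw [Nat.cast_one, one_mul] at h8
  rw [Nat.cast_sub h2.le] at h9
  apply mul_ne_zero h8 h9
  rw [show ((s' : ℝ) - s) * θ = s' * θ - s * θ by ring, Real.sin_sub]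
  rw [show ((s : ℝ) + 1) * θ = s * θ + θ by ring,
    show ((s' : ℝ) + 1) * θ = s' * θ + θ by ring, Real.sin_add, Real.sin_add] at h
  linarith

/-- The map `f(x, y) = (y, -x + c y + ∑ a_ℓ / y^ℓ + 1 / y^k)`, the sum over even `2 ≤ ℓ ≤ k - 2`;
it is used only where `y ≠ 0`. -/
noncomputable def fMap (k : ℕ) (c : ℝ) (a : ℕ → ℂ) (z : ℂ × ℂ) : ℂ × ℂ :=
  (z.2, -z.1 + c * z.2 + ∑ l ∈ (Finset.Icc 2 (k - 2)).filter Even, a l / z.2 ^ l + 1 / z.2 ^ k)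

/-- The coefficient `b_i` of `y^i` in the power series of `y^k / q(y)`, where
`q(y) = 1 + ∑ a_ℓ y^(k - ℓ) + c y^(k + 1)`. -/
noncomputable def bCoeff (k : ℕ) (c : ℝ) (a : ℕ → ℂ) (i : ℕ) : ℂ :=
  PowerSeries.coeff i ((PowerSeries.X : PowerSeries ℂ) ^ k *
    (1 + ∑ l ∈ (Finset.Icc 2 (k - 2)).filter Even,
        PowerSeries.C (a l) * (PowerSeries.X : PowerSeries ℂ) ^ (k - l) +
      PowerSeries.C (c : ℂ) * (PowerSeries.X : PowerSeries ℂ) ^ (k + 1))⁻¹)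

/-- The coordinate, on the `j`-th exceptional curve `F_s^j` over `f^s e_2`, of the next centre of
blowup, for `1 ≤ j ≤ 2k`: it is `(w_1 ⋯ w_{s-1})^(j-2) b_{j-1}`, with empty product `1` for
`s = 0, 1`. It vanishes for `j ≤ k`, as then `b_{j-1} = 0`. -/
noncomputable def centre (k : ℕ) (c : ℝ) (a : ℕ → ℂ) (s j : ℕ) : ℂ :=
  (∏ i ∈ Finset.Icc 1 (s - 1), orbit (c : ℂ) i) ^ (j - 2) * bCoeff k c a (j - 1)

/-- The chart of `ℙ²` used at `f^s e_2`: `[t : x : 1]` for `s = 0` and `[t : 1 : y]` otherwise. -/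
def markIdx (s : ℕ) : Fin 3 := if s = 0 then 2 else 1

/-- The coordinates of `f^s e_2` in that chart. -/
noncomputable def markCtr (c : ℂ) (s : ℕ) : ℂ × ℂ := if s = 0 then (0, 0) else (0, orbit c s)

theorem mark_injective {n : ℕ} {c : ℝ} (hc : c ∈ admissible n) :
    Function.Injective fun s : Fin n => stdPar (markIdx s) (markCtr (c : ℂ) s) := by
  intro s s' h
  have h := (stdPar_eq_iff' ..).1 h
  apply Fin.ext
  by_cases hs : (s : ℕ) = 0 <;> by_cases hs' : (s' : ℕ) = 0
  · rw [hs, hs']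
  · have := h 2
    simp [hs, hs', stdVec, markIdx, markCtr] at this
  · have := h 1
    simp [hs, hs', stdVec, markIdx, markCtr] at this
  · have := h 2
    simp only [hs, hs', stdVec, markIdx, markCtr, if_false] at this
    simp only [Matrix.cons_val, one_mul] at this
    by_contra hne
    rcases lt_or_gt_of_ne hne with hlt | hlt
    · exact orbit_injective hc (by omega) hlt s'.2 this.symm
    · exact orbit_injective hc (by omega) hlt s.2 this

/-- The projective plane with the marked points `e_2 = [0 : 0 : 1]` (for `s = 0`) and
`f^s e_2 = [0 : 1 : w_s]` (for `1 ≤ s ≤ n - 1`). -/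
noncomputable def markedPlane {n : ℕ} {c : ℝ} (hc : c ∈ admissible n) : MarkedSurface n where
  toComplexSurface := projPlane
  idx s := markIdx s
  ctr s := markCtr (c : ℂ) s
  ctr_mem _ := mem_univ _
  ctr_inj := mark_injective hc

section Tower

variable (k : ℕ) (a : ℕ → ℂ) {n : ℕ} {c : ℝ} (hc : c ∈ admissible n)

/-- The tower of blowups. The first step blows up the points `f^s e_2`, `0 ≤ s < n`, and uses the
charts `(t₁, η₁) ↦ (t₁, t₁ η₁)`; the first exceptional curve is `{t₁ = 0}`. With
`(ξ₁, x₁) = (t₁, η₁)`, each further step blows up the point `(ξ_j, x_j) = (centre, 0)` for every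
`s`, and uses the charts `(ξ_{j+1}, x_{j+1}) ↦ (ξ_{j+1} x_{j+1} + centre, x_{j+1}) = (ξ_j, x_j)`;
the new exceptional curve is `{x_{j+1} = 0}`. -/
noncomputable def stage : ℕ → MarkedSurface n
  | 0 => markedPlane hc
  | m + 1 => (stage m).next (decide (m = 0)) (fun s => centre k c a s (m + 1))

/-- The blow-down of a stage of the tower to the projective plane. -/
noncomputable def toPlane : ∀ m : ℕ, (stage k a hc m).carrier → ℙ ℂ (Fin 3 → ℂ)
  | 0 => id
  | m + 1 => fun x => toPlane m ((stage k a hc m).blowDown x)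

/-- The line at infinity `Σ_0 = {x_0 = 0}` and its strict transforms in the tower. -/
noncomputable def lineAtInfinity : ∀ m : ℕ, Set (stage k a hc m).carrier
  | 0 => {p : ℙ ℂ (Fin 3 → ℂ) | p.rep 0 = 0}
  | m + 1 => (stage k a hc m).strictTransform (lineAtInfinity m)

/-- The curve `F_s^j` in the `m`-th stage of the tower, `1 ≤ j ≤ m`: the exceptional curve over the
`s`-th centre of the `j`-th step, and its strict transforms in the later stages. -/
noncomputable def fiber (j : ℕ) (s : Fin n) : ∀ m : ℕ, Set (stage k a hc m).carrier
  | 0 => (∅ : Set (ℙ ℂ (Fin 3 → ℂ)))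
  | m + 1 => if j = m + 1 then (stage k a hc m).exceptional s
      else (stage k a hc m).strictTransform (fiber j s m)

/-- The rational surface `𝒳`, the last stage of the tower after `2k + 1` steps. -/
abbrev XSurf : Type := (stage k a hc (2 * k + 1)).carrier

/-- The set `𝒫`: the union of `Σ_0` and of the `F_s^j`, `0 ≤ s ≤ n - 1`, with `j = 1` or
`3 ≤ j ≤ 2k - 1`. -/
def parabolicSet : Set (XSurf k a hc) :=
  lineAtInfinity k a hc (2 * k + 1) ∪
    {p | ∃ (s : Fin n) (j : ℕ), (j = 1 ∨ 3 ≤ j ∧ j ≤ 2 * k - 1) ∧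
      p ∈ fiber k a hc j s (2 * k + 1)}

/-- `F` is induced by `f`: it covers `f` over the affine points `[1 : x : y]` with `y ≠ 0`, where
`f` is defined. -/
def IsInducedBy (F : XSurf k a hc → XSurf k a hc) : Prop :=
  ∀ (p : XSurf k a hc) (z : ℂ × ℂ), z.2 ≠ 0 → toPlane k a hc _ p = stdPar 0 z →
    toPlane k a hc _ (F p) = stdPar 0 (fMap k c a z)

end Tower

/-!
The map `f` is the composition `σ ∘ ρ` of two involutions of the affine plane, the exchange `ρ` of
the coordinates and `σ(x, y) = (x, -y + c x + h(1/x))`, where `h(t) = ∑ a_ℓ t^ℓ + t^k`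
(`fMap_eq_sigmaMap`). Both lift to holomorphic involutions of `𝒳`, so that `f` lifts to an
automorphism.

*Coordinates.* Write `P = w_1 ⋯ w_{s-1}`. Over the `s`-th point of the line at infinity use
coordinates `(T, x)`, which are `(ξ_1, x_1)` scaled by `P`. The centres of the blowups are the
Taylor coefficients of the curve `T = r(x)`, `r(x) = x^k / q(x)`, so that `𝒳` is there the toric
tower of blowups in the coordinates `D = T - r(x)` and `x`: a neighbourhood of the finite part of
`F_s^j` has coordinates `(d, x)` with `D = d x^(j-1)` (`fiberPar`), and the corners have monomial
coordinates as well (`cornerPar`). Every point of `𝒳` is described by one of these explicit models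
or lies in the plane (`exists_model`, `exists_surfaceModel`).

*Lifting.* The affine plane is dense in `𝒳` (`affineDense_stage`), hence a map of the plane
extends to `𝒳` as soon as near every point it is given by a holomorphic germ in the models
(`AffineDense.exists_extension`), and the extension is unique. Away from the pair (`σ`, `e_2`) both
involutions are given by germs `(D, x) ↦ (D α + x^(2k) β, x u + D γ)`; because `q` is even up to
order `k`, they preserve the curve `D = 0` to order `2k`, and such germs lift through all the
blowups (`TowerGerm.fiber_lift`, `TowerGerm.corner_lift`). Near `e_2` the involution `σ` is
`(D, x) ↦ (r(x)²/D, x)` (`sigmaMap_tower`), where `r² = x^(2k) / q²`. It exchanges `F_0^j` and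
`F_0^(2k+2-j)`, and `F_0^(2k+1)` and the affine line `{x = 0}`.

*Derivatives.* In these coordinates all the derivatives are diagonal at the generic points of the
curves `F_s^j`, for `j = 1` or `3 ≤ j ≤ 2k - 1`, and on the line at infinity. Along `F_s^j` their
products over `2n` steps are signs and factors `1/d²`, which cancel
(`IsLiftPair.tangentToId_first`, `IsLiftPair.tangentToId_fiber`). On the line at infinity `f` is
`y ↦ c - 1/y` with normal derivative `1/y`; writing the orbit of `y` as a sequence of quotients of a
solution of `u_{i+1} = c u_i - u_{i-1}` shows that the product of `1/y` over `2n` steps is `1`, since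
`c = 2 cos θ` for an odd multiple `θ` of `π/n` (`exists_angle`, `lineMap_period`). Fixing a point
and being tangent to the identity there is a closed condition (`TangentToId.of_mem_closure`), so that
it holds on all of `𝒫`.
-/

/-! ### Local parametrizations of a complex surface -/

namespace ComplexSurface

variable {M N : ComplexSurface}

/-- The chart inverse to the `i`-th parametrization, as an open partial homeomorphism. -/
noncomputable def homeo (M : ComplexSurface) (i : M.ι) :
    OpenPartialHomeomorph M.carrier (ℂ × ℂ) :=
  M.core.openPartialHomeomorph (M.chart i) (mem_range_self i)

theorem homeo_mem_maximalAtlas (M : ComplexSurface) (i : M.ι) :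
    M.homeo i ∈ IsManifold.maximalAtlas 𝓘(ℂ, ℂ × ℂ) ω M.carrier := by
  apply IsManifold.subset_maximalAtlas
  change M.homeo i ∈ ⋃ (e : PartialEquiv M.carrier (ℂ × ℂ)) (he : e ∈ M.core.atlas),
    {M.core.openPartialHomeomorph e he}
  simp only [mem_iUnion]
  exact ⟨M.chart i, mem_range_self i, rfl⟩

theorem homeo_par (M : ComplexSurface) (i : M.ι) {z : ℂ × ℂ} (hz : z ∈ M.dom i) :
    M.homeo i (M.par i z) = z :=
  M.chart_par i hz

theorem contMDiffAt_par (M : ComplexSurface) (i : M.ι) {z : ℂ × ℂ} (hz : z ∈ M.dom i) :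
    ContMDiffAt 𝓘(ℂ, ℂ × ℂ) 𝓘(ℂ, ℂ × ℂ) ω (M.par i) z :=
  contMDiffAt_symm_of_mem_maximalAtlas (M.homeo_mem_maximalAtlas i) hz

theorem contMDiffAt_homeo (M : ComplexSurface) (i : M.ι) {z : ℂ × ℂ} (hz : z ∈ M.dom i) :
    ContMDiffAt 𝓘(ℂ, ℂ × ℂ) 𝓘(ℂ, ℂ × ℂ) ω (M.homeo i) (M.par i z) :=
  contMDiffAt_of_mem_maximalAtlas (M.homeo_mem_maximalAtlas i)
    ((M.homeo i).map_target (x := z) hz)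

theorem map_par_nhds (M : ComplexSurface) (i : M.ι) {z : ℂ × ℂ} (hz : z ∈ M.dom i) :
    map (M.par i) (𝓝 z) = 𝓝 (M.par i z) :=
  (M.homeo i).symm.map_nhds_eq (x := z) hz

/-- `K` is a holomorphic local parametrization of `M` near `z`: there it is one of the
parametrizations of the atlas, composed with a biholomorphic germ `A` (with inverse `B`). -/
def IsLocalPar (M : ComplexSurface) (K : ℂ × ℂ → M.carrier) (z : ℂ × ℂ) : Prop :=
  ∃ (i : M.ι) (A B : ℂ × ℂ → ℂ × ℂ), A z ∈ M.dom i ∧ ContDiffAt ℂ ω A z ∧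
    ContDiffAt ℂ ω B (A z) ∧ (∀ᶠ w in 𝓝 z, B (A w) = w) ∧ (∀ᶠ y in 𝓝 (A z), A (B y) = y) ∧
    ∀ᶠ w in 𝓝 z, K w = M.par i (A w)

theorem isLocalPar_par (M : ComplexSurface) (i : M.ι) {z : ℂ × ℂ} (hz : z ∈ M.dom i) :
    M.IsLocalPar (M.par i) z :=
  ⟨i, id, id, hz, contDiffAt_id, contDiffAt_id, .of_forall fun _ => rfl,
    .of_forall fun _ => rfl, .of_forall fun _ => rfl⟩

namespace IsLocalPar

variable {K : ℂ × ℂ → M.carrier} {K' : ℂ × ℂ → N.carrier} {z z' : ℂ × ℂ}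

theorem contMDiffAt (h : M.IsLocalPar K z) :
    ContMDiffAt 𝓘(ℂ, ℂ × ℂ) 𝓘(ℂ, ℂ × ℂ) ω K z := by
  obtain ⟨i, A, B, hz, hA, -, -, -, hK⟩ := h
  exact ((M.contMDiffAt_par i hz).comp z hA.contMDiffAt).congr_of_eventuallyEq hK

/-- A local parametrization has a holomorphic local inverse. -/
theorem exists_inverse (h : M.IsLocalPar K z) : ∃ S : M.carrier → ℂ × ℂ,
    ContMDiffAt 𝓘(ℂ, ℂ × ℂ) 𝓘(ℂ, ℂ × ℂ) ω S (K z) ∧ (∀ᶠ w in 𝓝 z, S (K w) = w) ∧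
      ∀ᶠ p in 𝓝 (K z), K (S p) = p := by
  obtain ⟨i, A, B, hz, hA, hB, hBA, hAB, hK⟩ := h
  have hKz := hK.self_of_nhds
  have hdom : ∀ᶠ w in 𝓝 z, A w ∈ M.dom i := hA.continuousAt ((M.isOpen_dom i).mem_nhds hz)
  refine ⟨fun p => B (M.homeo i p), ?_, ?_, ?_⟩
  · rw [hKz]
    have hB' : ContMDiffAt 𝓘(ℂ, ℂ × ℂ) 𝓘(ℂ, ℂ × ℂ) ω B (M.homeo i (M.par i (A z))) := by
      rw [M.homeo_par i hz]; exact hB.contMDiffAt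
    exact hB'.comp _ (M.contMDiffAt_homeo i hz)
  · filter_upwards [hBA, hK, hdom] with w h1 h2 h3
    rw [h2, M.homeo_par i h3, h1]
  · rw [hKz, ← M.map_par_nhds i hz, eventually_map]
    have hBz : Tendsto B (𝓝 (A z)) (𝓝 z) := by
      have := hB.continuousAt.tendsto
      rwa [hBA.self_of_nhds] at this
    filter_upwards [hAB, hBz hK, (M.isOpen_dom i).mem_nhds hz] with y h1 h2 h3
    rw [M.homeo_par i h3]
    have h2 : K (B y) = M.par i (A (B y)) := h2
    rw [h2, h1]

theorem map_nhds (h : M.IsLocalPar K z) : map K (𝓝 z) = 𝓝 (K z) := by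
  obtain ⟨S, hS, h1, h2⟩ := h.exists_inverse
  have hSz : Tendsto S (𝓝 (K z)) (𝓝 z) := by
    have := hS.continuousAt.tendsto
    rwa [h1.self_of_nhds] at this
  refine le_antisymm h.contMDiffAt.continuousAt ?_
  calc 𝓝 (K z) = map (K ∘ S) (𝓝 (K z)) := by
        conv_lhs => rw [← map_id (f := 𝓝 (K z))]
        exact map_congr (by filter_upwards [h2] with p hp using hp.symm)
    _ ≤ map K (𝓝 z) := by rw [← map_map]; exact map_mono hSz

/-- A map which is holomorphic at a point has a holomorphic expression in local parametrizations. -/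
theorem exists_expression (hK : M.IsLocalPar K z) (hK' : N.IsLocalPar K' z')
    {F : M.carrier → N.carrier}
    (hF : ContMDiffAt 𝓘(ℂ, ℂ × ℂ) 𝓘(ℂ, ℂ × ℂ) ω F (K z)) (h : F (K z) = K' z') :
    ∃ G : ℂ × ℂ → ℂ × ℂ, ContDiffAt ℂ ω G z ∧ G z = z' ∧ ∀ᶠ w in 𝓝 z, F (K w) = K' (G w) := by
  obtain ⟨S, hS, h1, h2⟩ := hK'.exists_inverse
  rw [← h] at hS h2
  have hFK := hF.comp z hK.contMDiffAt
  refine ⟨fun w => S (F (K w)), contMDiffAt_iff_contDiffAt.1 (hS.comp z hFK), ?_, ?_⟩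
  · simp only [h, h1.self_of_nhds]
  · filter_upwards [hFK.continuousAt h2] with w hw using hw.symm

/-- A map with a holomorphic expression in local parametrizations is holomorphic. -/
theorem contMDiffAt_of_expression (hK : M.IsLocalPar K z) {F : M.carrier → N.carrier}
    {G : ℂ × ℂ → ℂ × ℂ} (hK' : N.IsLocalPar K' (G z)) (hG : ContDiffAt ℂ ω G z)
    (h : ∀ᶠ w in 𝓝 z, F (K w) = K' (G w)) :
    ContMDiffAt 𝓘(ℂ, ℂ × ℂ) 𝓘(ℂ, ℂ × ℂ) ω F (K z) := by
  obtain ⟨S, hS, h1, h2⟩ := hK.exists_inverse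
  have hSz : S (K z) = z := h1.self_of_nhds
  have hGS : ContMDiffAt 𝓘(ℂ, ℂ × ℂ) 𝓘(ℂ, ℂ × ℂ) ω (fun p => K' (G (S p))) (K z) := by
    have a1 : ContMDiffAt 𝓘(ℂ, ℂ × ℂ) 𝓘(ℂ, ℂ × ℂ) ω G (S (K z)) := by
      rw [hSz]; exact hG.contMDiffAt
    have a2 : ContMDiffAt 𝓘(ℂ, ℂ × ℂ) 𝓘(ℂ, ℂ × ℂ) ω K' (G (S (K z))) := by
      rw [hSz]; exact hK'.contMDiffAt
    exact a2.comp (K z) (a1.comp (K z) hS)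
  refine hGS.congr_of_eventuallyEq ?_
  have hSt : Tendsto S (𝓝 (K z)) (𝓝 z) := by
    have := hS.continuousAt.tendsto
    rwa [hSz] at this
  filter_upwards [h2, hSt h] with p h3 h4
  have h4 : F (K (S p)) = K' (G (S p)) := h4
  rw [← h4, h3]

end IsLocalPar

/-! ### Tangency to the identity -/

/-- `F` fixes `p` and is tangent to the identity there: in some local parametrization it is given
by a germ with a fixed point at which the derivative is the identity. -/
def TangentToId (F : M.carrier → M.carrier) (p : M.carrier) : Prop :=
  ∃ (K : ℂ × ℂ → M.carrier) (z : ℂ × ℂ) (G : ℂ × ℂ → ℂ × ℂ), M.IsLocalPar K z ∧ K z = p ∧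
    G z = z ∧ HasFDerivAt G (ContinuousLinearMap.id ℂ (ℂ × ℂ)) z ∧
    ∀ᶠ w in 𝓝 z, F (K w) = K (G w)

/-- Conjugation by a biholomorphic germ preserves tangency to the identity. -/
theorem hasFDerivAt_conj {T S G : ℂ × ℂ → ℂ × ℂ} {z z' : ℂ × ℂ} (hT : ContDiffAt ℂ ω T z')
    (hTz : T z' = z) (hS : ContDiffAt ℂ ω S z) (hST : ∀ᶠ w in 𝓝 z', S (T w) = w)
    (hG : HasFDerivAt G (ContinuousLinearMap.id ℂ (ℂ × ℂ)) z) (hGz : G z = z) :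
    HasFDerivAt (fun w => S (G (T w))) (ContinuousLinearMap.id ℂ (ℂ × ℂ)) z' := by
  have dT : HasFDerivAt T (fderiv ℂ T z') z' := (hT.differentiableAt (by simp)).hasFDerivAt
  have dS : HasFDerivAt S (fderiv ℂ S z) z := (hS.differentiableAt (by simp)).hasFDerivAt
  have e : (fderiv ℂ S z).comp (fderiv ℂ T z') = ContinuousLinearMap.id ℂ (ℂ × ℂ) := by
    have h1 : HasFDerivAt (fun w => S (T w)) ((fderiv ℂ S z).comp (fderiv ℂ T z')) z' :=
      HasFDerivAt.comp z' (by rw [hTz]; exact dS) dT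
    exact h1.unique ((hasFDerivAt_id z').congr_of_eventuallyEq hST)
  have h1 : HasFDerivAt (fun w => G (T w))
      ((ContinuousLinearMap.id ℂ (ℂ × ℂ)).comp (fderiv ℂ T z')) z' :=
    HasFDerivAt.comp z' (by rw [hTz]; exact hG) dT
  have h2 : HasFDerivAt (fun w => S (G (T w)))
      ((fderiv ℂ S z).comp ((ContinuousLinearMap.id ℂ (ℂ × ℂ)).comp (fderiv ℂ T z'))) z' :=
    HasFDerivAt.comp z' (by rw [hTz, hGz]; exact dS) h1
  rwa [ContinuousLinearMap.id_comp, e] at h2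

namespace TangentToId

variable {F : M.carrier → M.carrier} {p : M.carrier}

theorem apply_eq (h : M.TangentToId F p) : F p = p := by
  obtain ⟨K, z, G, -, rfl, hG, -, he⟩ := h
  rw [he.self_of_nhds, hG]

/-- Tangency to the identity can be tested in any local parametrization. -/
theorem exists_germ (h : M.TangentToId F p) {K : ℂ × ℂ → M.carrier} {z : ℂ × ℂ}
    (hK : M.IsLocalPar K z) (hz : K z = p) : ∃ G : ℂ × ℂ → ℂ × ℂ, G z = z ∧
      HasFDerivAt G (ContinuousLinearMap.id ℂ (ℂ × ℂ)) z ∧ ∀ᶠ w in 𝓝 z, F (K w) = K (G w) := by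
  obtain ⟨K', z', G, hK', hz', hGz, hG, he⟩ := h
  obtain ⟨T, hT, hTz, hTe⟩ := hK.exists_expression hK' (F := id) contMDiffAt_id (hz.trans hz'.symm)
  obtain ⟨S, hS, hSz, hSe⟩ := hK'.exists_expression hK (F := id) contMDiffAt_id (hz'.trans hz.symm)
  have hTt : Tendsto T (𝓝 z) (𝓝 z') := by
    have := hT.continuousAt.tendsto
    rwa [hTz] at this
  have hGt : Tendsto G (𝓝 z') (𝓝 z') := by
    have := hG.continuousAt.tendsto
    rwa [hGz] at this
  obtain ⟨R, -, hR, -⟩ := hK.exists_inverse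
  have hSt : Tendsto S (𝓝 z') (𝓝 z) := by
    have := hS.continuousAt.tendsto
    rwa [hSz] at this
  have hST : ∀ᶠ w in 𝓝 z, S (T w) = w := by
    filter_upwards [hTe, hTt hSe, hR, hTt (hSt hR)] with w h1 h2 h3 h4
    have h2 : K' (T w) = K (S (T w)) := h2
    have h4 : R (K (S (T w))) = S (T w) := h4
    have h1 : K w = K' (T w) := h1
    rw [← h4, ← h2, ← h1, h3]
  refine ⟨fun w => S (G (T w)), by simp only [hTz, hGz, hSz],
    hasFDerivAt_conj hT hTz hS hST hG hGz, ?_⟩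
  filter_upwards [hTe, hTt he, hTt (hGt hSe)] with w h1 h2 h3
  have h1 : K w = K' (T w) := h1
  have h3 : K' (G (T w)) = K (S (G (T w))) := h3
  have h2 : F (K' (T w)) = K' (G (T w)) := h2
  rw [h1, h2, h3]

theorem hasMFDerivAt (h : M.TangentToId F p) :
    HasMFDerivAt 𝓘(ℂ, ℂ × ℂ) 𝓘(ℂ, ℂ × ℂ) F p (ContinuousLinearMap.id ℂ (ℂ × ℂ)) := by
  have hp := h.apply_eq
  set i := (M.cover p).choose with hi
  obtain ⟨z, hz, hzp⟩ : ∃ z ∈ M.dom i, M.par i z = p := (M.cover p).choose_spec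
  have hK := M.isLocalPar_par i hz
  obtain ⟨G, hGz, hG, he⟩ := h.exists_germ hK hzp
  have hch : chartAt (ℂ × ℂ) p = M.homeo i := rfl
  have hzc : M.homeo i p = z := by rw [← hzp, M.homeo_par i hz]
  refine ⟨?_, ?_⟩
  · rw [ContinuousAt, hp]
    conv_lhs => rw [← hzp, ← hK.map_nhds]
    have h1 : Tendsto (fun w => M.par i (G w)) (𝓝 z) (𝓝 p) := by
      have h2 : Tendsto (M.par i) (𝓝 (G z)) (𝓝 p) := by
        rw [hGz, ← hzp]; exact hK.contMDiffAt.continuousAt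
      exact h2.comp hG.continuousAt
    rw [tendsto_map'_iff]
    exact h1.congr' (by filter_upwards [he] with w hw using hw.symm)
  · have hdom : ∀ᶠ w in 𝓝 z, G w ∈ M.dom i :=
      hG.continuousAt (by rw [hGz]; exact (M.isOpen_dom i).mem_nhds hz)
    have key : HasFDerivAt (fun w => M.homeo i (F (M.par i w)))
        (ContinuousLinearMap.id ℂ (ℂ × ℂ)) z := by
      refine hG.congr_of_eventuallyEq ?_
      filter_upwards [he, hdom] with w h1 h2
      rw [h1, M.homeo_par i h2]
    have e1 : writtenInExtChartAt 𝓘(ℂ, ℂ × ℂ) 𝓘(ℂ, ℂ × ℂ) p F =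
        fun w => M.homeo i (F (M.par i w)) := by
      funext w
      simp only [writtenInExtChartAt, hp]
      rfl
    have e2 : extChartAt 𝓘(ℂ, ℂ × ℂ) p p = z := by
      simp only [mfld_simps, hch, hzc]
    rw [e1, e2]
    exact key.hasFDerivWithinAt

/-- Tangency to the identity is invariant under conjugation by a biholomorphic map. -/
theorem conj (h : M.TangentToId F p) {Φ Ψ : M.carrier → M.carrier}
    (hΦ : ContMDiff 𝓘(ℂ, ℂ × ℂ) 𝓘(ℂ, ℂ × ℂ) ω Φ) (hΨ : ContMDiff 𝓘(ℂ, ℂ × ℂ) 𝓘(ℂ, ℂ × ℂ) ω Ψ)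
    (hΨΦ : ∀ x, Ψ (Φ x) = x) (hΦΨ : ∀ x, Φ (Ψ x) = x) (hc : ∀ x, F (Φ x) = Φ (F x)) :
    M.TangentToId F (Φ p) := by
  obtain ⟨K, z, G, hK, rfl, hGz, hG, he⟩ := h
  obtain ⟨i, y, hy, hyp⟩ := M.cover (Φ (K z))
  have hP := M.isLocalPar_par i hy
  obtain ⟨S, hS, hSz, hSe⟩ := hK.exists_expression hP hΦ.contMDiffAt hyp.symm
  obtain ⟨T, hT, hTz, hTe⟩ := hP.exists_expression hK hΨ.contMDiffAt (by rw [hyp, hΨΦ])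
  have hTt : Tendsto T (𝓝 y) (𝓝 z) := by
    have := hT.continuousAt.tendsto
    rwa [hTz] at this
  have hGt : Tendsto G (𝓝 z) (𝓝 z) := by
    have := hG.continuousAt.tendsto
    rwa [hGz] at this
  obtain ⟨R, -, hR, -⟩ := hP.exists_inverse
  have hSt : Tendsto S (𝓝 z) (𝓝 y) := by
    have := hS.continuousAt.tendsto
    rwa [hSz] at this
  have hST : ∀ᶠ w in 𝓝 y, S (T w) = w := by
    filter_upwards [hTe, hTt hSe, hR, hTt (hSt hR)] with w h1 h2 h3 h4
    have h2 : Φ (K (T w)) = M.par i (S (T w)) := h2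
    have h4 : R (M.par i (S (T w))) = S (T w) := h4
    rw [← h4, ← h2, ← h1, hΦΨ, h3]
  refine ⟨M.par i, y, fun w => S (G (T w)), hP, hyp, by simp only [hTz, hGz, hSz],
    hasFDerivAt_conj hT hTz hS hST hG hGz, ?_⟩
  filter_upwards [hTe, hTt he, hTt (hGt hSe)] with w h1 h2 h3
  have h3 : Φ (K (G (T w))) = M.par i (S (G (T w))) := h3
  have h2 : F (K (T w)) = K (G (T w)) := h2
  rw [← h3, ← h2, ← hc, ← h1, hΦΨ]

/-- Tangency to the identity is a closed condition. -/
theorem of_mem_closure (hF : ContMDiff 𝓘(ℂ, ℂ × ℂ) 𝓘(ℂ, ℂ × ℂ) ω F) {s : Set M.carrier}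
    (hs : ∀ x ∈ s, M.TangentToId F x) (hp : p ∈ closure s) : M.TangentToId F p := by
  have hfix : F p = p := by
    have hcl : IsClosed {x | F x = x} := isClosed_eq hF.continuous continuous_id
    exact closure_minimal (fun x hx => (hs x hx).apply_eq) hcl hp
  obtain ⟨i, z, hz, rfl⟩ := M.cover p
  have hK := M.isLocalPar_par i hz
  obtain ⟨G, hG, hGz, he⟩ := hK.exists_expression hK hF.contMDiffAt hfix
  refine ⟨M.par i, z, G, hK, rfl, hGz, ?_, he⟩
  have hd : HasFDerivAt G (fderiv ℂ G z) z := (hG.differentiableAt (by simp)).hasFDerivAt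
  have hc : ContinuousAt (fderiv ℂ G) z :=
    (hG.fderiv_right (m := ω) (by simp)).continuousAt
  have hfr : ∃ᶠ w in 𝓝 z, M.par i w ∈ s := by
    have := mem_closure_iff_frequently.1 hp
    rwa [← M.map_par_nhds i hz, frequently_map] at this
  have hdom : ∀ᶠ w in 𝓝 z, w ∈ M.dom i := (M.isOpen_dom i).mem_nhds hz
  have hGc : ∀ᶠ w in 𝓝 z, ContDiffAt ℂ ω G w := hG.eventually (by simp)
  have hGd : ∀ᶠ w in 𝓝 z, G w ∈ M.dom i :=
    hG.continuousAt (by rw [hGz]; exact (M.isOpen_dom i).mem_nhds hz)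
  have hev : ∀ᶠ w in 𝓝 z, M.par i w ∈ s →
      fderiv ℂ G w = ContinuousLinearMap.id ℂ (ℂ × ℂ) := by
    filter_upwards [hdom, hGd.eventually_nhds, he.eventually_nhds] with w h1 h2 h3 hw
    obtain ⟨G', hG'w, hG', he'⟩ := (hs _ hw).exists_germ (M.isLocalPar_par i h1) rfl
    refine (hG'.congr_of_eventuallyEq ?_).fderiv
    have hd' : ∀ᶠ v in 𝓝 w, G' v ∈ M.dom i :=
      hG'.continuousAt (by rw [hG'w]; exact (M.isOpen_dom i).mem_nhds h1)
    filter_upwards [h2, h3, he', hd'] with v b1 b2 b3 b4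
    exact M.injOn i b1 b4 (by rw [← b2, b3])
  have := tendsto_nhds_unique_of_frequently_eq hc.tendsto tendsto_const_nhds
    (hfr.mp (hev.mono fun w h1 h2 => h1 h2))
  rwa [this] at hd

end TangentToId

end ComplexSurface

/-! ### Extending a map of the affine plane over a surface -/

namespace ComplexSurface

variable {X : ComplexSurface} (π : X.carrier → ℙ ℂ (Fin 3 → ℂ))

/-- The map `F` covers the affine map `τ : Z → ℂ²` at the point `p`. -/
def CoversAt (τ : ℂ × ℂ → ℂ × ℂ) (Z : Set (ℂ × ℂ)) (F : X.carrier → X.carrier)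
    (p : X.carrier) : Prop :=
  ∀ u ∈ Z, π p = stdPar 0 u → π (F p) = stdPar 0 (τ u)

/-- In some local parametrization of `X`, taking `z` to `p`, the projection `π` to the plane is
given by the germ of `φ` at `z`. -/
def Realizes (p : X.carrier) (φ : ℂ × ℂ → ℙ ℂ (Fin 3 → ℂ)) (z : ℂ × ℂ) : Prop :=
  ∃ K : ℂ × ℂ → X.carrier, X.IsLocalPar K z ∧ K z = p ∧ ∀ᶠ w in 𝓝 z, π (K w) = φ w

/-- The holomorphic germ `G` at `z` expresses the affine map `τ : Z → ℂ²` in the (possibly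
degenerate) parametrizations `φ` and `ψ` of the plane. -/
def GermCovers (τ : ℂ × ℂ → ℂ × ℂ) (Z : Set (ℂ × ℂ)) (φ : ℂ × ℂ → ℙ ℂ (Fin 3 → ℂ)) (z : ℂ × ℂ)
    (ψ : ℂ × ℂ → ℙ ℂ (Fin 3 → ℂ)) (G : ℂ × ℂ → ℂ × ℂ) : Prop :=
  ContDiffAt ℂ ω G z ∧ ∀ᶠ w in 𝓝 z, ∀ u ∈ Z, φ w = stdPar 0 u → ψ (G w) = stdPar 0 (τ u)

/-- `X` contains the affine plane: `π` is injective over it, and the part over `Z` is dense. -/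
structure AffineDense (Z : Set (ℂ × ℂ)) : Prop where
  inj : ∀ (p p' : X.carrier) (u : ℂ × ℂ), π p = stdPar 0 u → π p' = stdPar 0 u → p = p'
  dense : Dense {p | ∃ u ∈ Z, π p = stdPar 0 u}

variable {π} {τ : ℂ × ℂ → ℂ × ℂ} {Z : Set (ℂ × ℂ)}

theorem AffineDense.mono {Z' : Set (ℂ × ℂ)} (h : AffineDense π Z) (hZ : Z ⊆ Z') :
    AffineDense π Z' :=
  ⟨h.inj, h.dense.mono (by rintro _ ⟨u, hu, hp⟩; exact ⟨u, hZ hu, hp⟩)⟩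

/-- Two continuous local lifts of the same affine map agree. -/
theorem AffineDense.eventuallyEq (hZ : AffineDense π Z) {F F' : X.carrier → X.carrier}
    {p : X.carrier} (h1 : ∀ᶠ x in 𝓝 p, ContinuousAt F x) (h2 : ∀ᶠ x in 𝓝 p, ContinuousAt F' x)
    (h3 : ∀ᶠ x in 𝓝 p, CoversAt π τ Z F x) (h4 : ∀ᶠ x in 𝓝 p, CoversAt π τ Z F' x) :
    F =ᶠ[𝓝 p] F' := by
  filter_upwards [h1, h2, h3.eventually_nhds, h4.eventually_nhds] with x c1 c2 l1 l2
  refine tendsto_nhds_unique_of_frequently_eq c1.tendsto c2.tendsto ?_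
  refine (mem_closure_iff_frequently.1 (hZ.dense x)).mp ?_
  filter_upwards [l1, l2] with y m1 m2
  rintro ⟨u, hu, hy⟩
  exact hZ.inj _ _ _ (m1 u hu hy) (m2 u hu hy)

theorem eventually_continuousAt {F : X.carrier → X.carrier} {p : X.carrier}
    (h : ContMDiffAt 𝓘(ℂ, ℂ × ℂ) 𝓘(ℂ, ℂ × ℂ) ω F p) : ∀ᶠ x in 𝓝 p, ContinuousAt F x :=
  ((contMDiffAt_iff_contMDiffAt_nhds (by simp)).1 h).mono fun _ hx => hx.continuousAt

/-- A germ in local parametrizations defines a holomorphic local lift. -/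
theorem exists_local_lift {K K' : ℂ × ℂ → X.carrier} {G : ℂ × ℂ → ℂ × ℂ} {z : ℂ × ℂ}
    {φ ψ : ℂ × ℂ → ℙ ℂ (Fin 3 → ℂ)} (hK : X.IsLocalPar K z) (hφ : ∀ᶠ w in 𝓝 z, π (K w) = φ w)
    (hK' : X.IsLocalPar K' (G z)) (hψ : ∀ᶠ w in 𝓝 (G z), π (K' w) = ψ w)
    (hG : GermCovers τ Z φ z ψ G) :
    ∃ F : X.carrier → X.carrier, ContMDiffAt 𝓘(ℂ, ℂ × ℂ) 𝓘(ℂ, ℂ × ℂ) ω F (K z) ∧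
      (∀ᶠ w in 𝓝 z, F (K w) = K' (G w)) ∧ ∀ᶠ x in 𝓝 (K z), CoversAt π τ Z F x := by
  obtain ⟨S, hS, h1, h2⟩ := hK.exists_inverse
  have he : ∀ᶠ w in 𝓝 z, K' (G (S (K w))) = K' (G w) := by
    filter_upwards [h1] with w hw
    rw [hw]
  refine ⟨fun x => K' (G (S x)), hK.contMDiffAt_of_expression hK' hG.1 he, he, ?_⟩
  rw [← hK.map_nhds, eventually_map]
  filter_upwards [he, hφ, hG.2, hG.1.continuousAt hψ] with w a1 a2 a3 a4 u hu hw
  have a4 : π (K' (G w)) = ψ (G w) := a4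
  change π (K' (G (S (K w)))) = _
  rw [a1, a4]
  exact a3 u hu (a2 ▸ hw)

/-- A continuous map which covers `τ` everywhere is given, in local parametrizations, by every germ
that expresses `τ`. -/
theorem AffineDense.expression (hZ : AffineDense π Z) {F : X.carrier → X.carrier}
    (hF : Continuous F) (hFτ : ∀ p, CoversAt π τ Z F p)
    {K K' : ℂ × ℂ → X.carrier} {G : ℂ × ℂ → ℂ × ℂ} {z : ℂ × ℂ}
    {φ ψ : ℂ × ℂ → ℙ ℂ (Fin 3 → ℂ)} (hK : X.IsLocalPar K z) (hφ : ∀ᶠ w in 𝓝 z, π (K w) = φ w)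
    (hK' : X.IsLocalPar K' (G z)) (hψ : ∀ᶠ w in 𝓝 (G z), π (K' w) = ψ w)
    (hG : GermCovers τ Z φ z ψ G) : ∀ᶠ w in 𝓝 z, F (K w) = K' (G w) := by
  obtain ⟨F', hF', he, hl⟩ := exists_local_lift hK hφ hK' hψ hG
  have hFF' := hZ.eventuallyEq (.of_forall fun x => hF.continuousAt)
    (eventually_continuousAt hF') (.of_forall hFτ) hl
  rw [← hK.map_nhds] at hFF'
  filter_upwards [he, hFF'] with w h1 h2
  have h2 : F (K w) = F' (K w) := h2
  rw [h2, h1]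

/-- **Extension principle.** A map of the affine plane that has a holomorphic local lift at every
point of `X` lifts to a holomorphic map of `X`. -/
theorem AffineDense.exists_extension (hZ : AffineDense π Z)
    (h : ∀ p : X.carrier, ∃ φ z ψ G p', Realizes π p φ z ∧ Realizes π p' ψ (G z) ∧
      GermCovers τ Z φ z ψ G) :
    ∃ F : X.carrier → X.carrier, ContMDiff 𝓘(ℂ, ℂ × ℂ) 𝓘(ℂ, ℂ × ℂ) ω F ∧
      ∀ p, CoversAt π τ Z F p := by
  have h' : ∀ p : X.carrier, ∃ F : X.carrier → X.carrier,
      ContMDiffAt 𝓘(ℂ, ℂ × ℂ) 𝓘(ℂ, ℂ × ℂ) ω F p ∧ ∀ᶠ x in 𝓝 p, CoversAt π τ Z F x := by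
    intro p
    obtain ⟨φ, z, ψ, G, p', ⟨K, hK, rfl, hφ⟩, ⟨K', hK', -, hψ⟩, hG⟩ := h p
    obtain ⟨F, h1, -, h2⟩ := exists_local_lift hK hφ hK' hψ hG
    exact ⟨F, h1, h2⟩
  choose L hL hLτ using h'
  have key : ∀ p, (fun x => L x x) =ᶠ[𝓝 p] L p := by
    intro p
    filter_upwards [(eventually_continuousAt (hL p)).eventually_nhds, (hLτ p).eventually_nhds]
      with x h1 h2
    exact (hZ.eventuallyEq (eventually_continuousAt (hL x)) h1 (hLτ x) h2).self_of_nhds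
  exact ⟨fun x => L x x, fun p => (hL p).congr_of_eventuallyEq (key p),
    fun p => (hLτ p).self_of_nhds⟩

/-- Continuous maps covering the same affine map are equal. -/
theorem AffineDense.eq_of_covers (hZ : AffineDense π Z) {F F' : X.carrier → X.carrier}
    (hF : Continuous F) (hF' : Continuous F') (h : ∀ p, CoversAt π τ Z F p)
    (h' : ∀ p, CoversAt π τ Z F' p) : F = F' :=
  funext fun p => (hZ.eventuallyEq (p := p) (.of_forall fun _ => hF.continuousAt)
    (.of_forall fun _ => hF'.continuousAt) (.of_forall h) (.of_forall h')).self_of_nhds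

/-- In local parametrizations with projections `φ` and `ψ`, the map `F` takes `z` to `z'`, with
derivative `A`. -/
def DerivBetween (π : X.carrier → ℙ ℂ (Fin 3 → ℂ)) (F : X.carrier → X.carrier)
    (φ : ℂ × ℂ → ℙ ℂ (Fin 3 → ℂ)) (z : ℂ × ℂ) (ψ : ℂ × ℂ → ℙ ℂ (Fin 3 → ℂ)) (z' : ℂ × ℂ)
    (A : ℂ × ℂ →L[ℂ] ℂ × ℂ) : Prop :=
  ∀ K K' : ℂ × ℂ → X.carrier, X.IsLocalPar K z → (∀ᶠ w in 𝓝 z, π (K w) = φ w) →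
    X.IsLocalPar K' z' → (∀ᶠ w in 𝓝 z', π (K' w) = ψ w) →
    ∃ G : ℂ × ℂ → ℂ × ℂ, G z = z' ∧ HasFDerivAt G A z ∧ ∀ᶠ w in 𝓝 z, F (K w) = K' (G w)

theorem AffineDense.derivBetween (hZ : AffineDense π Z) {F : X.carrier → X.carrier}
    (hF : Continuous F) (hFτ : ∀ p, CoversAt π τ Z F p)
    {G : ℂ × ℂ → ℂ × ℂ} {z z' : ℂ × ℂ} {φ ψ : ℂ × ℂ → ℙ ℂ (Fin 3 → ℂ)}
    {A : ℂ × ℂ →L[ℂ] ℂ × ℂ} (hG : GermCovers τ Z φ z ψ G) (hz : G z = z')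
    (hA : HasFDerivAt G A z) : DerivBetween π F φ z ψ z' A := by
  intro K K' hK hφ hK' hψ
  subst hz
  exact ⟨G, rfl, hA, hZ.expression hF hFτ hK hφ hK' hψ hG⟩

theorem DerivBetween.comp {F F' : X.carrier → X.carrier} {φ φ' φ'' : ℂ × ℂ → ℙ ℂ (Fin 3 → ℂ)}
    {z z' z'' : ℂ × ℂ} {A A' : ℂ × ℂ →L[ℂ] ℂ × ℂ} (h' : DerivBetween π F' φ' z' φ'' z'' A')
    (h : DerivBetween π F φ z φ' z' A) {p : X.carrier} (hp : Realizes π p φ' z') :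
    DerivBetween π (F' ∘ F) φ z φ'' z'' (A'.comp A) := by
  intro K K'' hK hφ hK'' hφ''
  obtain ⟨K', hK', -, hφ'⟩ := hp
  obtain ⟨G, hG, hA, he⟩ := h K K' hK hφ hK' hφ'
  obtain ⟨G', hG', hA', he'⟩ := h' K' K'' hK' hφ' hK'' hφ''
  subst hG
  refine ⟨G' ∘ G, hG', hA'.comp z hA, ?_⟩
  filter_upwards [he, hA.continuousAt he'] with w h1 h2
  have h2 : F' (K' (G w)) = K'' (G' (G w)) := h2
  simp only [Function.comp, h1, h2]

theorem DerivBetween.apply_eq {F : X.carrier → X.carrier} {φ ψ : ℂ × ℂ → ℙ ℂ (Fin 3 → ℂ)}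
    {z z' : ℂ × ℂ} {A : ℂ × ℂ →L[ℂ] ℂ × ℂ} (h : DerivBetween π F φ z ψ z' A) {p p' : X.carrier}
    (hp : Realizes π p φ z) (hp' : Realizes π p' ψ z') : F p = p' := by
  obtain ⟨K, hK, rfl, hφ⟩ := hp
  obtain ⟨K', hK', rfl, hφ'⟩ := hp'
  obtain ⟨G, rfl, -, he⟩ := h K K' hK hφ hK' hφ'
  exact he.self_of_nhds

theorem DerivBetween.tangentToId {F : X.carrier → X.carrier} {φ : ℂ × ℂ → ℙ ℂ (Fin 3 → ℂ)}
    {z : ℂ × ℂ} (h : DerivBetween π F φ z φ z (ContinuousLinearMap.id ℂ (ℂ × ℂ)))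
    {p : X.carrier} (hp : Realizes π p φ z) : X.TangentToId F p := by
  obtain ⟨K, hK, rfl, hφ⟩ := hp
  obtain ⟨G, hG, hA, he⟩ := h K K hK hφ hK hφ
  exact ⟨K, z, G, hK, rfl, hG, hA, he⟩

end ComplexSurface

/-! ### The orbit of `c` under `g(w) = c - 1 / w` -/

/-- The product `w_1 ⋯ w_{s-1}`, which is `1` for `s = 0, 1`. -/
noncomputable def orbitProd (c : ℂ) (s : ℕ) : ℂ := ∏ i ∈ Finset.Icc 1 (s - 1), orbit c i

theorem orbitProd_zero (c : ℂ) : orbitProd c 0 = 1 := by simp [orbitProd]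

theorem orbitProd_one (c : ℂ) : orbitProd c 1 = 1 := by simp [orbitProd]

theorem orbitProd_succ (c : ℂ) {s : ℕ} (hs : 1 ≤ s) :
    orbitProd c (s + 1) = orbitProd c s * orbit c s := by
  obtain ⟨r, rfl⟩ : ∃ r, s = r + 1 := ⟨s - 1, by omega⟩
  simp only [orbitProd, Nat.add_sub_cancel]
  rw [Finset.prod_Icc_succ_top (by omega)]

theorem two_le_of_admissible {n : ℕ} {c : ℝ} (hc : c ∈ admissible n) : 2 ≤ n := by
  obtain ⟨j, h1, h2, -⟩ := hc
  omega

/-- Every admissible `c` is `2 cos θ` with `θ` an odd multiple of `π / n`: this is what the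
condition `w_1 ⋯ w_{n-2} = 1` selects, as `w_s = sin ((s + 1) θ) / sin (s θ)`. -/
theorem exists_angle {n : ℕ} {c : ℝ} (hc : c ∈ admissible n) : ∃ θ : ℝ, c = 2 * Real.cos θ ∧
    Real.sin (n * θ) = 0 ∧ Real.cos (n * θ) = -1 ∧
    (∀ s : ℕ, 1 ≤ s → s < n → Real.sin (s * θ) ≠ 0) ∧
    (∀ s : ℕ, 1 ≤ s → s < n →
      orbit (c : ℂ) s = ((Real.sin ((s + 1) * θ) / Real.sin (s * θ) : ℝ) : ℂ)) ∧
    ∀ s : ℕ, 1 ≤ s → s ≤ n →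
      orbitProd (c : ℂ) s = ((Real.sin (s * θ) / Real.sin θ : ℝ) : ℂ) := by
  have hn2 := two_le_of_admissible hc
  obtain ⟨j0, hj0, hjn0, hco0, hcc, hprod⟩ := hc
  have hn : (n : ℝ) ≠ 0 := by positivity
  obtain ⟨j, hj, hjn, hco, hcj⟩ : ∃ j : ℕ, 0 < j ∧ j < n ∧ j.Coprime n ∧
      c = 2 * Real.cos (j * Real.pi / n) := by
    rcases hcc with hcc | hcc
    · exact ⟨j0, hj0, hjn0, hco0, hcc⟩
    · refine ⟨n - j0, by omega, by omega, ?_, ?_⟩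
      · exact (Nat.coprime_self_sub_left hjn0.le).2 hco0
      · rw [hcc, Nat.cast_sub hjn0.le,
          show ((n : ℝ) - j0) * Real.pi / n = Real.pi - j0 * Real.pi / n by field_simp,
          Real.cos_pi_sub]
        ring
  obtain ⟨θ, hθ⟩ : ∃ θ, θ = (j : ℝ) * Real.pi / n := ⟨_, rfl⟩
  rw [← hθ] at hcj
  have hnθ : (n : ℝ) * θ = j * Real.pi := by rw [hθ]; field_simp
  have hsin : ∀ s : ℕ, 1 ≤ s → s < n → Real.sin (s * θ) ≠ 0 := by
    intro s hs hsn h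
    obtain ⟨m, hm⟩ := Real.sin_eq_zero_iff.1 h
    have h4 : (m : ℝ) * n = s * j := by
      have hpi := Real.pi_ne_zero
      rw [hθ] at hm
      field_simp at hm
      linarith
    have h5 : (n : ℤ) ∣ (s : ℤ) * j := ⟨m, by exact_mod_cast (by linarith : (s : ℝ) * j = n * m)⟩
    have h6 : n ∣ s * j := by exact_mod_cast h5
    have h7 : n ∣ s := hco.symm.dvd_of_dvd_mul_right h6
    exact absurd (Nat.le_of_dvd (by omega) h7) (by omega)
  have h1 : Real.sin θ ≠ 0 := by simpa using hsin 1 le_rfl (by omega)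
  have horb : ∀ s : ℕ, 1 ≤ s → s < n →
      orbit (c : ℂ) s = ((Real.sin ((s + 1) * θ) / Real.sin (s * θ) : ℝ) : ℂ) := by
    intro s hs hsn
    rw [hcj]
    exact orbit_eq_sin θ n hsin s hs hsn
  have hP : ∀ s : ℕ, 1 ≤ s → s ≤ n →
      orbitProd (c : ℂ) s = ((Real.sin (s * θ) / Real.sin θ : ℝ) : ℂ) := by
    intro s hs
    induction s, hs using Nat.le_induction with
    | base => intro _; rw [orbitProd_one]; simp [h1]
    | succ m hm ih =>
      intro hmn
      rw [orbitProd_succ _ hm, ih (by omega), horb m hm (by omega), ← Complex.ofReal_mul]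
      have := hsin m hm (by omega)
      congr 1
      push_cast
      field_simp
  have hs0 : Real.sin (n * θ) = 0 := by rw [hnθ]; exact Real.sin_nat_mul_pi j
  refine ⟨θ, hcj, hs0, ?_, hsin, horb, hP⟩
  have h3 := hP (n - 1) (by omega) (by omega)
  rw [orbitProd, show n - 1 - 1 = n - 2 by omega, hprod, ← Complex.ofReal_one] at h3
  have h4 := Complex.ofReal_injective h3
  rw [eq_div_iff h1, Nat.cast_sub (by omega), Nat.cast_one, sub_mul, Real.sin_sub, hs0] at h4
  have : Real.sin θ * (Real.cos (n * θ) + 1) = 0 := by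
    rw [one_mul θ] at h4
    linear_combination h4
  have := (mul_eq_zero.1 this).resolve_left h1
  linarith

section Admissible

variable {n : ℕ} {c : ℝ}

theorem orbit_ne_zero (hc : c ∈ admissible n) {s : ℕ} (h1 : 1 ≤ s) (h2 : s + 1 < n) : orbit (c : ℂ) s ≠ 0 := by
  obtain ⟨θ, -, -, -, hs, ho, -⟩ := exists_angle hc
  rw [ho s h1 (by omega)]
  have a := hs (s + 1) (by omega) h2
  push_cast at a
  exact_mod_cast div_ne_zero a (hs s h1 (by omega))

theorem orbit_last (hc : c ∈ admissible n) : orbit (c : ℂ) (n - 1) = 0 := by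
  have hn := two_le_of_admissible hc
  obtain ⟨θ, -, h0, -, hs, ho, -⟩ := exists_angle hc
  rw [ho (n - 1) (by omega) (by omega), Nat.cast_sub (by omega)]
  simp [h0]

theorem orbit_succ {s : ℕ} (h1 : 1 ≤ s) : orbit (c : ℂ) (s + 1) = c - 1 / orbit (c : ℂ) s := by
  obtain ⟨r, rfl⟩ : ∃ r, s = r + 1 := ⟨s - 1, by omega⟩
  simp only [orbit, Nat.add_sub_cancel, Function.iterate_succ_apply']

theorem orbit_mul_orbit_rev (hc : c ∈ admissible n) {s : ℕ} (h1 : 1 ≤ s) (h2 : s + 1 < n) :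
    orbit (c : ℂ) s * orbit (c : ℂ) (n - 1 - s) = 1 := by
  obtain ⟨θ, -, h0, hc1, hs, ho, -⟩ := exists_angle hc
  have key : ∀ x : ℝ, Real.sin ((n - x) * θ) = Real.sin (x * θ) := by
    intro x; rw [sub_mul, Real.sin_sub, h0, hc1]; ring
  rw [ho s h1 (by omega), ho (n - 1 - s) (by omega) (by omega)]
  have a := hs s h1 (by omega)
  have b := hs (s + 1) (by omega) h2
  rw [show n - 1 - s = n - (s + 1) by omega, Nat.cast_sub (by omega),
    show (n : ℝ) - ((s + 1 : ℕ) : ℝ) + 1 = n - s by push_cast; ring, key, key]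
  push_cast at b ⊢
  have a' : (Real.sin (s * θ) : ℂ) ≠ 0 := by exact_mod_cast a
  have b' : (Real.sin ((s + 1) * θ) : ℂ) ≠ 0 := by exact_mod_cast b
  push_cast at a' b'
  field_simp

theorem orbit_add_orbit_sub (hc : c ∈ admissible n) {s : ℕ} (h1 : 1 ≤ s) (h2 : s < n) :
    orbit (c : ℂ) s + orbit (c : ℂ) (n - s) = c := by
  obtain ⟨θ, hcθ, h0, hc1, hs, ho, -⟩ := exists_angle hc
  have key : ∀ x : ℝ, Real.sin ((n - x) * θ) = Real.sin (x * θ) := by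
    intro x; rw [sub_mul, Real.sin_sub, h0, hc1]; ring
  rw [ho s h1 h2, ho (n - s) (by omega) (by omega)]
  have a := hs s h1 h2
  rw [Nat.cast_sub h2.le, show (n : ℝ) - s + 1 = n - (s - 1) by ring, key, key,
    ← Complex.ofReal_add]
  congr 1
  rw [hcθ, ← add_div, div_eq_iff a, add_mul, sub_mul, one_mul, Real.sin_add, Real.sin_sub]
  ring

theorem orbitProd_ne_zero (hc : c ∈ admissible n) {s : ℕ} (h2 : s < n) : orbitProd (c : ℂ) s ≠ 0 := by
  rcases Nat.eq_zero_or_pos s with rfl | h1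
  · simp [orbitProd_zero]
  · obtain ⟨θ, -, -, -, hs, -, hP⟩ := exists_angle hc
    rw [hP s h1 h2.le]
    have a := hs 1 le_rfl (by omega)
    rw [Nat.cast_one, one_mul] at a
    exact_mod_cast div_ne_zero (hs s h1 h2) a

theorem orbitProd_sub (hc : c ∈ admissible n) {s : ℕ} (h1 : 1 ≤ s) (h2 : s < n) :
    orbitProd (c : ℂ) (n - s) = orbitProd (c : ℂ) s := by
  obtain ⟨θ, -, h0, hc1, hs, -, hP⟩ := exists_angle hc
  rw [hP s h1 h2.le, hP (n - s) (by omega) (by omega), Nat.cast_sub h2.le, sub_mul, Real.sin_sub,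
    h0, hc1]
  congr 2
  ring

theorem orbitProd_last (hc : c ∈ admissible n) : orbitProd (c : ℂ) (n - 1) = 1 := by
  have := orbitProd_sub hc le_rfl (two_le_of_admissible hc)
  rw [this, orbitProd_one]

end Admissible

/-! ### The power series of `y ^ k / q(y)` and its tails -/

section Series

variable (k : ℕ) (c : ℝ) (a : ℕ → ℂ)

/-- The denominator `q(x) = 1 + ∑ a_ℓ x^(k-ℓ) + c x^(k+1)`. -/
noncomputable def qFun (x : ℂ) : ℂ :=
  1 + ∑ l ∈ (Finset.Icc 2 (k - 2)).filter Even, a l * x ^ (k - l) + c * x ^ (k + 1)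

/-- The function `r(x) = x^k / q(x)`, whose Taylor coefficients are the `b_i`. -/
noncomputable def rFun (x : ℂ) : ℂ := x ^ k / qFun k c a x

/-- The polynomial `h(T) = ∑ a_ℓ T^ℓ + T^k`, for which `f(x, y) = (y, -x + c y + h(1 / y))`. -/
noncomputable def hFun (T : ℂ) : ℂ :=
  ∑ l ∈ (Finset.Icc 2 (k - 2)).filter Even, a l * T ^ l + T ^ k

theorem fMap_eq (z : ℂ × ℂ) : fMap k c a z = (z.2, -z.1 + c * z.2 + hFun k a z.2⁻¹) := by
  simp only [fMap, hFun, inv_pow, div_eq_mul_inv, one_mul, add_assoc]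

/-- Hence `1 / r(x) = c x + h(1/x)`: this is how `r` enters the involution `sigmaMap`. -/
theorem qFun_eq {x : ℂ} (hx : x ≠ 0) : qFun k c a x = x ^ k * (c * x + hFun k a x⁻¹) := by
  have h : ∀ l ∈ (Finset.Icc 2 (k - 2)).filter Even,
      a l * x ^ (k - l) = x ^ k * (a l * x⁻¹ ^ l) := by
    intro l hl
    simp only [Finset.mem_filter, Finset.mem_Icc] at hl
    rw [pow_sub₀ _ hx (by omega), inv_pow]
    ring
  rw [qFun, hFun, Finset.sum_congr rfl h, ← Finset.mul_sum, inv_pow]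
  field_simp
  ring

theorem qFun_zero : qFun k c a 0 = 1 := by
  have h : ∀ l ∈ (Finset.Icc 2 (k - 2)).filter Even, a l * (0 : ℂ) ^ (k - l) = 0 := by
    intro l hl
    simp only [Finset.mem_filter, Finset.mem_Icc] at hl
    rw [zero_pow (by omega), mul_zero]
  rw [qFun, Finset.sum_congr rfl h]
  simp

/-- Up to the term `c x^(k+1)` the function `q` is even. -/
theorem qFun_neg (hk : Even k) (x : ℂ) :
    qFun k c a (-x) = qFun k c a x - 2 * c * x ^ (k + 1) := by
  have h : ∀ l ∈ (Finset.Icc 2 (k - 2)).filter Even, a l * (-x) ^ (k - l) = a l * x ^ (k - l) := by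
    intro l hl
    simp only [Finset.mem_filter, Finset.mem_Icc] at hl
    rw [Even.neg_pow ((Nat.even_sub (by omega)).2 (by simp [hk, hl.2]))]
  rw [qFun, Finset.sum_congr rfl h, Odd.neg_pow hk.add_one, qFun]
  ring

theorem contDiff_qFun : ContDiff ℂ ω (qFun k c a) := by
  unfold qFun
  fun_prop

theorem contDiff_hFun : ContDiff ℂ ω (hFun k a) := by
  unfold hFun
  fun_prop

/-- As `q - 1` vanishes at `0` to second order, the factors `q(x)` occurring in the germs do not
contribute to derivatives. -/
theorem hasDerivAt_qFun_zero (hk : 2 ≤ k) : HasDerivAt (qFun k c a) 0 0 := by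
  have h : ∀ l ∈ (Finset.Icc 2 (k - 2)).filter Even,
      HasDerivAt (fun x : ℂ => a l * x ^ (k - l)) 0 0 := by
    intro l hl
    simp only [Finset.mem_filter, Finset.mem_Icc] at hl
    have := (hasDerivAt_pow (k - l) (0 : ℂ)).const_mul (a l)
    rwa [zero_pow (by omega), mul_zero, mul_zero] at this
  have h2 : HasDerivAt (fun x : ℂ => (c : ℂ) * x ^ (k + 1)) 0 0 := by
    have := (hasDerivAt_pow (k + 1) (0 : ℂ)).const_mul (c : ℂ)
    rwa [zero_pow (by omega), mul_zero, mul_zero] at this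
  have := ((hasDerivAt_const (0 : ℂ) (1 : ℂ)).add (HasDerivAt.fun_sum h)).add h2
  simpa [qFun] using! this

open Polynomial in
/-- Division of power series with remainder: the quotient `p / q` of polynomials minus the partial
sum of order `N` is `x^N` times a function which is polynomial up to the denominator. -/
theorem exists_remainder (p q : ℂ[X]) (hq : q.coeff 0 = 1) (N : ℕ) :
    ∃ m : ℂ[X], m.eval 0 = PowerSeries.coeff N ((p : PowerSeries ℂ) * (q : PowerSeries ℂ)⁻¹) ∧
      ∀ x, p.eval x = q.eval x * ∑ i ∈ Finset.range N,
        PowerSeries.coeff i ((p : PowerSeries ℂ) * (q : PowerSeries ℂ)⁻¹) * x ^ i +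
        x ^ N * m.eval x := by
  set S : PowerSeries ℂ := (p : PowerSeries ℂ) * (q : PowerSeries ℂ)⁻¹ with hS
  have hq0 : PowerSeries.constantCoeff (q : PowerSeries ℂ) ≠ 0 := by
    simp [hq]
  have hqS : (q : PowerSeries ℂ) * S = p := by
    rw [hS, mul_left_comm, PowerSeries.mul_inv_cancel _ hq0, mul_one]
  obtain ⟨S', hS', hS0⟩ : ∃ S' : PowerSeries ℂ,
      S = PowerSeries.X ^ N * S' + (PowerSeries.trunc N S : PowerSeries ℂ) ∧
        PowerSeries.coeff 0 S' = PowerSeries.coeff N S :=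
    ⟨_, PowerSeries.eq_X_pow_mul_shift_add_trunc N S, by simp⟩
  have h1 : ((p - q * PowerSeries.trunc N S : ℂ[X]) : PowerSeries ℂ) =
      PowerSeries.X ^ N * ((q : PowerSeries ℂ) * S') := by
    push_cast
    rw [← hqS]
    linear_combination (q : PowerSeries ℂ) * hS'
  have h2 : X ^ N ∣ p - q * PowerSeries.trunc N S := by
    rw [X_pow_dvd_iff]
    intro d hd
    rw [← coeff_coe, h1, PowerSeries.coeff_X_pow_mul', if_neg (by omega)]
  obtain ⟨m, hm⟩ := h2
  have h3 : ((m : ℂ[X]) : PowerSeries ℂ) = (q : PowerSeries ℂ) * S' := by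
    rw [hm] at h1
    push_cast at h1
    exact mul_left_cancel₀ (pow_ne_zero N PowerSeries.X_ne_zero) h1
  refine ⟨m, ?_, fun x => ?_⟩
  · rw [← coeff_zero_eq_eval_zero, ← coeff_coe, h3, ← hS0]
    simp [hq]
  · have h4 : p.eval x = (q * PowerSeries.trunc N S).eval x + (X ^ N * m).eval x := by
      rw [← hm, ← eval_add, add_sub_cancel]
    rw [h4]
    simp only [eval_mul, eval_pow, eval_X]
    congr 2
    rw [← eval₂_id, PowerSeries.eval₂_trunc_eq_sum_range]
    rfl

/-- The `N`-th tail `R_N` of `r`: an analytic function with value `b_N` at `0` and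
`r(x) = ∑_{i < N} b_i x^i + x^N R_N(x)`. -/
theorem exists_tail (N : ℕ) : ∃ R : ℂ → ℂ, (∀ x, qFun k c a x ≠ 0 → ContDiffAt ℂ ω R x) ∧
    R 0 = bCoeff k c a N ∧ ∀ x, qFun k c a x ≠ 0 →
      rFun k c a x = ∑ i ∈ Finset.range N, bCoeff k c a i * x ^ i + x ^ N * R x := by
  set q : Polynomial ℂ := 1 + ∑ l ∈ (Finset.Icc 2 (k - 2)).filter Even,
    Polynomial.C (a l) * Polynomial.X ^ (k - l) + Polynomial.C (c : ℂ) * Polynomial.X ^ (k + 1)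
    with hq
  have hqe : ∀ x, q.eval x = qFun k c a x := by
    intro x
    simp [hq, qFun, Polynomial.eval_finsetSum]
  have hqc : (q : PowerSeries ℂ) = 1 + ∑ l ∈ (Finset.Icc 2 (k - 2)).filter Even,
        PowerSeries.C (a l) * (PowerSeries.X : PowerSeries ℂ) ^ (k - l) +
      PowerSeries.C (c : ℂ) * (PowerSeries.X : PowerSeries ℂ) ^ (k + 1) := by
    rw [hq, ← Polynomial.coeToPowerSeries.ringHom_apply]
    simp only [map_add, map_one, map_sum, map_mul, map_pow]
    simp
  have hb : ∀ i, bCoeff k c a i = PowerSeries.coeff i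
      (((Polynomial.X ^ k : Polynomial ℂ) : PowerSeries ℂ) * (q : PowerSeries ℂ)⁻¹) := by
    intro i
    rw [bCoeff, hqc]
    simp
  have hq0 : q.coeff 0 = 1 := by
    rw [Polynomial.coeff_zero_eq_eval_zero, hqe, qFun_zero]
  obtain ⟨m, hm0, hm⟩ := exists_remainder (Polynomial.X ^ k) q hq0 N
  simp only [← hb] at hm0 hm
  refine ⟨fun x => m.eval x / qFun k c a x, ?_, ?_, ?_⟩
  · intro x hx
    have h1 : ContDiff ℂ ω fun x => m.eval x := m.contDiff_aeval ω
    exact h1.contDiffAt.div (contDiff_qFun k c a).contDiffAt hx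
  · simp [qFun_zero, hm0]
  · intro x hx
    have := hm x
    simp only [Polynomial.eval_pow, Polynomial.eval_X, hqe] at this
    rw [rFun, this]
    field_simp

/-- The `N`-th tail of `r`. -/
noncomputable def rTail (N : ℕ) : ℂ → ℂ := (exists_tail k c a N).choose

theorem contDiffAt_rTail (N : ℕ) {x : ℂ} (hx : qFun k c a x ≠ 0) :
    ContDiffAt ℂ ω (rTail k c a N) x :=
  (exists_tail k c a N).choose_spec.1 x hx

theorem rTail_zero (N : ℕ) : rTail k c a N 0 = bCoeff k c a N :=
  (exists_tail k c a N).choose_spec.2.1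

theorem rFun_eq_sum_add (N : ℕ) {x : ℂ} (hx : qFun k c a x ≠ 0) :
    rFun k c a x = ∑ i ∈ Finset.range N, bCoeff k c a i * x ^ i + x ^ N * rTail k c a N x :=
  (exists_tail k c a N).choose_spec.2.2 x hx

theorem bCoeff_zero (hk : k ≠ 0) : bCoeff k c a 0 = 0 := by
  have := rFun_eq_sum_add k c a 0 (x := 0) (by simp [qFun_zero])
  simp only [rFun, zero_pow hk, zero_div, Finset.range_zero, Finset.sum_empty, pow_zero, one_mul,
    zero_add, rTail_zero] at this
  exact this.symm

theorem eventually_qFun_ne_zero : ∀ᶠ x in 𝓝 (0 : ℂ), qFun k c a x ≠ 0 :=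
  (contDiff_qFun k c a).continuous.continuousAt.eventually_ne (by simp [qFun_zero])

theorem contDiffAt_rFun {x : ℂ} (hx : qFun k c a x ≠ 0) : ContDiffAt ℂ ω (rFun k c a) x := by
  unfold rFun
  exact (contDiff_id.pow k).contDiffAt.div (contDiff_qFun k c a).contDiffAt hx

end Series

/-! ### Blowups of marked surfaces -/

theorem dense_coord_ne_zero : Dense {w : ℂ × ℂ | w.1 ≠ 0 ∧ w.2 ≠ 0} :=
  (dense_compl_singleton (0 : ℂ)).prod (dense_compl_singleton (0 : ℂ))

namespace MarkedSurface

open ComplexSurface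

variable {n : ℕ} (M : MarkedSurface n)

/-- The blow-down map, on the points of the blown-up surface. -/
def proj : M.blowup.carrier → M.carrier := M.blowDown

/-- The point of the exceptional curve over the `s`-th marked point with direction `d`. -/
def excPt (s : Fin n) (d : ℙ ℂ (ℂ × ℂ)) : M.blowup.carrier := Sum.inr (s, d)

/-- The parametrization of the blowup with index `i`. -/
noncomputable def chartPar (i : M.BlowIdx) : ℂ × ℂ → M.blowup.carrier := M.blowPar i

theorem isLocalPar_chartPar (i : M.BlowIdx) {z : ℂ × ℂ} (hz : z ∈ M.blowDom i) :
    M.blowup.IsLocalPar (M.chartPar i) z :=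
  M.blowup.isLocalPar_par i hz

theorem proj_chartPar (i : M.BlowIdx) (z : ℂ × ℂ) :
    M.proj (M.chartPar i z) = M.par (M.base i) (M.sig i z) :=
  M.blowDown_up _ _

theorem chartPar_onFiber (s : Fin n) (e : Bool) (t : ℂ) :
    M.chartPar (Sum.inr (s, e)) (onFiber e t) = M.excPt s (blowDir e (onFiber e t)) :=
  M.blowPar_over s e (blowCoord_onFiber e t)

theorem exists_chartPar (x : M.blowup.carrier) : ∃ i, ∃ z ∈ M.blowDom i, M.chartPar i z = x :=
  M.blow_cover x

theorem mem_blowDom_of_blowCoord (s : Fin n) (e : Bool) {z : ℂ × ℂ} (h : blowCoord e z = 0) :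
    z ∈ M.blowDom (Sum.inr (s, e)) := by
  refine ⟨?_, ?_⟩
  · simpa [sig, base, h] using M.ctr_mem s
  · intro s' hs' h'
    have : M.pt s = M.pt s' := by simpa [sig, base, h, pt] using h'
    have : s = s' := M.ctr_inj this
    exact hs' e (by rw [this])

theorem eq_up_of_proj {p : M.carrier} (hp : ∀ s, p ≠ M.pt s) {x : M.blowup.carrier}
    (hx : M.proj x = p) (d : ℙ ℂ (ℂ × ℂ)) : x = M.up p d := by
  rcases x with x | ⟨s, e⟩
  · obtain rfl : x.1 = p := hx
    exact (M.up_of_ne hp d).symm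
  · exact absurd hx.symm (hp s)

/-- Away from the centres a blowup does not change local parametrizations. -/
theorem realizes_blowup {π : M.carrier → ℙ ℂ (Fin 3 → ℂ)} {p : M.carrier}
    (hp : ∀ s, p ≠ M.pt s) {φ : ℂ × ℂ → ℙ ℂ (Fin 3 → ℂ)} {z : ℂ × ℂ}
    (h : Realizes (X := M.toComplexSurface) π p φ z) {x : M.blowup.carrier}
    (hx : M.proj x = p) :
    Realizes (X := M.blowup) (fun y => π (M.proj y)) x φ z := by
  obtain ⟨K, hK, rfl, hφ⟩ := h
  have hne : ∀ᶠ w in 𝓝 z, ∀ s, K w ≠ M.pt s :=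
    eventually_all.2 fun s => hK.contMDiffAt.continuousAt.eventually_ne (hp s)
  obtain ⟨i, A, B, hz, hA, hB, hBA, hAB, he⟩ := hK
  refine ⟨fun w => M.up (K w) (blowDir false 0), ?_, (M.eq_up_of_proj hp hx _).symm, ?_⟩
  · refine ⟨Sum.inl i, A, B, ⟨hz, fun s _ => ?_⟩, hA, hB, hBA, hAB, ?_⟩
    · have := hp s
      rwa [he.self_of_nhds] at this
    · filter_upwards [he, hne] with w h1 h2
      rw [h1] at h2
      exact M.up_congr h1 h2 _ _
  · filter_upwards [hφ] with w hw
    exact (congrArg π (M.blowDown_up _ _)).trans hw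

theorem next_pt (e : Bool) (β : Fin n → ℂ) (s : Fin n) :
    (M.next e β).pt s = M.excPt s (blowDir e (onFiber e (β s))) :=
  M.blowPar_over s e (blowCoord_onFiber _ _)

theorem proj_next_pt (e : Bool) (β : Fin n → ℂ) (s : Fin n) :
    M.proj ((M.next e β).pt s) = M.pt s := by
  rw [next_pt]
  rfl

theorem map_proj_nhds {x : M.blowup.carrier} (hx : ∀ s, M.proj x ≠ M.pt s) :
    map M.proj (𝓝 x) = 𝓝 (M.proj x) := by
  obtain ⟨i, z, hz, h⟩ := M.cover (M.proj x)
  have hz' : z ∈ M.blowDom (Sum.inl i) := ⟨hz, fun s _ => by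
    have := hx s
    rwa [← h] at this⟩
  have hxz : x = M.chartPar (Sum.inl i) z := by
    refine (M.eq_up_of_proj hx rfl (M.dir (Sum.inl i) z)).trans ?_
    rw [← h]
    rfl
  have h2 : M.proj x = M.par i z := h.symm
  rw [h2, ← M.map_par_nhds i hz]
  subst hxz
  rw [← (M.isLocalPar_chartPar _ hz').map_nhds, map_map]
  congr 1
  funext w
  exact M.proj_chartPar _ _

theorem mem_closure_preimage {x : M.blowup.carrier} (hx : ∀ s, M.proj x ≠ M.pt s)
    {D : Set M.carrier} (h : M.proj x ∈ closure D) : x ∈ closure (M.proj ⁻¹' D) := by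
  rw [mem_closure_iff_frequently] at h ⊢
  rwa [← M.map_proj_nhds hx, frequently_map] at h

/-- A subset of `D` which is dense in `C` remains dense in the strict transform. -/
theorem strictTransform_subset {C D : Set M.carrier} (h : C ⊆ closure D) :
    M.strictTransform C ⊆ closure (M.proj ⁻¹' D) := by
  refine closure_minimal ?_ isClosed_closure
  rintro x ⟨h1, h2⟩
  exact M.mem_closure_preimage (fun s hs => h2 ⟨s, hs.symm⟩) (h h1)

/-- The exceptional curves have no interior points. -/
theorem dense_preimage_proj {D : Set M.carrier} (hD : Dense D) : Dense (M.proj ⁻¹' D) := by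
  intro x
  by_cases hx : ∀ s, M.proj x ≠ M.pt s
  · exact M.mem_closure_preimage hx (hD _)
  push Not at hx
  obtain ⟨s, hs⟩ := hx
  obtain ⟨i, z, hz, rfl⟩ := M.exists_chartPar x
  rw [M.proj_chartPar] at hs
  obtain ⟨e, rfl, -⟩ := M.blow_over i hz s hs
  rw [← isClosed_closure.closure_eq, mem_closure_iff_frequently,
    ← (M.isLocalPar_chartPar _ hz).map_nhds, frequently_map]
  have h1 := mem_closure_iff_frequently.1 (dense_coord_ne_zero z)
  refine (h1.and_eventually ((M.blowDom_isOpen _).mem_nhds hz)).mono ?_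
  rintro w ⟨⟨hw1, hw2⟩, hw⟩
  refine M.mem_closure_preimage (fun s' h' => ?_) (hD _)
  rw [M.proj_chartPar] at h'
  obtain ⟨e', -, h0⟩ := M.blow_over _ hw s' h'
  cases e' <;> simp [blowCoord, hw1, hw2] at h0

/-- Points of an exceptional curve, seen from the chart `(ab, b)`. -/
theorem exceptional_direction (d : ℙ ℂ (ℂ × ℂ)) :
    (∃ a, d = blowDir false (a, 0)) ∨ d = blowDir true (0, 0) := by
  induction d using Projectivization.ind with
  | h v hv =>
    obtain ⟨u, v⟩ := v
    by_cases h : v = 0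
    · have hu : u ≠ 0 := by rintro rfl; exact hv (by simp [h])
      refine Or.inr ((Projectivization.mk_eq_mk_iff' ..).2 ⟨u, ?_⟩)
      simp [blowVec, h]
    · refine Or.inl ⟨u / v, (Projectivization.mk_eq_mk_iff' ..).2 ⟨v, ?_⟩⟩
      simp [blowVec, h, mul_div_cancel₀]

/-- Points of an exceptional curve, seen from the chart `(a, ab)`. -/
theorem exceptional_direction' (d : ℙ ℂ (ℂ × ℂ)) :
    (∃ b, d = blowDir true (0, b)) ∨ d = blowDir false (0, 0) := by
  rcases exceptional_direction d with ⟨a, rfl⟩ | rfl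
  · by_cases ha : a = 0
    · exact Or.inr (by rw [ha])
    · exact Or.inl ⟨a⁻¹, (blowDir_eq_iff _ _).2 (mul_inv_cancel₀ ha)⟩
  · exact Or.inl ⟨0, rfl⟩

/-- A cofinite part of an exceptional curve is dense in it. -/
theorem exceptional_subset_closure (s : Fin n) {E : Set (ℙ ℂ (ℂ × ℂ))} (hE : E.Finite) :
    M.exceptional s ⊆ closure {x | ∃ d ∉ E, x = M.excPt s d} := by
  have key : ∀ (e : Bool) (b : ℂ), M.excPt s (blowDir e (onFiber e b)) ∈
      closure {x | ∃ d ∉ E, x = M.excPt s d} := by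
    intro e b
    have hfin : {t : ℂ | blowDir e (onFiber e t) ∈ E}.Finite := by
      refine hE.preimage fun t _ t' _ h => ?_
      have := blowDir_eq_same e _ _ h
      cases e <;> simpa [blowVec, onFiber] using this
    have hd : Dense {t : ℂ | blowDir e (onFiber e t) ∈ E}ᶜ := hfin.countable.dense_compl ℂ
    have hz : onFiber e b ∈ M.blowDom (Sum.inr (s, e)) :=
      M.mem_blowDom_of_blowCoord s e (blowCoord_onFiber e b)
    have hc : ContinuousAt (fun t => M.chartPar (Sum.inr (s, e)) (onFiber e t)) b := by
      have h1 : ContinuousAt (onFiber e) b := by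
        cases e
        · exact (by fun_prop : Continuous fun t : ℂ => (t, (0 : ℂ))).continuousAt
        · exact (by fun_prop : Continuous fun t : ℂ => ((0 : ℂ), t)).continuousAt
      exact (M.isLocalPar_chartPar _ hz).contMDiffAt.continuousAt.comp h1
    rw [← M.chartPar_onFiber s e b, mem_closure_iff_frequently]
    exact hc.tendsto.frequently ((mem_closure_iff_frequently.1 (hd b)).mono
      fun t ht => ⟨_, ht, M.chartPar_onFiber s e t⟩)
  rintro x ⟨d, rfl⟩
  rcases exceptional_direction d with ⟨b, rfl⟩ | rfl
  · exact key false b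
  · exact key true 0

end MarkedSurface

/-! ### Parametrizations of the tower -/

open ComplexSurface MarkedSurface

section Models

variable (k : ℕ) (c : ℝ) (a : ℕ → ℂ)

/-- Coordinates `(T, x)` near the curve `F_s^1`: up to the scaling by `P = w_1 ⋯ w_{s-1}`, which
makes the centres of the blowups independent of `s`, these are `(ξ_1, x_1)`. -/
noncomputable def towerPar (s : ℕ) (z : ℂ × ℂ) : ℙ ℂ (Fin 3 → ℂ) :=
  stdPar (markIdx s) (markCtr c s +
    (z.1 / orbitProd c s, z.1 * z.2 / orbitProd c s ^ 2))

/-- Coordinates `(d, x)` near the finite part of the curve `F_s^j`. Here `T = r(x) + d x^(j-1)`, so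
that the next centre is at `d = 0`. -/
noncomputable def fiberPar (j s : ℕ) (z : ℂ × ℂ) : ℙ ℂ (Fin 3 → ℂ) :=
  towerPar c s (rFun k c a z.2 + z.1 * z.2 ^ (j - 1), z.2)

/-- Coordinates near the point where `F_s^(j+1)` meets the strict transform of `F_s^j` (for `j ≥ 2`)
or of `{x_1 = 0}` (for `j = 1`). Here `d = a` and `x = a b` for the coordinates `(d, x)` of
`fiberPar j`. -/
noncomputable def cornerPar (j s : ℕ) (z : ℂ × ℂ) : ℙ ℂ (Fin 3 → ℂ) :=
  towerPar c s (rFun k c a (z.1 * z.2) + z.1 ^ j * z.2 ^ (j - 1), z.1 * z.2)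

/-- Coordinates near the point where `F_s^1` meets the line at infinity. -/
noncomputable def lineCornerPar (s : ℕ) (z : ℂ × ℂ) : ℙ ℂ (Fin 3 → ℂ) :=
  stdPar (markIdx s) (markCtr c s + blowCoord false z)

theorem cornerPar_eq {j : ℕ} (hj : 1 ≤ j) (s : ℕ) (z : ℂ × ℂ) :
    cornerPar k c a j s z = fiberPar k c a j s (z.1, z.1 * z.2) := by
  obtain ⟨i, rfl⟩ : ∃ i, j = i + 1 := ⟨j - 1, by omega⟩
  simp only [cornerPar, fiberPar, Nat.add_sub_cancel]
  congr 3
  ring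

/-- The coordinate change from `(d, x)` to the coordinates `(ξ_j, x_j)` of the tower, `j = m + 1`,
for the value `P` of `w_1 ⋯ w_{s-1}`. -/
noncomputable def fiberCoord (P : ℂ) (m : ℕ) (z : ℂ × ℂ) : ℂ × ℂ :=
  (P ^ m * P⁻¹ * (z.1 + rTail k c a m z.2), z.2 / P)

/-- The inverse of `fiberCoord`. -/
noncomputable def fiberCoordInv (P : ℂ) (m : ℕ) (y : ℂ × ℂ) : ℂ × ℂ :=
  (P * (P ^ m)⁻¹ * y.1 - rTail k c a m (P * y.2), P * y.2)

/-- The coordinate change of `cornerPar`, to the coordinates of the tower centred at the blown-up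
point of `F_s^j`, `j = m + 1`. -/
noncomputable def cornerCoord (P : ℂ) (m : ℕ) (z : ℂ × ℂ) : ℂ × ℂ :=
  (P ^ m * P⁻¹ * (z.1 * (1 + z.2 * rTail k c a (m + 1) (z.1 * z.2))),
    z.2 / (P ^ m * (1 + z.2 * rTail k c a (m + 1) (z.1 * z.2))))

/-- The inverse of `cornerCoord`. -/
noncomputable def cornerCoordInv (P : ℂ) (m : ℕ) (y : ℂ × ℂ) : ℂ × ℂ :=
  (P * (P ^ m)⁻¹ * y.1 * (1 - P ^ m * y.2 * rTail k c a (m + 1) (P * (y.1 * y.2))),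
    P ^ m * y.2 / (1 - P ^ m * y.2 * rTail k c a (m + 1) (P * (y.1 * y.2))))

theorem rTail_eq_add (m : ℕ) {x : ℂ} (hx : qFun k c a x ≠ 0) :
    rTail k c a m x = bCoeff k c a m + x * rTail k c a (m + 1) x := by
  by_cases h : x = 0
  · subst h
    rw [rTail_zero, zero_mul, add_zero]
  · have h1 := rFun_eq_sum_add k c a m hx
    have h2 := rFun_eq_sum_add k c a (m + 1) hx
    rw [Finset.sum_range_succ] at h2
    apply mul_left_cancel₀ (pow_ne_zero m h)
    rw [h1] at h2
    linear_combination h2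

variable {P : ℂ} (m : ℕ)

theorem contDiffAt_fiberCoord {z : ℂ × ℂ} (hz : qFun k c a z.2 ≠ 0) :
    ContDiffAt ℂ ω (fiberCoord k c a P m) z := by
  unfold fiberCoord
  have h : ContDiffAt ℂ ω (fun w : ℂ × ℂ => rTail k c a m w.2) z :=
    ContDiffAt.comp z (contDiffAt_rTail k c a m hz) contDiffAt_snd
  exact (contDiffAt_const.mul (contDiffAt_fst.add h)).prodMk (contDiffAt_snd.div_const P)

theorem contDiffAt_fiberCoordInv {z : ℂ × ℂ} (hz : qFun k c a (P * z.2) ≠ 0) :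
    ContDiffAt ℂ ω (fiberCoordInv k c a P m) z := by
  unfold fiberCoordInv
  have h0 : ContDiffAt ℂ ω (fun w : ℂ × ℂ => P * w.2) z := contDiffAt_const.mul contDiffAt_snd
  have h : ContDiffAt ℂ ω (fun w : ℂ × ℂ => rTail k c a m (P * w.2)) z :=
    ContDiffAt.comp z (contDiffAt_rTail k c a m hz) h0
  exact ((contDiffAt_const.mul contDiffAt_fst).sub h).prodMk h0

theorem fiberCoordInv_fiberCoord (hP : P ≠ 0) (z : ℂ × ℂ) :
    fiberCoordInv k c a P m (fiberCoord k c a P m z) = z := by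
  ext
  · simp only [fiberCoord, fiberCoordInv, mul_div_cancel₀ _ hP]
    field_simp
    ring
  · simp only [fiberCoord, fiberCoordInv, mul_div_cancel₀ _ hP]

theorem fiberCoord_fiberCoordInv (hP : P ≠ 0) (y : ℂ × ℂ) :
    fiberCoord k c a P m (fiberCoordInv k c a P m y) = y := by
  ext
  · simp only [fiberCoord, fiberCoordInv]
    field_simp
    ring
  · simp only [fiberCoord, fiberCoordInv]
    field_simp

/-- A parametrization of the atlas, in the coordinates `(d, x)`. -/
theorem isLocalPar_fiberCoord (M : ComplexSurface) (i : M.ι) {P : ℂ} (hP : P ≠ 0) (m : ℕ)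
    {z : ℂ × ℂ} (hz : qFun k c a z.2 ≠ 0) (hd : fiberCoord k c a P m z ∈ M.dom i) :
    M.IsLocalPar (fun w => M.par i (fiberCoord k c a P m w)) z := by
  refine ⟨i, _, fiberCoordInv k c a P m, hd, contDiffAt_fiberCoord k c a m hz,
    contDiffAt_fiberCoordInv k c a m ?_, .of_forall (fiberCoordInv_fiberCoord k c a m hP),
    .of_forall (fiberCoord_fiberCoordInv k c a m hP), .of_forall fun _ => rfl⟩
  simpa only [fiberCoord, mul_div_cancel₀ _ hP] using hz

theorem isLocalPar_cornerCoord (M : ComplexSurface) (i : M.ι) {P : ℂ} (hP : P ≠ 0) (m : ℕ)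
    (hd : (0, 0) ∈ M.dom i) :
    M.IsLocalPar (fun w => M.par i (cornerCoord k c a P m w)) (0, 0) := by
  have h0 : cornerCoord k c a P m (0, 0) = (0, 0) := by simp [cornerCoord]
  have hq0 : qFun k c a (0 : ℂ) ≠ 0 := by simp [qFun_zero]
  have hR : ContDiffAt ℂ ω (fun w : ℂ × ℂ => rTail k c a (m + 1) (w.1 * w.2)) (0, 0) :=
    ContDiffAt.comp (0, 0) (contDiffAt_rTail k c a (m + 1) (by simpa using hq0))
      (contDiffAt_fst.mul contDiffAt_snd)
  have hR' : ContDiffAt ℂ ω (fun w : ℂ × ℂ => rTail k c a (m + 1) (P * (w.1 * w.2))) (0, 0) :=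
    ContDiffAt.comp (0, 0) (contDiffAt_rTail k c a (m + 1) (by simpa using hq0))
      (contDiffAt_const.mul (contDiffAt_fst.mul contDiffAt_snd))
  have hU : ContDiffAt ℂ ω (fun w : ℂ × ℂ => 1 + w.2 * rTail k c a (m + 1) (w.1 * w.2)) (0, 0) :=
    contDiffAt_const.add (contDiffAt_snd.mul hR)
  have hV : ContDiffAt ℂ ω
      (fun w : ℂ × ℂ => 1 - P ^ m * w.2 * rTail k c a (m + 1) (P * (w.1 * w.2))) (0, 0) :=
    contDiffAt_const.sub ((contDiffAt_const.mul contDiffAt_snd).mul hR')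
  have hU0 : ∀ᶠ w : ℂ × ℂ in 𝓝 (0, 0), 1 + w.2 * rTail k c a (m + 1) (w.1 * w.2) ≠ 0 :=
    hU.continuousAt.eventually_ne (by simp)
  have hV0 : ∀ᶠ w : ℂ × ℂ in 𝓝 (0, 0),
      1 - P ^ m * w.2 * rTail k c a (m + 1) (P * (w.1 * w.2)) ≠ 0 :=
    hV.continuousAt.eventually_ne (by simp)
  have hPm := pow_ne_zero m hP
  refine ⟨i, _, cornerCoordInv k c a P m, by rwa [h0], ?_, ?_, ?_, ?_, .of_forall fun _ => rfl⟩
  · exact (contDiffAt_const.mul (contDiffAt_fst.mul hU)).prodMk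
      (contDiffAt_snd.div (contDiffAt_const.mul hU) (by simp [hP]))
  · rw [h0]
    exact ((contDiffAt_const.mul contDiffAt_fst).mul hV).prodMk
      ((contDiffAt_const.mul contDiffAt_snd).div hV (by simp))
  · filter_upwards [hU0] with w hw
    have e : P * ((cornerCoord k c a P m w).1 * (cornerCoord k c a P m w).2) = w.1 * w.2 := by
      simp only [cornerCoord]
      generalize rTail k c a (m + 1) (w.1 * w.2) = R at hw ⊢
      field_simp
    simp only [cornerCoordInv, e]
    simp only [cornerCoord]
    generalize rTail k c a (m + 1) (w.1 * w.2) = R at hw ⊢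
    have e1 : 1 - P ^ m * (w.2 / (P ^ m * (1 + w.2 * R))) * R = (1 + w.2 * R)⁻¹ := by
      field_simp
      ring
    simp only [e1]
    ext <;> simp only <;> field_simp
  · rw [h0]
    filter_upwards [hV0] with w hw
    have e : (cornerCoordInv k c a P m w).1 * (cornerCoordInv k c a P m w).2 =
        P * (w.1 * w.2) := by
      simp only [cornerCoordInv]
      generalize rTail k c a (m + 1) (P * (w.1 * w.2)) = R at hw ⊢
      field_simp
    simp only [cornerCoord, e]
    simp only [cornerCoordInv]
    generalize rTail k c a (m + 1) (P * (w.1 * w.2)) = R at hw ⊢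
    have e1 : 1 + P ^ m * w.2 / (1 - P ^ m * w.2 * R) * R = (1 - P ^ m * w.2 * R)⁻¹ := by
      field_simp
      ring
    simp only [e1]
    ext <;> simp only <;> field_simp

end Models

/-! ### Local coordinates on the stages of the tower -/

section Stages

variable (k : ℕ) (a : ℕ → ℂ) {n : ℕ} {c : ℝ} (hc : c ∈ admissible n)

/-- `Realizes` for the points of the `m`-th stage of the tower. -/
def RealizedAt (m : ℕ) (p : (stage k a hc m).carrier) (φ : ℂ × ℂ → ℙ ℂ (Fin 3 → ℂ))
    (z : ℂ × ℂ) : Prop :=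
  Realizes (X := (stage k a hc m).toComplexSurface) (toPlane k a hc m) p φ z

/-- The points of the `m`-th stage which are not blown up in the next step. -/
def Unmarked (m : ℕ) (p : (stage k a hc m).carrier) : Prop :=
  ∀ s, p ≠ (stage k a hc m).pt s

/-- The blow-down from stage `m + 1` to stage `m`. -/
noncomputable def down (m : ℕ) : (stage k a hc (m + 1)).carrier → (stage k a hc m).carrier :=
  (stage k a hc m).proj

theorem toPlane_down (m : ℕ) (x : (stage k a hc (m + 1)).carrier) :
    toPlane k a hc m (down k a hc m x) = toPlane k a hc (m + 1) x := rfl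

theorem down_pt (m : ℕ) (s : Fin n) :
    down k a hc m ((stage k a hc (m + 1)).pt s) = (stage k a hc m).pt s :=
  (stage k a hc m).proj_next_pt _ _ s

theorem Unmarked.lift {m : ℕ} {x : (stage k a hc (m + 1)).carrier}
    (h : Unmarked k a hc m (down k a hc m x)) : Unmarked k a hc (m + 1) x := by
  rintro s rfl
  exact h s (down_pt k a hc m s)

theorem RealizedAt.lift {m : ℕ} {x : (stage k a hc (m + 1)).carrier}
    (h : Unmarked k a hc m (down k a hc m x)) {φ : ℂ × ℂ → ℙ ℂ (Fin 3 → ℂ)} {z : ℂ × ℂ}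
    (hφ : RealizedAt k a hc m (down k a hc m x) φ z) : RealizedAt k a hc (m + 1) x φ z :=
  (stage k a hc m).realizes_blowup h hφ rfl

theorem exists_down_eq {m : ℕ} {p : (stage k a hc m).carrier} (hp : Unmarked k a hc m p) :
    ∃ x, down k a hc m x = p :=
  ⟨(Sum.inl ⟨p, hp⟩ : (stage k a hc m).BlowPts), rfl⟩

theorem exists_realizedAt_of_le {m : ℕ} {φ : ℂ × ℂ → ℙ ℂ (Fin 3 → ℂ)} {z : ℂ × ℂ}
    (h : ∃ p, Unmarked k a hc m p ∧ RealizedAt k a hc m p φ z) {M : ℕ} (hM : m ≤ M) :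
    ∃ p, Unmarked k a hc M p ∧ RealizedAt k a hc M p φ z := by
  induction M, hM using Nat.le_induction with
  | base => exact h
  | succ M _ ih =>
    obtain ⟨p, h1, h2⟩ := ih
    obtain ⟨x, rfl⟩ := exists_down_eq k a hc h1
    exact ⟨x, h1.lift, h2.lift k a hc h1⟩

theorem toPlane_pt (m : ℕ) (s : Fin n) :
    toPlane k a hc m ((stage k a hc m).pt s) = stdPar (markIdx s) (markCtr c s) := by
  induction m with
  | zero => rfl
  | succ m ih => rw [← toPlane_down, down_pt, ih]

theorem stdPar_mark_ne_affine (s : ℕ) (u : ℂ × ℂ) :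
    stdPar (markIdx s) (markCtr c s) ≠ stdPar 0 u := by
  intro h
  have h := (stdPar_eq_iff' ..).1 h
  have h0 := h (markIdx s)
  by_cases hs : s = 0
  · simp [markIdx, markCtr, hs, stdVec] at h0
  · simp [markIdx, markCtr, hs, stdVec] at h0

theorem unmarked_of_affine {m : ℕ} {p : (stage k a hc m).carrier} {u : ℂ × ℂ}
    (h : toPlane k a hc m p = stdPar 0 u) : Unmarked k a hc m p := by
  rintro s rfl
  rw [toPlane_pt] at h
  exact stdPar_mark_ne_affine s u h

theorem down_injective {m : ℕ} {x y : (stage k a hc (m + 1)).carrier}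
    (hx : Unmarked k a hc m (down k a hc m x)) (h : down k a hc m x = down k a hc m y) :
    x = y :=
  ((stage k a hc m).eq_up_of_proj hx rfl (blowDir false 0)).trans
    ((stage k a hc m).eq_up_of_proj hx h.symm (blowDir false 0)).symm

theorem stdPar_eq_affine (i : Fin 3) {w : ℂ × ℂ} (h1 : w.1 ≠ 0) (h2 : w.2 ≠ 0) :
    ∃ u : ℂ × ℂ, (u.1 ≠ 0 ∧ u.2 ≠ 0) ∧ stdPar i w = stdPar 0 u := by
  fin_cases i
  · exact ⟨w, ⟨h1, h2⟩, rfl⟩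
  · refine ⟨(w.1⁻¹, w.2 / w.1), ⟨inv_ne_zero h1, div_ne_zero h2 h1⟩,
      (stdPar_eq_iff ..).2 ⟨w.1, ?_⟩⟩
    ext l; fin_cases l <;> simp [stdVec, h1, mul_div_cancel₀]
  · refine ⟨(w.2 / w.1, w.1⁻¹), ⟨div_ne_zero h2 h1, inv_ne_zero h1⟩,
      (stdPar_eq_iff ..).2 ⟨w.1, ?_⟩⟩
    ext l; fin_cases l <;> simp [stdVec, h1, mul_div_cancel₀]

/-- The affine plane is a dense subset of every stage of the tower. -/
theorem affineDense_stage (m : ℕ) :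
    AffineDense (X := (stage k a hc m).toComplexSurface) (toPlane k a hc m)
      {u | u.1 ≠ 0 ∧ u.2 ≠ 0} := by
  constructor
  · induction m with
    | zero => exact fun p p' u h h' => h.trans h'.symm
    | succ m ih =>
      intro p p' u h h'
      have h1 : toPlane k a hc m (down k a hc m p) = stdPar 0 u := h
      exact down_injective k a hc (unmarked_of_affine k a hc h1) (ih _ _ u h1 h')
  · induction m with
    | zero =>
      intro p
      obtain ⟨i, z, hz, rfl⟩ := (stage k a hc 0).cover p
      rw [mem_closure_iff_frequently, ← (stage k a hc 0).map_par_nhds i hz, frequently_map]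
      refine (mem_closure_iff_frequently.1 (dense_coord_ne_zero z)).mono ?_
      rintro w ⟨h1, h2⟩
      exact stdPar_eq_affine i h1 h2
    | succ m ih => exact (stage k a hc m).dense_preimage_proj ih

/-- The parametrization of stage `m + 1` that is used for the next blowup over `f^s e_2`. -/
noncomputable def markedPar (m : ℕ) (s : Fin n) : ℂ × ℂ → (stage k a hc (m + 1)).carrier :=
  (stage k a hc m).chartPar (Sum.inr (s, decide (m = 0)))

theorem centre_one (hk : k ≠ 0) (s : ℕ) : centre k c a s 1 = 0 := by
  simp [centre, bCoeff_zero k c a hk]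

theorem stage_ctr (hk : k ≠ 0) (m : ℕ) (s : Fin n) :
    (stage k a hc (m + 1)).ctr s = (centre k c a s (m + 1), 0) := by
  change onFiber (decide (m = 0)) (centre k c a s (m + 1)) = _
  by_cases hm : m = 0
  · subst hm
    simp [onFiber, centre_one k a hk]
  · simp [hm, onFiber]

theorem centre_eq {n : ℕ} {c : ℝ} (hc : c ∈ admissible n) (hk : k ≠ 0) (m : ℕ) {s : ℕ} (hs : s < n) :
    centre k c a s (m + 1) = orbitProd c s ^ m * (orbitProd c s)⁻¹ * bCoeff k c a m := by
  have hP := orbitProd_ne_zero hc hs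
  rcases m with _ | m
  · rw [centre_one k a hk, bCoeff_zero k c a hk, mul_zero]
  · rw [centre, show m + 1 + 1 - 2 = m by omega, Nat.add_sub_cancel, pow_succ,
      mul_inv_cancel_right₀ hP]
    rfl

/-- The coordinates `(ξ_j, x_j)` in terms of the affine coordinates at `f^s e_2`, `j = m + 1`. -/
theorem toPlane_markedPar (hk : k ≠ 0) (m : ℕ) (s : Fin n) (z : ℂ × ℂ) :
    toPlane k a hc (m + 1) (markedPar k a hc m s z) = stdPar (markIdx s) (markCtr c s +
      blowCoord true (∑ i ∈ Finset.range m, orbitProd c s ^ i * (orbitProd c s)⁻¹ *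
        bCoeff k c a i * z.2 ^ i + z.1 * z.2 ^ m, z.2)) := by
  induction m generalizing z with
  | zero =>
    rw [← toPlane_down]
    refine (congrArg (toPlane k a hc 0) ((stage k a hc 0).proj_chartPar _ z)).trans ?_
    simp only [Finset.range_zero, Finset.sum_empty, pow_zero, mul_one, zero_add]
    rfl
  | succ m ih =>
    rw [← toPlane_down]
    refine (congrArg (toPlane k a hc (m + 1))
      ((stage k a hc (m + 1)).proj_chartPar _ z)).trans ?_
    have e : (stage k a hc (m + 1)).sig (Sum.inr (s, decide (m + 1 = 0))) z =
        (centre k c a s (m + 1) + z.1 * z.2, z.2) := by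
      rw [sig, stage_ctr k a hc hk]
      simp [blowCoord]
    rw [e]
    refine (ih _).trans ?_
    rw [Finset.sum_range_succ, centre_eq k a hc hk m s.2]
    congr 3
    simp only [Prod.mk.injEq, and_true]
    ring

/-- The parametrization of stage `m + 1` near the curve `F_s^(m+1)` by the coordinates
`(d, x)`. -/
noncomputable def dPar (m : ℕ) (s : Fin n) (z : ℂ × ℂ) : (stage k a hc (m + 1)).carrier :=
  markedPar k a hc m s (fiberCoord k c a (orbitProd c s) m z)

theorem toPlane_dPar (hk : k ≠ 0) (m : ℕ) (s : Fin n) {z : ℂ × ℂ} (hz : qFun k c a z.2 ≠ 0) :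
    toPlane k a hc (m + 1) (dPar k a hc m s z) = fiberPar k c a (m + 1) s z := by
  have hP := orbitProd_ne_zero hc s.2
  rw [dPar, toPlane_markedPar k a hc hk, fiberPar, towerPar]
  set P := orbitProd (c : ℂ) s
  have key : ∑ i ∈ Finset.range m, P ^ i * P⁻¹ * bCoeff k c a i * (z.2 / P) ^ i +
      P ^ m * P⁻¹ * (z.1 + rTail k c a m z.2) * (z.2 / P) ^ m =
      (rFun k c a z.2 + z.1 * z.2 ^ m) / P := by
    rw [rFun_eq_sum_add k c a m hz, add_div, add_div, Finset.sum_div]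
    have : ∀ i ∈ Finset.range m, P ^ i * P⁻¹ * bCoeff k c a i * (z.2 / P) ^ i =
        bCoeff k c a i * z.2 ^ i / P := by
      intro i _
      rw [div_pow]
      field_simp
    rw [Finset.sum_congr rfl this, div_pow]
    field_simp
    ring
  simp only [fiberCoord, key, Nat.add_sub_cancel, blowCoord]
  congr 3
  field_simp

theorem isLocalPar_dPar (m : ℕ) (s : Fin n) {z : ℂ × ℂ} (hz : qFun k c a z.2 ≠ 0)
    (hd : fiberCoord k c a (orbitProd c s) m z ∈
      (stage k a hc m).blowDom (Sum.inr (s, decide (m = 0)))) :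
    (stage k a hc (m + 1)).IsLocalPar (dPar k a hc m s) z :=
  isLocalPar_fiberCoord k c a (stage k a hc (m + 1)).toComplexSurface
    (Sum.inr (s, decide (m = 0)) : (stage k a hc m).BlowIdx) (orbitProd_ne_zero hc s.2) m hz hd

theorem realizedAt_dPar (hk : k ≠ 0) (m : ℕ) (s : Fin n) {z : ℂ × ℂ} (hz : qFun k c a z.2 ≠ 0)
    (hd : fiberCoord k c a (orbitProd c s) m z ∈
      (stage k a hc m).blowDom (Sum.inr (s, decide (m = 0)))) :
    RealizedAt k a hc (m + 1) (dPar k a hc m s z) (fiberPar k c a (m + 1) s) z := by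
  refine ⟨dPar k a hc m s, isLocalPar_dPar k a hc m s hz hd, rfl, ?_⟩
  have h : ContinuousAt (fun w : ℂ × ℂ => qFun k c a w.2) z :=
    (contDiff_qFun k c a).continuous.continuousAt.comp continuousAt_snd
  filter_upwards [h.eventually_ne hz] with w hw
  exact toPlane_dPar k a hc hk m s hw

theorem fiberCoord_zero_right (P : ℂ) (m : ℕ) (d : ℂ) :
    fiberCoord k c a P m (d, 0) = (P ^ m * P⁻¹ * (d + bCoeff k c a m), 0) := by
  simp [fiberCoord, rTail_zero]

theorem dPar_zero (hk : k ≠ 0) (m : ℕ) (s : Fin n) :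
    dPar k a hc m s (0, 0) = (stage k a hc (m + 1)).pt s := by
  have h : fiberCoord k c a (orbitProd c s) m (0, 0) = (stage k a hc (m + 1)).ctr s := by
    rw [fiberCoord_zero_right, zero_add, stage_ctr k a hc hk, centre_eq k a hc hk m s.2]
  rw [dPar, h]
  rfl

theorem realizedAt_pt (hk : k ≠ 0) (m : ℕ) (s : Fin n) :
    RealizedAt k a hc (m + 1) ((stage k a hc (m + 1)).pt s) (fiberPar k c a (m + 1) s) (0, 0) := by
  rw [← dPar_zero k a hc hk]
  refine realizedAt_dPar k a hc hk m s (by simp [qFun_zero]) ?_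
  have h : fiberCoord k c a (orbitProd c s) m (0, 0) = (stage k a hc (m + 1)).ctr s := by
    rw [fiberCoord_zero_right, zero_add, stage_ctr k a hc hk, centre_eq k a hc hk m s.2]
  rw [h]
  exact (stage k a hc (m + 1)).ctr_mem s

/-- The points of `F_s^j`, `j ≥ 2`, in the coordinates `(d, x)`. -/
theorem dPar_eq_excPt (m : ℕ) (s : Fin n) (d : ℂ) :
    dPar k a hc (m + 1) s (d, 0) = (stage k a hc (m + 1)).excPt s (blowDir false
      (orbitProd c s ^ (m + 1) * (orbitProd c s)⁻¹ * (d + bCoeff k c a (m + 1)), 0)) := by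
  rw [dPar, fiberCoord_zero_right]
  exact (stage k a hc (m + 1)).chartPar_onFiber s false _

theorem excPt_injective {M : MarkedSurface n} {s s' : Fin n} {d d' : ℙ ℂ (ℂ × ℂ)}
    (h : M.excPt s d = M.excPt s' d') : s = s' ∧ d = d' := by
  have h : (Sum.inr (s, d) : M.BlowPts) = Sum.inr (s', d') := h
  simpa using h

theorem unmarked_dPar (hk : k ≠ 0) (m : ℕ) (s : Fin n) {d : ℂ} (hd : d ≠ 0) :
    Unmarked k a hc (m + 2) (dPar k a hc (m + 1) s (d, 0)) := by
  intro s' h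
  rw [← dPar_zero k a hc hk, dPar_eq_excPt, dPar_eq_excPt] at h
  obtain ⟨rfl, h⟩ := excPt_injective h
  have hP := orbitProd_ne_zero hc s.2
  have h := blowDir_eq_same _ _ _ h
  simp only [blowVec, Prod.mk.injEq, and_true, zero_add] at h
  have := mul_left_cancel₀ (mul_ne_zero (pow_ne_zero (m + 1) hP) (inv_ne_zero hP)) h
  exact hd (by linear_combination this)

theorem realizedAt_dPar_fiber (hk : k ≠ 0) (m : ℕ) (s : Fin n) (d : ℂ) :
    RealizedAt k a hc (m + 2) (dPar k a hc (m + 1) s (d, 0)) (fiberPar k c a (m + 2) s)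
      (d, 0) := by
  refine realizedAt_dPar k a hc hk (m + 1) s (by simp [qFun_zero]) ?_
  rw [fiberCoord_zero_right]
  exact (stage k a hc (m + 1)).mem_blowDom_of_blowCoord s false (by simp [blowCoord])

/-- The point of `F_s^1` with coordinate `x_1 = x / P`. -/
theorem realizedAt_first (hk : k ≠ 0) (s : Fin n) (x : ℂ) :
    RealizedAt k a hc 1 ((stage k a hc 0).excPt s (blowDir true (0, x / orbitProd c s)))
      (towerPar c s) (0, x) := by
  have hP := orbitProd_ne_zero hc s.2
  have hd : ((0 : ℂ), x / orbitProd c s) ∈ (stage k a hc 0).blowDom (Sum.inr (s, true)) :=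
    (stage k a hc 0).mem_blowDom_of_blowCoord s true (by simp [blowCoord])
  refine ⟨fun z => markedPar k a hc 0 s (z.1 / orbitProd c s, z.2 / orbitProd c s), ?_, ?_, ?_⟩
  · refine ⟨(Sum.inr (s, true) : (stage k a hc 0).BlowIdx),
      fun z => (z.1 / orbitProd c s, z.2 / orbitProd c s),
      fun z => (z.1 * orbitProd c s, z.2 * orbitProd c s), ?_, ?_, ?_, .of_forall fun z => ?_,
      .of_forall fun z => ?_, .of_forall fun z => rfl⟩
    · simp only [zero_div]
      exact hd
    · fun_prop
    · fun_prop
    · simp [hP]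
    · simp [hP]
  · simp only [zero_div]
    exact (stage k a hc 0).chartPar_onFiber s true _
  · refine .of_forall fun z => ?_
    rw [toPlane_markedPar k a hc hk, towerPar]
    simp only [Finset.range_zero, Finset.sum_empty, pow_zero, mul_one, zero_add, blowCoord]
    congr 3
    field_simp

theorem pt_one (hk : k ≠ 0) (s : Fin n) :
    (stage k a hc 1).pt s = (stage k a hc 0).excPt s (blowDir true (0, 0)) := by
  refine ((stage k a hc 0).next_pt true (fun s => centre k c a s 1) s).trans ?_
  rw [centre_one k a hk]
  rfl

theorem unmarked_first (hk : k ≠ 0) (s : Fin n) {x : ℂ} (hx : x ≠ 0) :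
    Unmarked k a hc 1 ((stage k a hc 0).excPt s (blowDir true (0, x / orbitProd c s))) := by
  intro s' h
  rw [pt_one k a hc hk] at h
  obtain ⟨rfl, h'⟩ := excPt_injective h
  have h' := blowDir_eq_same _ _ _ h'
  simp [blowVec, hx, orbitProd_ne_zero hc s.2] at h'

theorem realizedAt_lineCorner (s : Fin n) :
    RealizedAt k a hc 1 ((stage k a hc 0).excPt s (blowDir false (0, 0)))
      (lineCornerPar c s) (0, 0) := by
  refine ⟨(stage k a hc 0).chartPar (Sum.inr (s, false)),
    (stage k a hc 0).isLocalPar_chartPar _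
      ((stage k a hc 0).mem_blowDom_of_blowCoord s false (by simp [blowCoord])),
    (stage k a hc 0).chartPar_onFiber s false 0, .of_forall fun z => ?_⟩
  exact congrArg (toPlane k a hc 0) ((stage k a hc 0).proj_chartPar _ z)

theorem unmarked_lineCorner (hk : k ≠ 0) (s : Fin n) :
    Unmarked k a hc 1 ((stage k a hc 0).excPt s (blowDir false (0, 0))) := by
  intro s' h
  rw [pt_one k a hc hk] at h
  obtain ⟨-, h⟩ := excPt_injective h
  simp [blowDir_eq_iff] at h

/-- The coordinates near a corner are a chart of the blowup of the point `d = x = 0`. -/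
theorem sig_cornerCoord (hk : k ≠ 0) (m : ℕ) (s : Fin n) {w : ℂ × ℂ}
    (hw : qFun k c a (w.1 * w.2) ≠ 0)
    (hw' : 1 + w.2 * rTail k c a (m + 1) (w.1 * w.2) ≠ 0) :
    (stage k a hc (m + 1)).sig (Sum.inr (s, true)) (cornerCoord k c a (orbitProd c s) m w) =
      fiberCoord k c a (orbitProd c s) m (w.1, w.1 * w.2) := by
  have hP := orbitProd_ne_zero hc s.2
  rw [sig, stage_ctr k a hc hk, centre_eq k a hc hk m s.2]
  simp only [blowCoord, cornerCoord, fiberCoord, rTail_eq_add k c a m hw]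
  generalize rTail k c a (m + 1) (w.1 * w.2) = R at hw' ⊢
  ext
  · simp only [Prod.mk_add_mk]
    ring
  · simp only [Prod.mk_add_mk]
    field_simp
    ring

theorem realizedAt_corner (hk : k ≠ 0) (m : ℕ) (s : Fin n) :
    RealizedAt k a hc (m + 2) ((stage k a hc (m + 1)).excPt s (blowDir true (0, 0)))
      (cornerPar k c a (m + 1) s) (0, 0) := by
  have hd : ((0 : ℂ), (0 : ℂ)) ∈ (stage k a hc (m + 1)).blowDom (Sum.inr (s, true)) :=
    (stage k a hc (m + 1)).mem_blowDom_of_blowCoord s true (by simp [blowCoord])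
  refine ⟨fun w => (stage k a hc (m + 1)).chartPar (Sum.inr (s, true))
    (cornerCoord k c a (orbitProd c s) m w), isLocalPar_cornerCoord k c a
      (stage k a hc (m + 2)).toComplexSurface
      (Sum.inr (s, true) : (stage k a hc (m + 1)).BlowIdx) (orbitProd_ne_zero hc s.2) m hd,
    ?_, ?_⟩
  · have h0 : cornerCoord k c a (orbitProd c s) m (0, 0) = (0, 0) := by simp [cornerCoord]
    simp only [h0]
    exact (stage k a hc (m + 1)).chartPar_onFiber s true 0
  · have c1 : ContinuousAt (fun w : ℂ × ℂ => qFun k c a (w.1 * w.2)) (0, 0) :=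
      ((contDiff_qFun k c a).continuous.comp (continuous_fst.mul continuous_snd)).continuousAt
    have c2 : ContinuousAt (fun w : ℂ × ℂ => 1 + w.2 * rTail k c a (m + 1) (w.1 * w.2))
        (0, 0) := by
      have : ContinuousAt (rTail k c a (m + 1)) ((0 : ℂ) * 0) :=
        (contDiffAt_rTail k c a (m + 1) (by simp [qFun_zero])).continuousAt
      have h2 : ContinuousAt (fun w : ℂ × ℂ => rTail k c a (m + 1) (w.1 * w.2)) (0, 0) :=
        ContinuousAt.comp (f := fun w : ℂ × ℂ => w.1 * w.2) this
          (continuous_fst.mul continuous_snd).continuousAt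
      exact continuousAt_const.add (continuousAt_snd.mul h2)
    filter_upwards [c1.eventually_ne (y := 0) (by simp [qFun_zero]),
      c2.eventually_ne (y := 0) (by simp)]
      with w h1 h2
    rw [cornerPar_eq k c a (by omega), ← toPlane_dPar k a hc hk m s (z := (w.1, w.1 * w.2)) h1,
      ← toPlane_down]
    refine congrArg (toPlane k a hc (m + 1)) ?_
    refine ((stage k a hc (m + 1)).proj_chartPar _ _).trans ?_
    rw [sig_cornerCoord k a hc hk m s h1 h2]
    rfl

theorem unmarked_corner (hk : k ≠ 0) (m : ℕ) (s : Fin n) :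
    Unmarked k a hc (m + 2) ((stage k a hc (m + 1)).excPt s (blowDir true (0, 0))) := by
  intro s' h
  rw [← dPar_zero k a hc hk, dPar_eq_excPt] at h
  obtain ⟨-, h⟩ := excPt_injective h
  have := (blowDir_eq_iff _ _).1 h.symm
  simp at this

end Stages

/-! ### The models cover the tower -/

/-- The coordinates used on stage `M` of the tower, each with the point at which they are used. -/
inductive TowerModel (k : ℕ) (c : ℝ) (a : ℕ → ℂ) (n M : ℕ) :
    (ℂ × ℂ → ℙ ℂ (Fin 3 → ℂ)) → ℂ × ℂ → Prop
  | plane (i : Fin 3) (z : ℂ × ℂ)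
      (h : ∀ s < n, stdPar i z ≠ stdPar (markIdx s) (markCtr c s)) :
      TowerModel k c a n M (stdPar i) z
  | first (s : ℕ) (x : ℂ) (hs : s < n) (hx : x ≠ 0) : TowerModel k c a n M (towerPar c s) (0, x)
  | lineCorner (s : ℕ) (hs : s < n) : TowerModel k c a n M (lineCornerPar c s) (0, 0)
  | fiber (s j : ℕ) (d : ℂ) (hs : s < n) (hj : 2 ≤ j) (hjM : j ≤ M) (hd : d ≠ 0) :
      TowerModel k c a n M (fiberPar k c a j s) (d, 0)
  | corner (s j : ℕ) (hs : s < n) (hj : 1 ≤ j) (hjM : j < M) :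
      TowerModel k c a n M (cornerPar k c a j s) (0, 0)

theorem TowerModel.mono {k : ℕ} {c : ℝ} {a : ℕ → ℂ} {n M M' : ℕ} (hM : M ≤ M')
    {φ : ℂ × ℂ → ℙ ℂ (Fin 3 → ℂ)} {z : ℂ × ℂ} (h : TowerModel k c a n M φ z) :
    TowerModel k c a n M' φ z := by
  cases h with
  | plane i z h => exact .plane i z h
  | first s x hs hx => exact .first s x hs hx
  | lineCorner s hs => exact .lineCorner s hs
  | fiber s j d hs hj hjM hd => exact .fiber s j d hs hj (hjM.trans hM) hd
  | corner s j hs hj hjM => exact .corner s j hs hj (hjM.trans_le hM)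

section Coverage

variable (k : ℕ) (a : ℕ → ℂ) {n : ℕ} {c : ℝ} (hc : c ∈ admissible n)

/-- The point of the plane with coordinates `z` in the `i`-th chart, as a point of stage `0`. -/
noncomputable def planePt (i : Fin 3) (z : ℂ × ℂ) : (stage k a hc 0).carrier := stdPar i z

theorem realizedAt_plane (i : Fin 3) (z : ℂ × ℂ) :
    RealizedAt k a hc 0 (planePt k a hc i z) (stdPar i) z :=
  ⟨planePt k a hc i, projPlane.isLocalPar_par i (mem_univ z), rfl, .of_forall fun _ => rfl⟩

/-- Every model occurs on the stages where it is expected. -/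
theorem exists_realizedAt (hk : k ≠ 0) {M : ℕ} (hM : 1 ≤ M) {φ : ℂ × ℂ → ℙ ℂ (Fin 3 → ℂ)}
    {z : ℂ × ℂ} (h : TowerModel k c a n M φ z) :
    ∃ p, Unmarked k a hc M p ∧ RealizedAt k a hc M p φ z := by
  cases h with
  | plane i z h =>
    exact exists_realizedAt_of_le k a hc
      ⟨planePt k a hc i z, fun s => h s s.2, realizedAt_plane k a hc i z⟩ (Nat.zero_le M)
  | first s x hs hx =>
    exact exists_realizedAt_of_le k a hc
      ⟨_, unmarked_first k a hc hk ⟨s, hs⟩ hx, realizedAt_first k a hc hk ⟨s, hs⟩ x⟩ hM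
  | lineCorner s hs =>
    exact exists_realizedAt_of_le k a hc
      ⟨_, unmarked_lineCorner k a hc hk ⟨s, hs⟩, realizedAt_lineCorner k a hc ⟨s, hs⟩⟩ hM
  | fiber s j d hs hj hjM hd =>
    obtain ⟨m, rfl⟩ : ∃ m, j = m + 2 := ⟨j - 2, by omega⟩
    exact exists_realizedAt_of_le k a hc
      ⟨_, unmarked_dPar k a hc hk m ⟨s, hs⟩ hd, realizedAt_dPar_fiber k a hc hk m ⟨s, hs⟩ d⟩ hjM
  | corner s j hs hj hjM =>
    obtain ⟨m, rfl⟩ : ∃ m, j = m + 1 := ⟨j - 1, by omega⟩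
    exact exists_realizedAt_of_le k a hc
      ⟨_, unmarked_corner k a hc hk m ⟨s, hs⟩, realizedAt_corner k a hc hk m ⟨s, hs⟩⟩ hjM

theorem eq_excPt_of_not_unmarked {m : ℕ} {x : (stage k a hc (m + 1)).carrier}
    (h : ¬ Unmarked k a hc m (down k a hc m x)) : ∃ s d, x = (stage k a hc m).excPt s d := by
  have h' : ∀ y : (stage k a hc m).BlowPts, ¬ Unmarked k a hc m ((stage k a hc m).blowDown y) →
      ∃ s d, y = Sum.inr (s, d) := by
    rintro (y | ⟨s, d⟩) hy
    · exact absurd y.2 hy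
    · exact ⟨s, d, rfl⟩
  exact h' x h

/-- Every point of a stage other than the next centres is described by a model. -/
theorem exists_model (hk : k ≠ 0) {M : ℕ} (hM : 1 ≤ M) (p : (stage k a hc M).carrier) :
    (∃ s, p = (stage k a hc M).pt s) ∨
      ∃ φ z, TowerModel k c a n M φ z ∧ RealizedAt k a hc M p φ z := by
  induction M, hM using Nat.le_induction with
  | base =>
    by_cases h : Unmarked k a hc 0 (down k a hc 0 p)
    · right
      obtain ⟨i, z, hz, hp⟩ := projPlane.cover (down k a hc 0 p)
      have h2 : down k a hc 0 p = planePt k a hc i z := hp.symm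
      refine ⟨stdPar i, z, .plane i z fun s hs => ?_, RealizedAt.lift k a hc h ?_⟩
      · have h3 := h ⟨s, hs⟩
        rw [h2] at h3
        exact h3
      · rw [h2]
        exact realizedAt_plane k a hc i z
    · obtain ⟨s, d, rfl⟩ := eq_excPt_of_not_unmarked k a hc h
      rcases exceptional_direction' d with ⟨b, rfl⟩ | rfl
      · by_cases hb : b = 0
        · subst hb
          exact Or.inl ⟨s, (pt_one k a hc hk s).symm⟩
        · have hP := orbitProd_ne_zero hc s.2
          have := realizedAt_first k a hc hk s (b * orbitProd c s)
          rw [mul_div_cancel_right₀ _ hP] at this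
          exact Or.inr ⟨_, _, .first s _ s.2 (mul_ne_zero hb hP), this⟩
      · exact Or.inr ⟨_, _, .lineCorner s s.2, realizedAt_lineCorner k a hc s⟩
  | succ M hM ih =>
    by_cases h : Unmarked k a hc M (down k a hc M p)
    · right
      rcases ih (down k a hc M p) with ⟨s, hs⟩ | ⟨φ, z, h1, h2⟩
      · exact absurd hs (h s)
      · exact ⟨φ, z, h1.mono (Nat.le_succ M), h2.lift k a hc h⟩
    · obtain ⟨s, d, rfl⟩ := eq_excPt_of_not_unmarked k a hc h
      obtain ⟨m, rfl⟩ : ∃ m, M = m + 1 := ⟨M - 1, by omega⟩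
      rcases exceptional_direction d with ⟨b, rfl⟩ | rfl
      · have hP := orbitProd_ne_zero hc s.2
        have hP' : orbitProd (c : ℂ) s ^ (m + 1) * (orbitProd (c : ℂ) s)⁻¹ ≠ 0 :=
          mul_ne_zero (pow_ne_zero _ hP) (inv_ne_zero hP)
        obtain ⟨t, ht⟩ : ∃ t, orbitProd (c : ℂ) s ^ (m + 1) * (orbitProd (c : ℂ) s)⁻¹ *
            (t + bCoeff k c a (m + 1)) = b :=
          ⟨b / (orbitProd (c : ℂ) s ^ (m + 1) * (orbitProd (c : ℂ) s)⁻¹) - bCoeff k c a (m + 1),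
            by rw [sub_add_cancel, mul_div_cancel₀ _ hP']⟩
        rw [← ht, ← dPar_eq_excPt]
        by_cases h0 : t = 0
        · subst h0
          exact Or.inl ⟨s, dPar_zero k a hc hk (m + 1) s⟩
        · exact Or.inr ⟨_, _, .fiber s (m + 2) t s.2 (by omega) le_rfl h0,
            realizedAt_dPar_fiber k a hc hk m s t⟩
      · exact Or.inr ⟨_, _, .corner s (m + 1) s.2 (by omega) (by omega),
          realizedAt_corner k a hc hk m s⟩

/-- The points of stage `m` described by the coordinates `φ` at a point of `W`. -/
def genericSet (m : ℕ) (φ : ℂ × ℂ → ℙ ℂ (Fin 3 → ℂ)) (W : Set (ℂ × ℂ)) :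
    Set (stage k a hc m).carrier :=
  {p | Unmarked k a hc m p ∧ ∃ z ∈ W, RealizedAt k a hc m p φ z}

theorem strictTransform_subset_genericSet {m : ℕ} {φ : ℂ × ℂ → ℙ ℂ (Fin 3 → ℂ)}
    {W : Set (ℂ × ℂ)} {C : Set (stage k a hc m).carrier}
    (h : C ⊆ closure (genericSet k a hc m φ W)) :
    (stage k a hc m).strictTransform C ⊆
      closure (X := (stage k a hc (m + 1)).carrier) (genericSet k a hc (m + 1) φ W) := by
  refine ((stage k a hc m).strictTransform_subset h).trans (closure_mono ?_)
  rintro x ⟨h1, z, hz, h2⟩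
  exact ⟨Unmarked.lift k a hc (x := x) h1, z, hz, RealizedAt.lift k a hc (x := x) h1 h2⟩

/-- The points `(d, 0)`, `d ≠ 0`, are dense in the curve `F_s^j`, `j ≥ 2`. -/
theorem fiber_subset_closure (hk : k ≠ 0) {j : ℕ} (hj : 2 ≤ j) (s : Fin n) {M : ℕ} (hM : j ≤ M) :
    fiber k a hc j s M ⊆
      closure (genericSet k a hc M (fiberPar k c a j s) {z | z.1 ≠ 0 ∧ z.2 = 0}) := by
  induction M, hM using Nat.le_induction with
  | base =>
    obtain ⟨m, rfl⟩ : ∃ m, j = m + 2 := ⟨j - 2, by omega⟩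
    have hP := orbitProd_ne_zero hc s.2
    have hP' : orbitProd (c : ℂ) s ^ (m + 1) * (orbitProd (c : ℂ) s)⁻¹ ≠ 0 :=
      mul_ne_zero (pow_ne_zero _ hP) (inv_ne_zero hP)
    have e : fiber k a hc (m + 2) s (m + 2) = (stage k a hc (m + 1)).exceptional s := if_pos rfl
    rw [e]
    refine ((stage k a hc (m + 1)).exceptional_subset_closure s
      (E := {blowDir true (0, 0), blowDir false
        (orbitProd c s ^ (m + 1) * (orbitProd c s)⁻¹ * bCoeff k c a (m + 1), 0)})
      (Set.toFinite _)).trans (closure_mono ?_)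
    rintro x ⟨d, hd, rfl⟩
    simp only [mem_insert_iff, mem_singleton_iff, not_or] at hd
    obtain ⟨b, rfl⟩ := (exceptional_direction d).resolve_right hd.1
    obtain ⟨t, rfl⟩ : ∃ t, orbitProd (c : ℂ) s ^ (m + 1) * (orbitProd (c : ℂ) s)⁻¹ *
        (t + bCoeff k c a (m + 1)) = b :=
      ⟨b / (orbitProd (c : ℂ) s ^ (m + 1) * (orbitProd (c : ℂ) s)⁻¹) - bCoeff k c a (m + 1),
        by rw [sub_add_cancel, mul_div_cancel₀ _ hP']⟩
    rw [← dPar_eq_excPt]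
    have ht : t ≠ 0 := by
      rintro rfl
      exact hd.2 (by rw [zero_add])
    exact ⟨unmarked_dPar k a hc hk m s ht, (t, 0), ⟨ht, rfl⟩,
      realizedAt_dPar_fiber k a hc hk m s t⟩
  | succ M hM ih =>
    have e : fiber k a hc j s (M + 1) = (stage k a hc M).strictTransform (fiber k a hc j s M) :=
      if_neg (by omega)
    rw [e]
    exact strictTransform_subset_genericSet k a hc ih

/-- The points `(0, x)`, `x ≠ 0`, are dense in the curve `F_s^1`. -/
theorem first_subset_closure (hk : k ≠ 0) (s : Fin n) {M : ℕ} (hM : 1 ≤ M) :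
    fiber k a hc 1 s M ⊆
      closure (genericSet k a hc M (towerPar c s) {z | z.1 = 0 ∧ z.2 ≠ 0}) := by
  induction M, hM using Nat.le_induction with
  | base =>
    have hP := orbitProd_ne_zero hc s.2
    have e : fiber k a hc 1 s 1 = (stage k a hc 0).exceptional s := if_pos rfl
    rw [e]
    refine ((stage k a hc 0).exceptional_subset_closure s
      (E := {blowDir true (0, 0), blowDir false (0, 0)}) (Set.toFinite _)).trans (closure_mono ?_)
    rintro x ⟨d, hd, rfl⟩
    simp only [mem_insert_iff, mem_singleton_iff, not_or] at hd
    obtain ⟨b, rfl⟩ := (exceptional_direction' d).resolve_right hd.2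
    have hb : b * orbitProd c s ≠ 0 := by
      refine mul_ne_zero ?_ hP
      rintro rfl
      exact hd.1 rfl
    rw [← mul_div_cancel_right₀ b hP]
    exact ⟨unmarked_first k a hc hk s hb, _, ⟨rfl, hb⟩, realizedAt_first k a hc hk s _⟩
  | succ M hM ih =>
    have e : fiber k a hc 1 s (M + 1) = (stage k a hc M).strictTransform (fiber k a hc 1 s M) :=
      if_neg (by omega)
    rw [e]
    exact strictTransform_subset_genericSet k a hc ih

/-- The points `[0 : 1 : y]`, `y ∈ Y`, are dense in the line at infinity, if `Y` has countable
complement. -/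
theorem lineAtInfinity_subset_closure {Y : Set ℂ} (hY : Yᶜ.Countable)
    (hYm : ∀ y ∈ Y, ∀ s < n, stdPar 1 (0, y) ≠ stdPar (markIdx s) (markCtr c s)) (M : ℕ) :
    lineAtInfinity k a hc M ⊆
      closure (genericSet k a hc M (stdPar 1) {z | z.1 = 0 ∧ z.2 ∈ Y}) := by
  induction M with
  | zero =>
    have key : ∀ y ∈ Y, planePt k a hc 1 (0, y) ∈
        genericSet k a hc 0 (stdPar 1) {z | z.1 = 0 ∧ z.2 ∈ Y} := fun y hy =>
      ⟨fun s => hYm y hy s s.2, _, ⟨rfl, hy⟩, realizedAt_plane k a hc 1 (0, y)⟩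
    have hcont : ∀ i x, Tendsto (fun t : ℂ => planePt k a hc i (0, t)) (𝓝 x)
        (𝓝 (planePt k a hc i (0, x))) := by
      intro i x
      have h1 : Continuous fun t : ℂ => ((0 : ℂ), t) := by fun_prop
      exact (projPlane.contMDiffAt_par i (mem_univ ((0 : ℂ), x))).continuousAt.tendsto.comp
        h1.continuousAt
    have mark0 : ∀ (i : Fin 3) (z : ℂ × ℂ), (stdPar i z).rep 0 = 0 → stdVec i z 0 = 0 := by
      intro i z h
      obtain ⟨u, hu⟩ := Projectivization.exists_smul_eq_mk_rep ℂ (stdVec i z) (stdVec_ne i z)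
      have h2 := congrFun hu 0
      have h : (Projectivization.mk ℂ (stdVec i z) (stdVec_ne i z)).rep 0 = 0 := h
      rw [h] at h2
      exact (mul_eq_zero.1 h2).resolve_left u.ne_zero
    have pull : ∀ (i : Fin 3) (x : ℂ) (S : Set ℂ), Dense S → (∀ t ∈ S, planePt k a hc i (0, t) ∈
        genericSet k a hc 0 (stdPar 1) {z | z.1 = 0 ∧ z.2 ∈ Y}) →
        planePt k a hc i (0, x) ∈
          closure (genericSet k a hc 0 (stdPar 1) {z | z.1 = 0 ∧ z.2 ∈ Y}) := by
      intro i x S hS h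
      rw [mem_closure_iff_frequently]
      exact Tendsto.frequently (hcont i x) ((mem_closure_iff_frequently.1 (hS x)).mono h)
    intro p hp
    obtain ⟨i, z1, z2, rfl⟩ : ∃ (i : Fin 3) (z1 z2 : ℂ), planePt k a hc i (z1, z2) = p := by
      obtain ⟨i, z, -, h⟩ := projPlane.cover p
      exact ⟨i, z.1, z.2, h⟩
    have h0 := mark0 i (z1, z2) hp
    have hYd : Dense Y := by
      have := hY.dense_compl ℂ
      rwa [compl_compl] at this
    fin_cases i
    · simp [stdVec] at h0
    · obtain rfl : z1 = 0 := by simpa [stdVec] using h0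
      exact pull 1 z2 Y hYd key
    · obtain rfl : z1 = 0 := by simpa [stdVec] using h0
      have hc2 : {t : ℂ | t = 0 ∨ t⁻¹ ∈ Yᶜ}.Countable := by
        refine (countable_singleton (0 : ℂ)).union ?_
        exact hY.preimage inv_injective
      refine pull 2 z2 _ (hc2.dense_compl ℂ) fun t ht => ?_
      simp only [mem_compl_iff, mem_ofPred_eq, not_or, not_not] at ht
      have e : planePt k a hc 2 (0, t) = planePt k a hc 1 (0, t⁻¹) := by
        refine (stdPar_eq_iff ..).2 ⟨t, ?_⟩
        ext l
        fin_cases l <;> simp [stdVec, ht.1]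
      rw [e]
      exact key _ ht.2
  | succ M ih => exact strictTransform_subset_genericSet k a hc ih

end Coverage

/-! ### Analytic difference quotients -/

/-- `f` is analytic at `0`, with a difference quotient that is analytic in two variables. -/
def HasDiffQuotient (f : ℂ → ℂ) : Prop :=
  ContDiffAt ℂ ω f 0 ∧ ∃ S : ℂ × ℂ → ℂ, ContDiffAt ℂ ω S (0, 0) ∧
    ∀ᶠ p : ℂ × ℂ in 𝓝 (0, 0), f p.1 - f p.2 = (p.1 - p.2) * S p

namespace HasDiffQuotient

variable {f g : ℂ → ℂ}

theorem const (b : ℂ) : HasDiffQuotient fun _ => b :=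
  ⟨contDiffAt_const, fun _ => 0, contDiffAt_const, .of_forall fun _ => by simp⟩

theorem id : HasDiffQuotient fun x => x :=
  ⟨contDiffAt_id, fun _ => 1, contDiffAt_const, .of_forall fun _ => by simp⟩

theorem comp_fst (hf : HasDiffQuotient f) : ContDiffAt ℂ ω (fun p : ℂ × ℂ => f p.1) (0, 0) :=
  ContDiffAt.comp (0, 0) hf.1 contDiffAt_fst

theorem comp_snd (hf : HasDiffQuotient f) : ContDiffAt ℂ ω (fun p : ℂ × ℂ => f p.2) (0, 0) :=
  ContDiffAt.comp (0, 0) hf.1 contDiffAt_snd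

theorem add (hf : HasDiffQuotient f) (hg : HasDiffQuotient g) : HasDiffQuotient fun x => f x + g x := by
  obtain ⟨S, hS, h1⟩ := hf.2
  obtain ⟨S', hS', h2⟩ := hg.2
  refine ⟨hf.1.add hg.1, fun p => S p + S' p, hS.add hS', ?_⟩
  filter_upwards [h1, h2] with p e1 e2
  linear_combination e1 + e2

theorem mul (hf : HasDiffQuotient f) (hg : HasDiffQuotient g) : HasDiffQuotient fun x => f x * g x := by
  obtain ⟨S, hS, h1⟩ := hf.2
  obtain ⟨S', hS', h2⟩ := hg.2
  refine ⟨hf.1.mul hg.1, fun p => S p * g p.1 + f p.2 * S' p,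
    (hS.mul hg.comp_fst).add (hf.comp_snd.mul hS'), ?_⟩
  filter_upwards [h1, h2] with p e1 e2
  linear_combination g p.1 * e1 + f p.2 * e2

theorem inv (hf : HasDiffQuotient f) (h0 : f 0 ≠ 0) : HasDiffQuotient fun x => (f x)⁻¹ := by
  obtain ⟨S, hS, h1⟩ := hf.2
  refine ⟨hf.1.inv h0, fun p => -S p / (f p.1 * f p.2),
    hS.neg.div (hf.comp_fst.mul hf.comp_snd) (mul_ne_zero h0 h0), ?_⟩
  filter_upwards [h1, hf.comp_fst.continuousAt.eventually_ne h0,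
    hf.comp_snd.continuousAt.eventually_ne h0] with p e1 e2 e3
  field_simp
  linear_combination -e1

theorem pow (hf : HasDiffQuotient f) (m : ℕ) : HasDiffQuotient fun x => f x ^ m := by
  induction m with
  | zero => simpa using const 1
  | succ m ih => simpa only [pow_succ] using ih.mul hf

theorem sum {ι : Type*} (s : Finset ι) {F : ι → ℂ → ℂ} (h : ∀ i ∈ s, HasDiffQuotient (F i)) :
    HasDiffQuotient fun x => ∑ i ∈ s, F i x := by
  classical
  induction s using Finset.induction_on with
  | empty => simpa using const 0
  | insert i s hi ih =>
    simp only [Finset.sum_insert hi]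
    exact (h i (Finset.mem_insert_self i s)).add
      (ih fun j hj => h j (Finset.mem_insert_of_mem hj))

end HasDiffQuotient

/-- The difference quotient of `r`; it vanishes at `0` as `r` vanishes there to order `k ≥ 2`. -/
theorem exists_quotient_rFun (k : ℕ) (c : ℝ) (a : ℕ → ℂ) (hk : 2 ≤ k) :
    ∃ S : ℂ × ℂ → ℂ, ContDiffAt ℂ ω S (0, 0) ∧ S (0, 0) = 0 ∧
      ∀ᶠ p : ℂ × ℂ in 𝓝 (0, 0),
        rFun k c a p.1 - rFun k c a p.2 = (p.1 - p.2) * S p := by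
  have hq : HasDiffQuotient (qFun k c a) :=
    ((HasDiffQuotient.const 1).add (HasDiffQuotient.sum _ fun l _ =>
      (HasDiffQuotient.const (a l)).mul (HasDiffQuotient.id.pow (k - l)))).add
      ((HasDiffQuotient.const (c : ℂ)).mul (HasDiffQuotient.id.pow (k + 1)))
  have h1 : HasDiffQuotient fun x => x ^ (k - 1) * (qFun k c a x)⁻¹ :=
    (HasDiffQuotient.id.pow (k - 1)).mul (hq.inv (by simp [qFun_zero]))
  obtain ⟨S, hS, he⟩ := h1.2
  refine ⟨fun p => p.1 ^ (k - 1) * (qFun k c a p.1)⁻¹ + p.2 * S p,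
    h1.comp_fst.add (contDiffAt_snd.mul hS), ?_, ?_⟩
  · simp [show k - 1 ≠ 0 by omega]
  · filter_upwards [he] with p hp
    have e : ∀ x, rFun k c a x = x * (x ^ (k - 1) * (qFun k c a x)⁻¹) := by
      intro x
      rw [rFun, ← mul_assoc, mul_pow_sub_one (by omega), div_eq_mul_inv]
    rw [e, e]
    linear_combination p.2 * hp

/-! ### Germs that lift to the tower -/

/-- The diagonal linear map with entries `s` and `t`. -/
noncomputable def diagMap (s t : ℂ) : ℂ × ℂ →L[ℂ] ℂ × ℂ :=
  (s • ContinuousLinearMap.fst ℂ ℂ ℂ).prod (t • ContinuousLinearMap.snd ℂ ℂ ℂ)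

theorem diagMap_comp (s t s' t' : ℂ) :
    (diagMap s' t').comp (diagMap s t) = diagMap (s' * s) (t' * t) := by
  ext <;> simp [diagMap]

theorem diagMap_one : diagMap 1 1 = ContinuousLinearMap.id ℂ (ℂ × ℂ) := by
  ext <;> simp [diagMap]

theorem hasFDerivAt_mul_of_eq_zero {f g : ℂ × ℂ → ℂ} {z : ℂ × ℂ} (hf : DifferentiableAt ℂ f z)
    (hg : DifferentiableAt ℂ g z) (hf0 : f z = 0) (hg0 : g z = 0) :
    HasFDerivAt (fun w => f w * g w) (0 : ℂ × ℂ →L[ℂ] ℂ) z := by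
  refine (hf.hasFDerivAt.fun_mul hg.hasFDerivAt).congr_fderiv ?_
  ext <;> simp [hf0, hg0]

/-- A germ `Θ` in the coordinates `(T, x)` near `F_s^1`, which maps the curve `D = 0`, where
`D = T - r(x)`, to itself to high order: it is `(D, x) ↦ (D α + x^(2k) β, x u + D γ)`, where `α - 1`
and `u - ε` vanish at `0` to second order and `β`, `γ` vanish at `0`. -/
def TowerGerm (k : ℕ) (c : ℝ) (a : ℕ → ℂ) (ε : ℂ) (Θ : ℂ × ℂ → ℂ × ℂ) : Prop :=
  ∃ α β u γ : ℂ × ℂ → ℂ, (ContDiffAt ℂ ω α 0 ∧ ContDiffAt ℂ ω β 0 ∧ ContDiffAt ℂ ω u 0 ∧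
    ContDiffAt ℂ ω γ 0) ∧ (α 0 = 1 ∧ β 0 = 0 ∧ u 0 = ε ∧ γ 0 = 0) ∧
    HasFDerivAt α (0 : ℂ × ℂ →L[ℂ] ℂ) 0 ∧ HasFDerivAt u (0 : ℂ × ℂ →L[ℂ] ℂ) 0 ∧
    ∀ᶠ w : ℂ × ℂ in 𝓝 0, Θ (rFun k c a w.2 + w.1, w.2) =
      (rFun k c a (w.2 * u w + w.1 * γ w) + (w.1 * α w + w.2 ^ (2 * k) * β w),
        w.2 * u w + w.1 * γ w)

/-- The germ `Θ` at `(0, 0)` expresses the affine map `τ` in the coordinates near `F_s^1` and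
`F_{s'}^1`. -/
def TowerCovers (c : ℝ) (τ : ℂ × ℂ → ℂ × ℂ) (Z : Set (ℂ × ℂ)) (s s' : ℕ)
    (Θ : ℂ × ℂ → ℂ × ℂ) : Prop :=
  ∀ᶠ w : ℂ × ℂ in 𝓝 0, ∀ u ∈ Z, towerPar c s w = stdPar 0 u →
    towerPar c s' (Θ w) = stdPar 0 (τ u)

section Lifts

variable {k : ℕ} {c : ℝ} {a : ℕ → ℂ} {ε : ℂ} {Θ : ℂ × ℂ → ℂ × ℂ} {τ : ℂ × ℂ → ℂ × ℂ}
  {Z : Set (ℂ × ℂ)} {s s' : ℕ}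

theorem rFun_zero (hk : k ≠ 0) : rFun k c a 0 = 0 := by simp [rFun, hk]

theorem tendsto_towerCoord (hk : k ≠ 0) {κ : ℂ × ℂ → ℂ × ℂ} {z : ℂ × ℂ}
    (hκ : Tendsto κ (𝓝 z) (𝓝 0)) :
    Tendsto (fun w => (rFun k c a (κ w).2 + (κ w).1, (κ w).2)) (𝓝 z) (𝓝 0) := by
  have h1 : ContinuousAt (rFun k c a) 0 :=
    (contDiffAt_rFun k c a (by simp [qFun_zero])).continuousAt
  have hκ1 : Tendsto (fun w => (κ w).1) (𝓝 z) (𝓝 0) := (continuous_fst.tendsto _).comp hκ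
  have hκ2 : Tendsto (fun w => (κ w).2) (𝓝 z) (𝓝 0) := (continuous_snd.tendsto _).comp hκ
  have h2 : Tendsto (fun w => rFun k c a (κ w).2) (𝓝 z) (𝓝 (rFun k c a 0)) := h1.tendsto.comp hκ2
  have h3 := (h2.add hκ1).prodMk_nhds hκ2
  rwa [rFun_zero hk, add_zero] at h3

/-- A tower germ lifts to the coordinates near `F_s^j`. -/
theorem TowerGerm.fiber_lift (hk : k ≠ 0) (hΘ : TowerGerm k c a ε Θ) (hε : ε ≠ 0)
    (hτ : TowerCovers c τ Z s s' Θ) {j : ℕ} (hj : 2 ≤ j) (hj' : j ≤ 2 * k + 1) (d : ℂ) :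
    ∃ G, GermCovers τ Z (fiberPar k c a j s) (d, 0) (fiberPar k c a j s') G ∧
      G (d, 0) = (d / ε ^ (j - 1), 0) ∧
      (3 ≤ j → j ≤ 2 * k → HasFDerivAt G (diagMap (1 / ε ^ (j - 1)) ε) (d, 0)) := by
  obtain ⟨α, β, u, γ, ⟨hα, hβ, hu, hγ⟩, ⟨hα0, hβ0, hu0, hγ0⟩, dα, du, he⟩ := hΘ
  obtain ⟨i, rfl⟩ : ∃ i, j = i + 2 := ⟨j - 2, by omega⟩
  obtain ⟨l, hl⟩ : ∃ l, 2 * k = i + 1 + l := ⟨2 * k - (i + 1), by omega⟩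
  rw [show i + 2 - 1 = i + 1 by omega]
  set κ : ℂ × ℂ → ℂ × ℂ := fun w => (w.1 * w.2 ^ (i + 1), w.2) with hκ
  have hκ0 : κ (d, 0) = 0 := by simp [hκ]
  have cκ : ContDiffAt ℂ ω κ (d, 0) :=
    ((contDiff_fst.mul (contDiff_snd.pow _)).prodMk contDiff_snd).contDiffAt
  have pull : ∀ {f : ℂ × ℂ → ℂ}, ContDiffAt ℂ ω f 0 →
      ContDiffAt ℂ ω (fun w => f (κ w)) (d, 0) := by
    intro f hf
    rw [← hκ0] at hf
    exact hf.comp (d, 0) cκ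
  set U : ℂ × ℂ → ℂ := fun w => u (κ w) + w.1 * (w.2 ^ i * γ (κ w)) with hU
  have cp : ∀ m : ℕ, ContDiffAt ℂ ω (fun w : ℂ × ℂ => w.2 ^ m) (d, 0) := fun m =>
    (contDiff_snd.pow m).contDiffAt
  have cU : ContDiffAt ℂ ω U (d, 0) :=
    (pull hu).add (contDiffAt_fst.mul ((cp i).mul (pull hγ)))
  have hU0 : U (d, 0) = ε := by simp [hU, hκ0, hu0, hγ0]
  set G : ℂ × ℂ → ℂ × ℂ := fun w =>
    ((w.1 * α (κ w) + w.2 ^ l * β (κ w)) / U w ^ (i + 1), w.2 * U w) with hG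
  have cN : ContDiffAt ℂ ω (fun w : ℂ × ℂ => w.1 * α (κ w) + w.2 ^ l * β (κ w)) (d, 0) :=
    (contDiffAt_fst.mul (pull hα)).add ((cp l).mul (pull hβ))
  refine ⟨G, ⟨(cN.div (cU.pow _) (by rw [hU0]; exact pow_ne_zero _ hε)).prodMk
    (contDiffAt_snd.mul cU), ?_⟩, ?_, ?_⟩
  · have tκ : Tendsto κ (𝓝 (d, 0)) (𝓝 0) := by
      have := cκ.continuousAt.tendsto
      rwa [hκ0] at this
    have hUne : ∀ᶠ w in 𝓝 (d, (0 : ℂ)), U w ≠ 0 :=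
      cU.continuousAt.eventually_ne (by rw [hU0]; exact hε)
    filter_upwards [tκ he, tendsto_towerCoord (c := c) (a := a) hk tκ hτ, hUne] with w h1 h2 h3 v hv hw
    have h1 : Θ (rFun k c a w.2 + w.1 * w.2 ^ (i + 1), w.2) = _ := h1
    have h2 : ∀ v ∈ Z, towerPar c s (rFun k c a w.2 + w.1 * w.2 ^ (i + 1), w.2) = stdPar 0 v →
      towerPar c s' (Θ (rFun k c a w.2 + w.1 * w.2 ^ (i + 1), w.2)) = stdPar 0 (τ v) := h2
    rw [← h2 v hv hw, h1, fiberPar, show i + 2 - 1 = i + 1 by omega]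
    have e2 : (κ w).2 * u (κ w) + (κ w).1 * γ (κ w) = w.2 * U w := by
      simp only [hU, hκ]
      ring
    have e1 : (κ w).1 * α (κ w) + (κ w).2 ^ (2 * k) * β (κ w) =
        (w.1 * α (κ w) + w.2 ^ l * β (κ w)) / U w ^ (i + 1) * (w.2 * U w) ^ (i + 1) := by
      rw [hl, mul_pow, div_mul_eq_mul_div, eq_div_iff (pow_ne_zero _ h3)]
      simp only [hκ]
      ring
    rw [e1, e2]
  · have hlβ : (0 : ℂ) ^ l * β 0 = 0 := by rw [hβ0, mul_zero]
    simp only [hG, hκ0, hU0, hα0, hlβ]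
    simp
  · intro h3 h4
    have dκ : ∀ {f : ℂ × ℂ → ℂ}, HasFDerivAt f (0 : ℂ × ℂ →L[ℂ] ℂ) 0 →
        HasFDerivAt (fun w => f (κ w)) (0 : ℂ × ℂ →L[ℂ] ℂ) (d, 0) := by
      intro f hf
      rw [← hκ0] at hf
      have := hf.comp (d, 0) (cκ.differentiableAt (by simp)).hasFDerivAt
      simpa using! this
    have dif : ∀ {f : ℂ × ℂ → ℂ}, ContDiffAt ℂ ω f (d, 0) → DifferentiableAt ℂ f (d, 0) :=
      fun h => h.differentiableAt (by simp)
    have d1 : HasFDerivAt U (0 : ℂ × ℂ →L[ℂ] ℂ) (d, 0) := by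
      have h5 : HasFDerivAt (fun w : ℂ × ℂ => w.2 ^ i * (w.1 * γ (κ w)))
          (0 : ℂ × ℂ →L[ℂ] ℂ) (d, 0) :=
        hasFDerivAt_mul_of_eq_zero (dif (cp i)) (dif (contDiffAt_fst.mul (pull hγ)))
          (zero_pow (by omega)) (by simp [hκ0, hγ0])
      have := (dκ du).add h5
      rw [add_zero] at this
      refine this.congr_of_eventuallyEq (.of_forall fun w => ?_)
      simp only [hU, Pi.add_apply]
      ring
    have d2 : HasFDerivAt (fun w : ℂ × ℂ => (U w ^ (i + 1))⁻¹) (0 : ℂ × ℂ →L[ℂ] ℂ) (d, 0) := by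
      have hne : U (d, 0) ^ (i + 1) ≠ 0 := by rw [hU0]; exact pow_ne_zero _ hε
      refine HasFDerivAt.congr_fderiv
        ((hasDerivAt_inv hne).comp_hasFDerivAt (d, (0 : ℂ)) (d1.pow (i + 1))) ?_
      ext <;> simp
    have d3 : HasFDerivAt (fun w : ℂ × ℂ => w.1 * α (κ w) + w.2 ^ l * β (κ w))
        (ContinuousLinearMap.fst ℂ ℂ ℂ) (d, 0) := by
      have h5 : HasFDerivAt (fun w : ℂ × ℂ => w.2 ^ l * β (κ w)) (0 : ℂ × ℂ →L[ℂ] ℂ) (d, 0) :=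
        hasFDerivAt_mul_of_eq_zero (dif (cp l)) (dif (pull hβ)) (zero_pow (by omega))
          (by simp [hκ0, hβ0])
      have h6 := (hasFDerivAt_fst (𝕜 := ℂ) (p := (d, (0 : ℂ)))).fun_mul (dκ dα)
      refine (h6.fun_add h5).congr_fderiv ?_
      ext <;> simp [hκ0, hα0]
    have d4 := d3.mul d2
    have d5 := (hasFDerivAt_snd (𝕜 := ℂ) (p := (d, (0 : ℂ)))).mul d1
    refine (d4.prodMk d5).congr_fderiv ?_
    ext <;> simp [diagMap, hU0]

/-- A tower germ lifts to the coordinates near the corners. -/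
theorem TowerGerm.corner_lift (hk : k ≠ 0) (hΘ : TowerGerm k c a ε Θ) (hε : ε ≠ 0)
    (hτ : TowerCovers c τ Z s s' Θ) {j : ℕ} (hj : 1 ≤ j) (hj' : j ≤ 2 * k) :
    ∃ G, GermCovers τ Z (cornerPar k c a j s) (0, 0) (cornerPar k c a j s') G ∧
      G (0, 0) = (0, 0) := by
  obtain ⟨α, β, u, γ, ⟨hα, hβ, hu, hγ⟩, ⟨hα0, hβ0, hu0, hγ0⟩, -, -, he⟩ := hΘ
  obtain ⟨i, rfl⟩ : ∃ i, j = i + 1 := ⟨j - 1, by omega⟩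
  obtain ⟨l, hl⟩ : ∃ l, 2 * k = i + 1 + l := ⟨2 * k - (i + 1), by omega⟩
  set κ : ℂ × ℂ → ℂ × ℂ := fun w => (w.1 ^ (i + 1) * w.2 ^ i, w.1 * w.2) with hκ
  have hκ0 : κ (0, 0) = 0 := by simp [hκ]
  have cκ : ContDiffAt ℂ ω κ (0, 0) :=
    (((contDiff_fst.pow _).mul (contDiff_snd.pow _)).prodMk
      (contDiff_fst.mul contDiff_snd)).contDiffAt
  have pull : ∀ {f : ℂ × ℂ → ℂ}, ContDiffAt ℂ ω f 0 →
      ContDiffAt ℂ ω (fun w => f (κ w)) (0, 0) := by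
    intro f hf
    rw [← hκ0] at hf
    exact hf.comp (0, 0) cκ
  have cm : ∀ m m' : ℕ, ContDiffAt ℂ ω (fun w : ℂ × ℂ => w.1 ^ m * w.2 ^ m') (0, 0) :=
    fun m m' => ((contDiff_fst.pow m).mul (contDiff_snd.pow m')).contDiffAt
  -- For `i = 0` the factor `U` enters only with exponent `0`, and its value is irrelevant.
  set U : ℂ × ℂ → ℂ := fun w => u (κ w) + w.1 ^ i * w.2 ^ (i - 1) * γ (κ w) with hU
  set V : ℂ × ℂ → ℂ := fun w => α (κ w) + w.1 ^ l * w.2 ^ (l + 1) * β (κ w) with hV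
  have cU : ContDiffAt ℂ ω U (0, 0) := (pull hu).add ((cm _ _).mul (pull hγ))
  have cV : ContDiffAt ℂ ω V (0, 0) := (pull hα).add ((cm _ _).mul (pull hβ))
  have hU0 : U (0, 0) = ε := by
    simp only [hU, hκ0, hu0, hγ0, mul_zero, add_zero]
  have hV0 : V (0, 0) = 1 := by
    simp only [hV, hκ0, hα0, hβ0, mul_zero, add_zero]
  set G : ℂ × ℂ → ℂ × ℂ := fun w => (w.1 * V w / U w ^ i,
    (w.2 * u (κ w) + w.1 ^ i * w.2 ^ i * γ (κ w)) * U w ^ i / V w) with hG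
  refine ⟨G, ⟨((contDiffAt_fst.mul cV).div (cU.pow _) (by rw [hU0]; exact pow_ne_zero _ hε)).prodMk
    ((((contDiffAt_snd.mul (pull hu)).add ((cm _ _).mul (pull hγ))).mul (cU.pow _)).div cV
      (by rw [hV0]; exact one_ne_zero)), ?_⟩, ?_⟩
  · have tκ : Tendsto κ (𝓝 (0, 0)) (𝓝 0) := by
      have := cκ.continuousAt.tendsto
      rwa [hκ0] at this
    filter_upwards [tκ he, tendsto_towerCoord (c := c) (a := a) hk tκ hτ,
      cU.continuousAt.eventually_ne (y := 0) (by rw [hU0]; exact hε),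
      cV.continuousAt.eventually_ne (y := 0) (by rw [hV0]; exact one_ne_zero)]
      with w h1 h2 h3 h4 v hv hw
    have h1 : Θ (rFun k c a (w.1 * w.2) + w.1 ^ (i + 1) * w.2 ^ i, w.1 * w.2) = _ := h1
    have h2 : ∀ v ∈ Z, towerPar c s
        (rFun k c a (w.1 * w.2) + w.1 ^ (i + 1) * w.2 ^ i, w.1 * w.2) = stdPar 0 v →
      towerPar c s' (Θ (rFun k c a (w.1 * w.2) + w.1 ^ (i + 1) * w.2 ^ i, w.1 * w.2)) =
        stdPar 0 (τ v) := h2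
    rw [← h2 v hv hw, h1, cornerPar, Nat.add_sub_cancel]
    have e2 : (G w).1 * (G w).2 = (κ w).2 * u (κ w) + (κ w).1 * γ (κ w) := by
      simp only [hG, hκ]
      field_simp
      ring
    have e3 : ((κ w).2 * u (κ w) + (κ w).1 * γ (κ w)) ^ i = (w.1 * w.2 * U w) ^ i := by
      rcases Nat.eq_zero_or_pos i with rfl | hi
      · simp
      · obtain ⟨m, rfl⟩ : ∃ m, i = m + 1 := ⟨i - 1, by omega⟩
        congr 1
        simp only [hU, hκ, Nat.add_sub_cancel]
        ring
    have e1 : (G w).1 ^ (i + 1) * (G w).2 ^ i =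
        (κ w).1 * α (κ w) + (κ w).2 ^ (2 * k) * β (κ w) := by
      rw [pow_succ', mul_assoc, ← mul_pow, e2, e3, hl]
      have e4 : (G w).1 * U w ^ i = w.1 * V w := by
        simp only [hG]
        field_simp
      rw [mul_pow, mul_comm _ (U w ^ i), ← mul_assoc, e4]
      simp only [hV, hκ]
      ring
    rw [e1, e2]
  · simp only [hG]
    rcases Nat.eq_zero_or_pos i with rfl | hi
    · simp [hκ0, hγ0]
    · simp [hi.ne']

end Lifts

/-! ### The germs which occur -/

section TowerGerms

variable (k : ℕ) (c : ℝ) (a : ℕ → ℂ)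

theorem towerGerm_id : TowerGerm k c a 1 fun w => w :=
  ⟨fun _ => 1, fun _ => 0, fun _ => 1, fun _ => 0,
    ⟨contDiffAt_const, contDiffAt_const, contDiffAt_const, contDiffAt_const⟩,
    ⟨rfl, rfl, rfl, rfl⟩, hasFDerivAt_const .., hasFDerivAt_const ..,
    .of_forall fun w => by simp⟩

/-- As `q` is even up to order `k`, the function `r` is even up to order `2k`. -/
theorem exists_rFun_sub_neg (hk : Even k) : ∃ A : ℂ → ℂ, ContDiffAt ℂ ω A 0 ∧ A 0 = 0 ∧
    ∀ᶠ x in 𝓝 0, rFun k c a x - rFun k c a (-x) = x ^ (2 * k) * A x := by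
  have h1 := (contDiff_qFun k c a).contDiffAt (x := 0)
  have h2 : ContDiffAt ℂ ω (fun x => qFun k c a (-x)) 0 :=
    ((contDiff_qFun k c a).comp contDiff_neg).contDiffAt
  refine ⟨fun x => -2 * c * x / (qFun k c a x * qFun k c a (-x)),
    (contDiffAt_const.mul contDiffAt_id).div (h1.mul h2) (by simp [qFun_zero]), by simp, ?_⟩
  filter_upwards [h1.continuousAt.eventually_ne (y := 0) (by simp [qFun_zero]),
    h2.continuousAt.eventually_ne (y := 0) (by simp [qFun_zero])] with x e1 e2
  rw [rFun, rFun, hk.neg_pow, div_sub_div _ _ e1 e2, mul_div_assoc', qFun_neg k c a hk]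
  congr 1
  ring

theorem exists_rFun_sq : ∃ B : ℂ → ℂ, ContDiffAt ℂ ω B 0 ∧
    ∀ x, rFun k c a x ^ 2 = x ^ (2 * k) * B x :=
  ⟨fun x => (qFun k c a x ^ 2)⁻¹,
    ((contDiff_qFun k c a).contDiffAt.pow 2).inv (by simp [qFun_zero]),
    fun x => by rw [rFun, div_pow, ← pow_mul, mul_comm k 2, div_eq_mul_inv]⟩

variable {k c a}

theorem ContDiffAt.comp_snd_zero {f : ℂ → ℂ} (h : ContDiffAt ℂ ω f 0) :
    ContDiffAt ℂ ω (fun w : ℂ × ℂ => f w.2) 0 :=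
  ContDiffAt.comp (0 : ℂ × ℂ) h contDiffAt_snd

theorem tendsto_snd_zero : Tendsto (fun w : ℂ × ℂ => w.2) (𝓝 0) (𝓝 0) :=
  continuous_snd.tendsto _

theorem hasFDerivAt_const_add_mul (b : ℂ) {f g : ℂ × ℂ → ℂ} {z : ℂ × ℂ} (hf : ContDiffAt ℂ ω f z)
    (hg : ContDiffAt ℂ ω g z) (hf0 : f z = 0) (hg0 : g z = 0) :
    HasFDerivAt (fun w => b + f w * g w) (0 : ℂ × ℂ →L[ℂ] ℂ) z :=
  (hasFDerivAt_mul_of_eq_zero (hf.differentiableAt (by simp)) (hg.differentiableAt (by simp))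
    hf0 hg0).const_add b

/-- The expression of `ρ` near `F_s^1` for `1 ≤ s ≤ n - 2`. -/
theorem towerGerm_moebius (hk : 2 ≤ k) (hk' : Even k) (κ : ℂ) :
    TowerGerm k c a (-1) fun w => (w.1 / (1 + κ * w.1 * w.2), -w.2) := by
  obtain ⟨A, cA, hA0, hA⟩ := exists_rFun_sub_neg k c a hk'
  obtain ⟨B, cB, hB⟩ := exists_rFun_sq k c a
  have hr0 : rFun k c a 0 = 0 := rFun_zero (by omega)
  have cr : ContDiffAt ℂ ω (fun w : ℂ × ℂ => rFun k c a w.2) 0 :=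
    (contDiffAt_rFun k c a (by simp [qFun_zero])).comp_snd_zero
  set V : ℂ × ℂ → ℂ := fun w => 1 + κ * (rFun k c a w.2 + w.1) * w.2 with hV
  have cV : ContDiffAt ℂ ω V 0 :=
    contDiffAt_const.add ((contDiffAt_const.mul (cr.add contDiffAt_fst)).mul contDiffAt_snd)
  have hV0 : V 0 = 1 := by simp [hV]
  have hVne : V 0 ≠ 0 := by rw [hV0]; exact one_ne_zero
  have c1 : ContDiffAt ℂ ω (fun w : ℂ × ℂ => -κ * w.2) 0 := contDiffAt_const.mul contDiffAt_snd
  have c2 : ContDiffAt ℂ ω (fun w : ℂ × ℂ => (2 * rFun k c a w.2 + w.1) / V w) 0 :=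
    ((contDiffAt_const.mul cr).add contDiffAt_fst).div cV hVne
  refine ⟨fun w => 1 + -κ * w.2 * ((2 * rFun k c a w.2 + w.1) / V w),
    fun w => A w.2 - κ * w.2 * (B w.2 / V w), fun _ => -1, fun _ => 0,
    ⟨contDiffAt_const.add (c1.mul c2),
      cA.comp_snd_zero.sub ((contDiffAt_const.mul contDiffAt_snd).mul
        (cB.comp_snd_zero.div cV hVne)),
      contDiffAt_const, contDiffAt_const⟩,
    ⟨by simp, by simp [hA0], rfl, rfl⟩,
    hasFDerivAt_const_add_mul 1 c1 c2 (by simp) (by simp [hr0]), hasFDerivAt_const .., ?_⟩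
  filter_upwards [tendsto_snd_zero hA, cV.continuousAt.eventually_ne hVne] with w h1 h2
  have h3 := hB w.2
  have h1 : rFun k c a w.2 - rFun k c a (-w.2) = w.2 ^ (2 * k) * A w.2 := h1
  have e : w.2 * -1 + w.1 * 0 = -w.2 := by ring
  simp only [e, Prod.mk.injEq, and_true]
  rw [div_eq_iff h2]
  have h4 : V w = 1 + κ * (rFun k c a w.2 + w.1) * w.2 := rfl
  field_simp
  linear_combination (-κ * w.2) * h3 + V w * h1 + (rFun k c a w.2 + w.1) * h4

/-- The expression of `σ` near `F_s^1` for `1 ≤ s ≤ n - 1`. -/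
theorem towerGerm_shear (hk : 2 ≤ k) (hk' : Even k) {H : ℂ → ℂ} (hH : ContDiffAt ℂ ω H 0) :
    TowerGerm k c a (-1) fun w => (w.1, -w.2 + w.1 ^ 2 * H w.1) := by
  obtain ⟨A, cA, hA0, hA⟩ := exists_rFun_sub_neg k c a hk'
  obtain ⟨B, cB, hB⟩ := exists_rFun_sq k c a
  obtain ⟨S, cS, hS0, hS⟩ := exists_quotient_rFun k c a hk
  have hr0 : rFun k c a 0 = 0 := rFun_zero (by omega)
  have cr : ContDiffAt ℂ ω (fun w : ℂ × ℂ => rFun k c a w.2) 0 :=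
    (contDiffAt_rFun k c a (by simp [qFun_zero])).comp_snd_zero
  have cT : ContDiffAt ℂ ω (fun w : ℂ × ℂ => rFun k c a w.2 + w.1) 0 := cr.add contDiffAt_fst
  have cH : ContDiffAt ℂ ω (fun w : ℂ × ℂ => H (rFun k c a w.2 + w.1)) 0 :=
    ContDiffAt.comp (0 : ℂ × ℂ) (g := H) (by simpa [hr0] using hH) cT
  set x' : ℂ × ℂ → ℂ := fun w =>
    -w.2 + (rFun k c a w.2 + w.1) ^ 2 * H (rFun k c a w.2 + w.1) with hx'
  have cx' : ContDiffAt ℂ ω x' 0 := contDiffAt_snd.neg.add ((cT.pow 2).mul cH)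
  have hx'0 : x' 0 = 0 := by simp [hx', hr0]
  have cp : ContDiffAt ℂ ω (fun w : ℂ × ℂ => (-w.2, x' w)) 0 := contDiffAt_snd.neg.prodMk cx'
  have hp0 : (-(0 : ℂ × ℂ).2, x' 0) = (0, 0) := by simp [hx'0]
  have cSp : ContDiffAt ℂ ω (fun w : ℂ × ℂ => S (-w.2, x' w)) 0 :=
    ContDiffAt.comp (0 : ℂ × ℂ) (g := S) (by rw [hp0]; exact cS) cp
  have hSp0 : S (-(0 : ℂ × ℂ).2, x' 0) = 0 := by simpa [hx'0] using hS0
  have tp : Tendsto (fun w : ℂ × ℂ => (-w.2, x' w)) (𝓝 0) (𝓝 (0, 0)) := by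
    have := cp.continuousAt.tendsto
    rwa [hp0] at this
  have cγ : ContDiffAt ℂ ω (fun w : ℂ × ℂ =>
      (2 * rFun k c a w.2 + w.1) * H (rFun k c a w.2 + w.1)) 0 :=
    ((contDiffAt_const.mul cr).add contDiffAt_fst).mul cH
  have cBH : ContDiffAt ℂ ω (fun w : ℂ × ℂ => B w.2 * H (rFun k c a w.2 + w.1)) 0 :=
    cB.comp_snd_zero.mul cH
  have cu : ContDiffAt ℂ ω (fun w : ℂ × ℂ =>
      w.2 ^ (2 * k - 2) * (B w.2 * H (rFun k c a w.2 + w.1))) 0 :=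
    (contDiffAt_snd.pow _).mul cBH
  refine ⟨fun w => 1 + (2 * rFun k c a w.2 + w.1) * H (rFun k c a w.2 + w.1) * -S (-w.2, x' w),
    fun w => A w.2 - B w.2 * H (rFun k c a w.2 + w.1) * S (-w.2, x' w),
    fun w => -1 + w.2 * (w.2 ^ (2 * k - 2) * (B w.2 * H (rFun k c a w.2 + w.1))),
    fun w => (2 * rFun k c a w.2 + w.1) * H (rFun k c a w.2 + w.1),
    ⟨contDiffAt_const.add (cγ.mul cSp.neg), cA.comp_snd_zero.sub (cBH.mul cSp),
      contDiffAt_const.add (contDiffAt_snd.mul cu), cγ⟩,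
    ⟨by simp [hr0], by simp only [hSp0]; simp [hA0], by simp, by simp [hr0]⟩,
    hasFDerivAt_const_add_mul 1 cγ cSp.neg (by simp [hr0])
      (by rw [hSp0, neg_zero]),
    hasFDerivAt_const_add_mul (-1) contDiffAt_snd cu (by simp)
      (by simp [show 2 * k - 2 ≠ 0 by omega]), ?_⟩
  filter_upwards [tendsto_snd_zero hA, tp hS] with w h1 h2
  have h3 := hB w.2
  have h1 : rFun k c a w.2 - rFun k c a (-w.2) = w.2 ^ (2 * k) * A w.2 := h1
  have h2 : rFun k c a (-w.2) - rFun k c a (x' w) = (-w.2 - x' w) * S (-w.2, x' w) := h2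
  have e5 : w.2 ^ (2 * k) = w.2 * (w.2 * w.2 ^ (2 * k - 2)) := by
    rw [← pow_succ', ← pow_succ']
    congr 1
    omega
  have hxw : x' w = -w.2 + (rFun k c a w.2 + w.1) ^ 2 * H (rFun k c a w.2 + w.1) := rfl
  have e : w.2 * (-1 + w.2 * (w.2 ^ (2 * k - 2) * (B w.2 * H (rFun k c a w.2 + w.1)))) +
      w.1 * ((2 * rFun k c a w.2 + w.1) * H (rFun k c a w.2 + w.1)) = x' w := by
    rw [hxw]
    linear_combination -H (rFun k c a w.2 + w.1) * h3 - B w.2 * H (rFun k c a w.2 + w.1) * e5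
  simp only [e]
  rw [← hxw]
  simp only [Prod.mk.injEq, and_true]
  linear_combination h1 + h2 + S (-w.2, x' w) * hxw -
    H (rFun k c a w.2 + w.1) * S (-w.2, x' w) * h3

end TowerGerms

/-! ### The factorization of `f` into two involutions -/

/-- The involution `(x, y) ↦ (x, -y + c x + h(1/x))`; the map `f` is its composition with the
exchange of the coordinates. -/
noncomputable def sigmaMap (k : ℕ) (c : ℝ) (a : ℕ → ℂ) (u : ℂ × ℂ) : ℂ × ℂ :=
  (u.1, -u.2 + c * u.1 + hFun k a u.1⁻¹)

/-- The affine points at which `sigmaMap` is defined. -/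
def sigmaDom : Set (ℂ × ℂ) := {u | u.1 ≠ 0}

theorem fMap_eq_sigmaMap (k : ℕ) (c : ℝ) (a : ℕ → ℂ) (z : ℂ × ℂ) :
    fMap k c a z = sigmaMap k c a z.swap := fMap_eq k c a z

theorem sigmaMap_sigmaMap (k : ℕ) (c : ℝ) (a : ℕ → ℂ) (u : ℂ × ℂ) :
    sigmaMap k c a (sigmaMap k c a u) = u := by
  ext
  · rfl
  · simp only [sigmaMap]
    ring

theorem exists_hFun_eq (k : ℕ) (a : ℕ → ℂ) (hk : 2 ≤ k) :
    ∃ h₂ : ℂ → ℂ, ContDiff ℂ ω h₂ ∧ ∀ t, hFun k a t = t ^ 2 * h₂ t := by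
  refine ⟨fun t => ∑ l ∈ (Finset.Icc 2 (k - 2)).filter Even, a l * t ^ (l - 2) + t ^ (k - 2),
    by fun_prop, fun t => ?_⟩
  rw [hFun, mul_add, Finset.mul_sum, ← pow_add, show 2 + (k - 2) = k by omega]
  congr 1
  refine Finset.sum_congr rfl fun l hl => ?_
  simp only [Finset.mem_filter, Finset.mem_Icc] at hl
  rw [mul_left_comm, ← pow_add, show 2 + (l - 2) = l by omega]

section PlaneCharts

variable {z u : ℂ × ℂ}

theorem stdPar_zero_eq_iff : stdPar 0 z = stdPar 0 u ↔ z = u :=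
  ⟨fun h => projPlane.injOn (0 : Fin 3) (mem_univ _) (mem_univ _) h, fun h => h ▸ rfl⟩

theorem stdPar_one_eq_iff : stdPar 1 z = stdPar 0 u ↔ z.1 * u.1 = 1 ∧ z.1 * u.2 = z.2 := by
  rw [stdPar_eq_iff']
  constructor
  · intro h
    exact ⟨by simpa [stdVec] using h 1, by simpa [stdVec] using h 2⟩
  · rintro ⟨h1, h2⟩ l
    fin_cases l <;> simp [stdVec, h1, h2]

theorem stdPar_two_eq_iff : stdPar 2 z = stdPar 0 u ↔ z.1 * u.1 = z.2 ∧ z.1 * u.2 = 1 := by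
  rw [stdPar_eq_iff']
  constructor
  · intro h
    exact ⟨by simpa [stdVec] using h 1, by simpa [stdVec] using h 2⟩
  · rintro ⟨h1, h2⟩ l
    fin_cases l <;> simp [stdVec, h1, h2]

/-- The `s`-th point `f^s e_2`. -/
noncomputable def markPt (c : ℝ) (s : ℕ) : ℙ ℂ (Fin 3 → ℂ) := stdPar (markIdx s) (markCtr c s)

variable {c : ℝ} {s : ℕ}

theorem stdPar_one_ne_markPt_zero : stdPar 1 z ≠ markPt c 0 := by
  intro h
  have h := (stdPar_eq_iff' ..).1 h 1
  simp [stdVec, markIdx, markCtr] at h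

theorem stdPar_two_eq_markPt_zero_iff : stdPar 2 z = markPt c 0 ↔ z = 0 := by
  have : markPt c 0 = stdPar 2 0 := by
    simp [markPt, markIdx, markCtr, ← Prod.zero_eq_mk]
  rw [this]
  exact ⟨fun h => projPlane.injOn (2 : Fin 3) (mem_univ _) (mem_univ _) h, fun h => h ▸ rfl⟩

theorem stdPar_one_eq_markPt_iff (hs : 1 ≤ s) :
    stdPar 1 z = markPt c s ↔ z = (0, orbit c s) := by
  have : markPt c s = stdPar 1 (0, orbit c s) := by
    simp [markPt, markIdx, markCtr, show s ≠ 0 by omega]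
  rw [this]
  exact ⟨fun h => projPlane.injOn (1 : Fin 3) (mem_univ _) (mem_univ _) h, fun h => h ▸ rfl⟩

theorem stdPar_two_eq_markPt_iff (hs : 1 ≤ s) :
    stdPar 2 z = markPt c s ↔ z.1 = 0 ∧ z.2 * orbit c s = 1 := by
  have : markPt c s = stdPar 1 (0, orbit c s) := by
    simp [markPt, markIdx, markCtr, show s ≠ 0 by omega]
  rw [this, stdPar_eq_iff']
  constructor
  · intro h
    exact ⟨by simpa [stdVec, eq_comm] using h 0, by simpa [stdVec] using h 2⟩
  · rintro ⟨h1, h2⟩ l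
    fin_cases l <;> simp [stdVec, h1, h2]

theorem towerPar_zero (w : ℂ × ℂ) : towerPar c 0 w = stdPar 2 (w.1, w.1 * w.2) := by
  simp [towerPar, markIdx, markCtr, orbitProd_zero]

theorem towerPar_pos (hs : 1 ≤ s) (w : ℂ × ℂ) : towerPar c s w =
    stdPar 1 (w.1 / orbitProd c s, orbit c s + w.1 * w.2 / orbitProd c s ^ 2) := by
  simp [towerPar, markIdx, markCtr, show s ≠ 0 by omega]

theorem lineCornerPar_zero (w : ℂ × ℂ) : lineCornerPar c 0 w = stdPar 2 (w.1 * w.2, w.2) := by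
  simp [lineCornerPar, markIdx, markCtr, blowCoord]

theorem lineCornerPar_pos (hs : 1 ≤ s) (w : ℂ × ℂ) :
    lineCornerPar c s w = stdPar 1 (w.1 * w.2, orbit c s + w.2) := by
  simp [lineCornerPar, markIdx, markCtr, show s ≠ 0 by omega, blowCoord]

end PlaneCharts

section Derivatives

theorem hasFDerivAt_fst_mul {g : ℂ × ℂ → ℂ} {z : ℂ × ℂ} (hg : ContDiffAt ℂ ω g z) (hz : z.1 = 0) :
    HasFDerivAt (fun w : ℂ × ℂ => w.1 * g w) (g z • ContinuousLinearMap.fst ℂ ℂ ℂ) z := by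
  refine (hasFDerivAt_fst.fun_mul (hg.differentiableAt (by simp)).hasFDerivAt).congr_fderiv ?_
  ext <;> simp [hz]

theorem hasFDerivAt_diag {f g : ℂ × ℂ → ℂ} {z : ℂ × ℂ} {s t : ℂ}
    (hf : HasFDerivAt f (s • ContinuousLinearMap.fst ℂ ℂ ℂ) z)
    (hg : HasFDerivAt g (t • ContinuousLinearMap.snd ℂ ℂ ℂ) z) :
    HasFDerivAt (fun w => (f w, g w)) (diagMap s t) z := hf.prodMk hg

theorem hasFDerivAt_smul_snd (t : ℂ) (z : ℂ × ℂ) :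
    HasFDerivAt (fun w : ℂ × ℂ => t * w.2) (t • ContinuousLinearMap.snd ℂ ℂ ℂ) z :=
  hasFDerivAt_snd.const_mul t

end Derivatives

/-! ### The action of the involutions near the curves `F_s^j` -/

/-- The map `τ` lifts to germs taking the coordinates near the curves `F_s^j` to those near
`F_{s'}^j`, and `x` to `ε x + ⋯`. -/
def TowerStep (k : ℕ) (c : ℝ) (a : ℕ → ℂ) (τ : ℂ × ℂ → ℂ × ℂ) (Z : Set (ℂ × ℂ)) (s s' : ℕ)
    (ε : ℂ) : Prop :=
  ∃ Θ, TowerGerm k c a ε Θ ∧ ∀ x, GermCovers τ Z (towerPar c s) (0, x) (towerPar c s') Θ ∧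
    Θ (0, x) = (0, ε * x) ∧ HasFDerivAt Θ (diagMap 1 ε) (0, x)

section TowerSteps

variable {n k : ℕ} {c : ℝ} (a : ℕ → ℂ)

/-- As `e_2` goes to `[0 : 1 : 0] = f^(n-1) e_2`, whose factor `w_1 ⋯ w_{n-2}` is `1` for admissible
`c`, the coordinates `(T, x)` do not change. -/
theorem towerStep_swap_zero (hc : c ∈ admissible n) :
    TowerStep k c a Prod.swap univ 0 (n - 1) 1 := by
  have hn := two_le_of_admissible hc
  refine ⟨_, towerGerm_id k c a, fun x => ⟨⟨contDiffAt_id, .of_forall fun w u _ h => ?_⟩, by simp,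
    by rw [diagMap_one]; exact hasFDerivAt_id _⟩⟩
  rw [towerPar_zero, stdPar_two_eq_iff] at h
  rw [towerPar_pos (by omega), orbitProd_last hc, orbit_last hc, stdPar_one_eq_iff]
  simpa using h.symm

theorem towerStep_swap_last (hc : c ∈ admissible n) :
    TowerStep k c a Prod.swap univ (n - 1) 0 1 := by
  have hn := two_le_of_admissible hc
  refine ⟨_, towerGerm_id k c a, fun x => ⟨⟨contDiffAt_id, .of_forall fun w u _ h => ?_⟩, by simp,
    by rw [diagMap_one]; exact hasFDerivAt_id _⟩⟩
  rw [towerPar_pos (by omega), orbitProd_last hc, orbit_last hc, stdPar_one_eq_iff] at h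
  rw [towerPar_zero, stdPar_two_eq_iff]
  simpa using h.symm

theorem orbitProd_rev (hc : c ∈ admissible n) {s : ℕ} (h1 : 1 ≤ s) (h2 : s + 1 < n) :
    orbitProd (c : ℂ) (n - 1 - s) = orbitProd (c : ℂ) s * orbit (c : ℂ) s := by
  rw [← orbitProd_succ _ h1, ← orbitProd_sub hc (by omega) h2]
  congr 1
  omega

/-- In the coordinate `y` of the line at infinity the exchange of `x` and `y` is `y ↦ 1 / y`, and
`w_{n-1-s} = 1 / w_s`. -/
theorem towerStep_swap_mid (hc : c ∈ admissible n) (hk : 2 ≤ k) (hk' : Even k) {s : ℕ}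
    (h1 : 1 ≤ s) (h2 : s + 1 < n) :
    TowerStep k c a Prod.swap univ s (n - 1 - s) (-1) := by
  have hP := orbitProd_ne_zero hc (s := s) (by omega)
  have hw := orbit_ne_zero hc h1 h2
  have hw' := orbit_mul_orbit_rev hc h1 h2
  have hP' := orbitProd_rev hc h1 h2
  set P := orbitProd (c : ℂ) s
  set y := orbit (c : ℂ) s
  refine ⟨_, towerGerm_moebius hk hk' (1 / (P ^ 2 * y)), fun x => ?_⟩
  have cV : ContDiffAt ℂ ω (fun w : ℂ × ℂ => 1 + 1 / (P ^ 2 * y) * w.1 * w.2) (0, x) := by fun_prop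
  have hV : ∀ᶠ w : ℂ × ℂ in 𝓝 (0, x), 1 + 1 / (P ^ 2 * y) * w.1 * w.2 ≠ 0 :=
    cV.continuousAt.eventually_ne (by simp)
  have hV0 : (1 : ℂ) + 1 / (P ^ 2 * y) * (0, x).1 * (0, x).2 ≠ 0 := by simp
  refine ⟨⟨(contDiffAt_fst.div cV hV0).prodMk contDiffAt_snd.neg, ?_⟩, by simp, ?_⟩
  · filter_upwards [hV] with w hw1 u _ h
    rw [towerPar_pos h1, stdPar_one_eq_iff] at h
    rw [towerPar_pos (by omega), hP', show orbit (c : ℂ) (n - 1 - s) = 1 / y by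
      rw [eq_div_iff hw, mul_comm, hw'], stdPar_one_eq_iff]
    obtain ⟨e1, e2⟩ := h
    set V := 1 + 1 / (P ^ 2 * y) * w.1 * w.2 with hVw
    have e3 : y * V = y + w.1 * w.2 / P ^ 2 := by
      rw [hVw]; field_simp
    have e2 : w.1 / P * u.2 = y + w.1 * w.2 / P ^ 2 := e2
    have e1 : w.1 / P * u.1 = 1 := e1
    refine ⟨?_, ?_⟩
    · change w.1 / V / (P * y) * u.2 = 1
      rw [show w.1 / V / (P * y) * u.2 = w.1 / P * u.2 / (y * V) by field_simp, e2, e3, div_self]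
      rw [← e3]
      exact mul_ne_zero hw hw1
    · change w.1 / V / (P * y) * u.1 = 1 / y + w.1 / V * -w.2 / (P * y) ^ 2
      rw [show w.1 / V / (P * y) * u.1 = w.1 / P * u.1 / (y * V) by field_simp, e1]
      field_simp
      clear_value V
      field_simp at e3
      linear_combination -e3
  · have cg : ContDiffAt ℂ ω (fun w : ℂ × ℂ => (1 + 1 / (P ^ 2 * y) * w.1 * w.2)⁻¹) (0, x) :=
      cV.inv hV0
    refine hasFDerivAt_diag ?_ ?_
    · have := hasFDerivAt_fst_mul cg rfl
      simpa only [div_eq_mul_inv, mul_zero, zero_mul, add_zero, inv_one] using this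
    · simpa using hasFDerivAt_smul_snd (-1) (0, x)

/-- In the coordinate `y` of the line at infinity `sigmaMap` is `y ↦ c - y`, and `w_{n-s} = c - w_s`. -/
theorem towerStep_sigma (hc : c ∈ admissible n) (hk : 2 ≤ k) (hk' : Even k) {s : ℕ}
    (h1 : 1 ≤ s) (h2 : s < n) :
    TowerStep k c a (sigmaMap k c a) sigmaDom s (n - s) (-1) := by
  have hP := orbitProd_ne_zero hc h2
  have hw := orbit_add_orbit_sub hc h1 h2
  have hP' := orbitProd_sub hc h1 h2
  set P := orbitProd (c : ℂ) s
  set y := orbit (c : ℂ) s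
  obtain ⟨h₂, ch, hh⟩ := exists_hFun_eq k a hk
  have cH : ContDiff ℂ ω fun T : ℂ => h₂ (T / P) / P := by fun_prop
  refine ⟨_, towerGerm_shear hk hk' cH.contDiffAt, fun x => ⟨⟨?_, .of_forall ?_⟩, by simp, ?_⟩⟩
  · exact ContDiff.contDiffAt (contDiff_fst.prodMk (contDiff_snd.neg.add
      ((contDiff_fst.pow 2).mul (cH.comp contDiff_fst))))
  · intro w u hu h
    rw [towerPar_pos h1, stdPar_one_eq_iff] at h
    rw [towerPar_pos (by omega), hP', stdPar_one_eq_iff]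
    obtain ⟨e1, e2⟩ := h
    refine ⟨e1, ?_⟩
    have e1 : w.1 / P * u.1 = 1 := e1
    have e2 : w.1 / P * u.2 = y + w.1 * w.2 / P ^ 2 := e2
    have e3 : u.1⁻¹ = w.1 / P := (eq_inv_of_mul_eq_one_left e1).symm
    change w.1 / P * (-u.2 + c * u.1 + hFun k a u.1⁻¹) = orbit (c : ℂ) (n - s) +
      w.1 * (-w.2 + w.1 ^ 2 * (h₂ (w.1 / P) / P)) / P ^ 2
    rw [e3, hh]
    have e4 : (w.1 / P) ^ 2 * h₂ (w.1 / P) * (w.1 / P) =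
      w.1 * (w.1 ^ 2 * (h₂ (w.1 / P) / P)) / P ^ 2 := by
      field_simp
    linear_combination -e2 + c * e1 + e4 - hw
  · refine hasFDerivAt_diag ?_ ?_
    · simpa using! hasFDerivAt_fst (𝕜 := ℂ) (p := ((0 : ℂ), x))
    · have h3 : ContDiffAt ℂ ω (fun w : ℂ × ℂ => w.1 * (h₂ (w.1 / P) / P)) (0, x) :=
        ContDiff.contDiffAt (contDiff_fst.mul (cH.comp contDiff_fst))
      have h4 := (hasFDerivAt_smul_snd (-1) (0, x)).fun_add (hasFDerivAt_fst_mul h3 rfl)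
      refine (h4.congr_fderiv ?_).congr_of_eventuallyEq (.of_forall fun w => ?_)
      · ext <;> simp
      change -w.2 + w.1 ^ 2 * (h₂ (w.1 / P) / P) = -1 * w.2 + w.1 * (w.1 * (h₂ (w.1 / P) / P))
      ring

end TowerSteps

section TowerStepLifts

variable {k : ℕ} {c : ℝ} {a : ℕ → ℂ} {ε : ℂ} {τ : ℂ × ℂ → ℂ × ℂ} {Z : Set (ℂ × ℂ)} {s s' : ℕ}

theorem TowerStep.fiber_lift (h : TowerStep k c a τ Z s s' ε) (hk : k ≠ 0) (hε : ε ≠ 0) {j : ℕ}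
    (hj : 2 ≤ j) (hj' : j ≤ 2 * k + 1) (d : ℂ) :
    ∃ G, GermCovers τ Z (fiberPar k c a j s) (d, 0) (fiberPar k c a j s') G ∧
      G (d, 0) = (d / ε ^ (j - 1), 0) ∧
      (3 ≤ j → j ≤ 2 * k → HasFDerivAt G (diagMap (1 / ε ^ (j - 1)) ε) (d, 0)) := by
  obtain ⟨Θ, hΘ, h⟩ := h
  exact hΘ.fiber_lift hk hε (h 0).1.2 hj hj' d

theorem TowerStep.corner_lift (h : TowerStep k c a τ Z s s' ε) (hk : k ≠ 0) (hε : ε ≠ 0) {j : ℕ}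
    (hj : 1 ≤ j) (hj' : j ≤ 2 * k) :
    ∃ G, GermCovers τ Z (cornerPar k c a j s) (0, 0) (cornerPar k c a j s') G ∧
      G (0, 0) = (0, 0) := by
  obtain ⟨Θ, hΘ, h⟩ := h
  exact hΘ.corner_lift hk hε (h 0).1.2 hj hj'

end TowerStepLifts

/-! ### The action of the second involution near `e_2`

In the coordinates `(D, x)`, `D = T - r(x)`, it is `(D, x) ↦ (r(x)² / D, x)`. -/

section SigmaZero

variable {k : ℕ} (c : ℝ) (a : ℕ → ℂ)

theorem rFun_inv_eq {x : ℂ} (hx : x ≠ 0) : (rFun k c a x)⁻¹ = c * x + hFun k a x⁻¹ := by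
  rw [rFun, inv_div, qFun_eq k c a hx, mul_div_cancel_left₀ _ (pow_ne_zero k hx)]

theorem rFun_ne_zero {x : ℂ} (hx : x ≠ 0) (hq : qFun k c a x ≠ 0) : rFun k c a x ≠ 0 :=
  div_ne_zero (pow_ne_zero k hx) hq

/-- The affine coordinates of a point with coordinates `(T, x)` near `e_2`. -/
theorem towerPar_zero_eq_iff {w u : ℂ × ℂ} :
    towerPar c 0 w = stdPar 0 u ↔ w.1 * u.2 = 1 ∧ w.2 = u.1 := by
  rw [towerPar_zero, stdPar_two_eq_iff]
  constructor
  · rintro ⟨h1, h2⟩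
    refine ⟨h2, ?_⟩
    have : w.1 ≠ 0 := by
      intro h0
      rw [h0, zero_mul] at h2
      exact zero_ne_one h2
    exact (mul_left_cancel₀ this h1).symm
  · rintro ⟨h1, h2⟩
    exact ⟨by rw [h2], h1⟩

/-- The key computation at `e_2`: since `1 / r = c x + h(1/x)`, the map `T ↦ T'`,
`1 / T' = 1 / r - 1 / T`, is `D ↦ r² / D` in terms of `D = T - r`. -/
theorem sigmaMap_tower {D D' x : ℂ} {u : ℂ × ℂ} (hx : x ≠ 0) (hq : qFun k c a x ≠ 0) (hD : D ≠ 0)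
    (hDD : D * D' = rFun k c a x ^ 2) (h : towerPar c 0 (rFun k c a x + D, x) = stdPar 0 u) :
    towerPar c 0 (rFun k c a x + D', x) = stdPar 0 (sigmaMap k c a u) := by
  rw [towerPar_zero_eq_iff] at h ⊢
  obtain ⟨h1, h2⟩ := h
  obtain rfl : x = u.1 := h2
  refine ⟨?_, rfl⟩
  have hr := rFun_ne_zero c a hx hq
  have e1 := rFun_inv_eq (k := k) c a hx
  simp only at h1 ⊢
  rw [sigmaMap, add_assoc, ← e1]
  set r := rFun k c a u.1
  have hT : r + D ≠ 0 := by
    intro h0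
    rw [h0, zero_mul] at h1
    exact zero_ne_one h1
  have e2 : u.2 = (r + D)⁻¹ := eq_inv_of_mul_eq_one_right h1
  have e3 : D' = r ^ 2 / D := by rw [eq_div_iff hD, mul_comm, hDD]
  rw [e2, e3]
  field_simp
  ring

theorem eventually_qFun_snd_ne_zero (d : ℂ) :
    ∀ᶠ w : ℂ × ℂ in 𝓝 (d, 0), qFun k c a w.2 ≠ 0 :=
  (continuous_snd.tendsto (d, (0 : ℂ))).eventually (eventually_qFun_ne_zero k c a)

theorem sigma_zero_first {x : ℂ} (hx : x ≠ 0) :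
    ∃ G, GermCovers (sigmaMap k c a) sigmaDom (towerPar c 0) (0, x) (towerPar c 0) G ∧
      G (0, x) = (0, x) ∧ HasFDerivAt G (diagMap (-1) 1) (0, x) := by
  have cx : ContDiff ℂ ω fun w : ℂ × ℂ => w.2 ^ k := contDiff_snd.pow k
  have cW : ContDiff ℂ ω fun w : ℂ × ℂ => qFun k c a w.2 * w.1 - w.2 ^ k :=
    (((contDiff_qFun k c a).comp contDiff_snd).mul contDiff_fst).sub cx
  have hW : qFun k c a x * 0 - x ^ k ≠ 0 := by
    simpa using pow_ne_zero k hx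
  have cg : ContDiffAt ℂ ω (fun w : ℂ × ℂ => w.2 ^ k / (qFun k c a w.2 * w.1 - w.2 ^ k)) (0, x) :=
    cx.contDiffAt.div cW.contDiffAt hW
  refine ⟨fun w => (w.1 * (w.2 ^ k / (qFun k c a w.2 * w.1 - w.2 ^ k)), 1 * w.2),
    ⟨(contDiffAt_fst.mul cg).prodMk (contDiffAt_const.mul contDiffAt_snd), ?_⟩, by simp,
    hasFDerivAt_diag ((hasFDerivAt_fst_mul cg rfl).congr_fderiv ?_) (hasFDerivAt_smul_snd 1 _)⟩
  · filter_upwards [cW.continuous.continuousAt.eventually_ne hW,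
      continuousAt_snd.eventually_ne (x := ((0 : ℂ), x)) hx] with w h1 h2 u hu h
    rw [towerPar_zero_eq_iff] at h ⊢
    obtain ⟨e1, e2⟩ := h
    refine ⟨?_, by rw [one_mul]; exact e2⟩
    have e3 : qFun k c a w.2 = w.2 ^ k * (c * w.2 + hFun k a w.2⁻¹) := qFun_eq k c a h2
    rw [sigmaMap, ← e2, mul_div_assoc', div_mul_eq_mul_div, div_eq_one_iff_eq h1, e3]
    linear_combination -w.2 ^ k * e1
  · have : x ^ k / (qFun k c a x * 0 - x ^ k) = -1 := by
      rw [mul_zero, zero_sub, div_neg, div_self (pow_ne_zero k hx)]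
    rw [this]

theorem hasFDerivAt_inv_qFun_sq (hk : 2 ≤ k) (d : ℂ) :
    HasFDerivAt (fun w : ℂ × ℂ => (qFun k c a w.2 ^ 2)⁻¹) (0 : ℂ × ℂ →L[ℂ] ℂ) (d, 0) := by
  have h1 : HasDerivAt (fun x => (qFun k c a x ^ 2)⁻¹) 0 0 := by
    have := ((hasDerivAt_qFun_zero k c a hk).fun_pow 2).fun_inv (by simp [qFun_zero])
    simpa using this
  have h2 : HasFDerivAt (fun w : ℂ × ℂ => w.2) (ContinuousLinearMap.snd ℂ ℂ ℂ) (d, (0 : ℂ)) :=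
    hasFDerivAt_snd
  have h3 := HasDerivAt.comp_hasFDerivAt (d, (0 : ℂ)) (h₂ := fun x => (qFun k c a x ^ 2)⁻¹) h1 h2
  refine HasFDerivAt.congr_fderiv h3 ?_
  ext <;> simp

/-- As `r² = x^(2k) / q²`, the curve `D = d x^(j-1)` goes to the one with exponent `2k + 1 - j`.
Thus the involution exchanges `F_0^j` with `F_0^(2k+2-j)`. -/
theorem sigma_zero_fiber (hk : 2 ≤ k) {j : ℕ} (hj : 2 ≤ j) (hj' : j ≤ 2 * k) {d : ℂ}
    (hd : d ≠ 0) :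
    ∃ G, GermCovers (sigmaMap k c a) sigmaDom (fiberPar k c a j 0) (d, 0)
        (fiberPar k c a (2 * k + 2 - j) 0) G ∧
      G (d, 0) = (1 / d, 0) ∧ HasFDerivAt G (diagMap (-1 / d ^ 2) 1) (d, 0) := by
  have cq : ContDiffAt ℂ ω (fun w : ℂ × ℂ => (qFun k c a w.2 ^ 2)⁻¹) (d, 0) :=
    (((contDiff_qFun k c a).comp contDiff_snd).pow 2).contDiffAt.inv (by simp [qFun_zero])
  refine ⟨fun w => ((qFun k c a w.2 ^ 2)⁻¹ * w.1⁻¹, 1 * w.2),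
    ⟨(cq.mul (contDiffAt_fst.inv hd)).prodMk (contDiffAt_const.mul contDiffAt_snd), ?_⟩,
    by simp [qFun_zero], hasFDerivAt_diag ?_ (hasFDerivAt_smul_snd 1 _)⟩
  · filter_upwards [eventually_qFun_snd_ne_zero c a d,
      continuousAt_fst.eventually_ne (x := (d, (0 : ℂ))) hd] with w h1 h2 u hu h
    have hx : w.2 ≠ 0 := by
      rw [fiberPar, towerPar_zero_eq_iff] at h
      rw [show w.2 = u.1 from h.2]
      exact hu
    rw [fiberPar, one_mul]
    refine sigmaMap_tower c a hx h1 (mul_ne_zero h2 (pow_ne_zero _ hx)) ?_ h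
    obtain ⟨i, rfl⟩ : ∃ i, j = i + 2 := ⟨j - 2, by omega⟩
    have e : w.2 ^ (2 * k) = w.2 ^ (i + 2 - 1) * w.2 ^ (2 * k + 2 - (i + 2) - 1) := by
      rw [← pow_add]
      congr 1
      omega
    rw [rFun, div_pow, ← pow_mul, mul_comm k 2, e]
    field_simp
  · have h1 : HasFDerivAt (fun w : ℂ × ℂ => w.1⁻¹)
        ((-1 / d ^ 2) • ContinuousLinearMap.fst ℂ ℂ ℂ) (d, 0) := by
      have h2 : HasFDerivAt (fun w : ℂ × ℂ => w.1) (ContinuousLinearMap.fst ℂ ℂ ℂ)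
        (d, (0 : ℂ)) := hasFDerivAt_fst
      have := HasDerivAt.comp_hasFDerivAt (d, (0 : ℂ)) (h₂ := fun x => x⁻¹) (hasDerivAt_inv hd) h2
      simpa [neg_div] using! this
    refine ((hasFDerivAt_inv_qFun_sq c a hk d).fun_mul h1).congr_fderiv ?_
    ext <;> simp [qFun_zero]

/-- The corner `F_0^j ∩ F_0^(j+1)` goes to `F_0^(2k+2-j) ∩ F_0^(2k+1-j)`, with the factors of
`x = a b` exchanged. -/
theorem sigma_zero_corner {j : ℕ} (hj : 1 ≤ j) (hj' : j ≤ 2 * k) :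
    ∃ G, GermCovers (sigmaMap k c a) sigmaDom (cornerPar k c a j 0) (0, 0)
        (cornerPar k c a (2 * k + 1 - j) 0) G ∧ G (0, 0) = (0, 0) := by
  have cm : ContDiff ℂ ω fun w : ℂ × ℂ => qFun k c a (w.1 * w.2) ^ 2 :=
    ((contDiff_qFun k c a).comp (contDiff_fst.mul contDiff_snd)).pow 2
  have hm : qFun k c a ((0, 0) : ℂ × ℂ).1 ^ 2 ≠ 0 := by simp [qFun_zero]
  have hq : ∀ᶠ w : ℂ × ℂ in 𝓝 (0, 0), qFun k c a (w.1 * w.2) ≠ 0 := by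
    have h2 : ContinuousAt (fun w : ℂ × ℂ => qFun k c a (w.1 * w.2)) (0, 0) :=
      ((contDiff_qFun k c a).comp (contDiff_fst.mul contDiff_snd)).continuous.continuousAt
    exact h2.eventually_ne (by simp [qFun_zero])
  refine ⟨fun w => (w.2 * (qFun k c a (w.1 * w.2) ^ 2)⁻¹, w.1 * qFun k c a (w.1 * w.2) ^ 2),
    ⟨(contDiffAt_snd.mul (cm.contDiffAt.inv (by simp [qFun_zero]))).prodMk
      (contDiffAt_fst.mul cm.contDiffAt), ?_⟩, by simp⟩
  filter_upwards [hq] with w h1 u hu h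
  have hx : w.1 * w.2 ≠ 0 := by
    rw [cornerPar, towerPar_zero_eq_iff] at h
    rw [show w.1 * w.2 = u.1 from h.2]
    exact hu
  have h2 := left_ne_zero_of_mul hx
  have h3 := right_ne_zero_of_mul hx
  have e : w.2 * (qFun k c a (w.1 * w.2) ^ 2)⁻¹ * (w.1 * qFun k c a (w.1 * w.2) ^ 2) =
      w.1 * w.2 := by
    generalize qFun k c a (w.1 * w.2) = Q at h1 ⊢
    field_simp
  rw [cornerPar]
  simp only [e]
  refine sigmaMap_tower c a hx h1 (mul_ne_zero (pow_ne_zero _ h2) (pow_ne_zero _ h3)) ?_ h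
  obtain ⟨i, rfl⟩ : ∃ i, j = i + 1 := ⟨j - 1, by omega⟩
  obtain ⟨l, hl⟩ : ∃ l, 2 * k = i + 1 + l := ⟨2 * k - (i + 1), by omega⟩
  rw [show 2 * k + 1 - (i + 1) = l + 1 by omega, Nat.add_sub_cancel, Nat.add_sub_cancel, rFun,
    div_pow, ← pow_mul, mul_comm k 2, hl]
  rw [pow_succ (w.2 * _), mul_right_comm ((w.2 * _) ^ l), ← mul_pow, e, div_eq_mul_inv]
  ring

/-- The last curve of the tower over `e_2` is exchanged with the affine line `{x = 0}`. -/
theorem sigma_zero_last (hk : k ≠ 0) (d : ℂ) :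
    ∃ G, GermCovers (sigmaMap k c a) sigmaDom (fiberPar k c a (2 * k + 1) 0) (d, 0)
        (stdPar 0) G := by
  have cq : ContDiff ℂ ω fun w : ℂ × ℂ => qFun k c a w.2 := (contDiff_qFun k c a).comp contDiff_snd
  have cV : ContDiff ℂ ω fun w : ℂ × ℂ => 1 + qFun k c a w.2 * w.1 * w.2 ^ k :=
    contDiff_const.add ((cq.mul contDiff_fst).mul (contDiff_snd.pow k))
  have hV : 1 + qFun k c a ((d, 0) : ℂ × ℂ).2 * ((d, 0) : ℂ × ℂ).1 * ((d, 0) : ℂ × ℂ).2 ^ k ≠ 0 := by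
    simp [hk]
  refine ⟨fun w => (w.2, w.1 * qFun k c a w.2 ^ 2 / (1 + qFun k c a w.2 * w.1 * w.2 ^ k)),
    contDiffAt_snd.prodMk ((contDiffAt_fst.mul (cq.pow 2).contDiffAt).div cV.contDiffAt hV), ?_⟩
  filter_upwards [eventually_qFun_snd_ne_zero c a d,
    cV.continuous.continuousAt.eventually_ne hV] with w h1 h2 u hu h
  rw [fiberPar, towerPar_zero_eq_iff] at h
  obtain ⟨e1, e2⟩ := h
  have e2 : w.2 = u.1 := e2
  have hx : w.2 ≠ 0 := by rw [e2]; exact hu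
  rw [stdPar_zero_eq_iff, sigmaMap, add_assoc, ← e2, ← rFun_inv_eq c a hx]
  refine Prod.ext rfl ?_
  have e3 : u.2 = (rFun k c a w.2 + w.1 * w.2 ^ (2 * k))⁻¹ := eq_inv_of_mul_eq_one_right e1
  have e4 : rFun k c a w.2 + w.1 * w.2 ^ (2 * k) =
      w.2 ^ k / qFun k c a w.2 * (1 + qFun k c a w.2 * w.1 * w.2 ^ k) := by
    rw [rFun]
    field_simp
    ring
  have e5 : 1 + qFun k c a w.2 * w.1 * w.2 ^ k - 1 = qFun k c a w.2 * w.1 * w.2 ^ k := by ring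
  simp only
  rw [e3, e4, rFun]
  generalize 1 + qFun k c a w.2 * w.1 * w.2 ^ k = V at h2 e5 ⊢
  field_simp
  linear_combination -e5

theorem sigma_zero_affine (hk : k ≠ 0) (y : ℂ) :
    ∃ G, GermCovers (sigmaMap k c a) sigmaDom (stdPar 0) (0, y) (fiberPar k c a (2 * k + 1) 0) G ∧
      (G (0, y)).2 = 0 := by
  have cq : ContDiffAt ℂ ω (fun w : ℂ × ℂ => qFun k c a w.1) (0, y) :=
    ((contDiff_qFun k c a).comp contDiff_fst).contDiffAt
  have hq0 : qFun k c a ((0, y) : ℂ × ℂ).1 ≠ 0 := by simp [qFun_zero]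
  have cV : ContDiffAt ℂ ω (fun w : ℂ × ℂ => qFun k c a w.1 * (qFun k c a w.1 - w.1 ^ k * w.2))
      (0, y) :=
    cq.mul (cq.sub ((contDiffAt_fst.pow k).mul contDiffAt_snd))
  have hV : qFun k c a ((0, y) : ℂ × ℂ).1 *
      (qFun k c a ((0, y) : ℂ × ℂ).1 - ((0, y) : ℂ × ℂ).1 ^ k * ((0, y) : ℂ × ℂ).2) ≠ 0 := by
    simp [hk, qFun_zero]
  refine ⟨fun w => (w.2 / (qFun k c a w.1 * (qFun k c a w.1 - w.1 ^ k * w.2)), w.1),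
    ⟨(contDiffAt_snd.div cV hV).prodMk contDiffAt_fst, ?_⟩, rfl⟩
  filter_upwards [cV.continuousAt.eventually_ne hV] with w h2 u hu h
  obtain rfl := stdPar_zero_eq_iff.1 h
  have h1 := left_ne_zero_of_mul h2
  have h3 := right_ne_zero_of_mul h2
  have hx : w.1 ≠ 0 := hu
  rw [fiberPar, towerPar_zero_eq_iff, Nat.add_sub_cancel]
  refine ⟨?_, rfl⟩
  rw [sigmaMap, add_assoc, ← rFun_inv_eq c a hx, rFun]
  simp only
  field_simp
  ring

theorem sigma_zero_lineCorner :
    ∃ G, GermCovers (sigmaMap k c a) sigmaDom (lineCornerPar c 0) (0, 0) (lineCornerPar c 0) G ∧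
      G (0, 0) = (0, 0) := by
  have cV : ContDiff ℂ ω fun w : ℂ × ℂ => -1 + c * w.2 + w.1 * w.2 * hFun k a w.1 :=
    (contDiff_const.add (contDiff_const.mul contDiff_snd)).add
      ((contDiff_fst.mul contDiff_snd).mul ((contDiff_hFun k a).comp contDiff_fst))
  have hV : -1 + c * ((0, 0) : ℂ × ℂ).2 +
      ((0, 0) : ℂ × ℂ).1 * ((0, 0) : ℂ × ℂ).2 * hFun k a ((0, 0) : ℂ × ℂ).1 ≠ 0 := by simp
  refine ⟨fun w => (w.1, w.2 / (-1 + c * w.2 + w.1 * w.2 * hFun k a w.1)),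
    ⟨contDiffAt_fst.prodMk (contDiffAt_snd.div cV.contDiffAt hV), ?_⟩, by simp⟩
  filter_upwards [cV.continuous.continuousAt.eventually_ne hV] with w h1 u hu h
  rw [lineCornerPar_zero, stdPar_two_eq_iff] at h ⊢
  obtain ⟨e1, e2⟩ := h
  simp only at e1 e2
  have hb : w.2 ≠ 0 := by
    rintro h0
    rw [h0, mul_zero, zero_mul] at e2
    exact zero_ne_one e2
  have e3 : w.1 * u.1 = 1 := by
    apply mul_left_cancel₀ hb
    linear_combination e1
  have e4 : u.1⁻¹ = w.1 := (eq_inv_of_mul_eq_one_left e3).symm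
  have e5 : -1 + c * w.2 + w.1 * w.2 * hFun k a w.1 - (-1 + c * w.2) =
    w.1 * w.2 * hFun k a w.1 := by ring
  simp only [sigmaMap, e4]
  generalize -1 + c * w.2 + w.1 * w.2 * hFun k a w.1 = V at h1 e5 ⊢
  refine ⟨?_, ?_⟩
  · field_simp
    exact e3
  · field_simp
    linear_combination -e2 + c * w.2 * e3 - e5

end SigmaZero

/-! ### Lifting the involutions to the surface -/

/-- The local models of the points of `𝒳`: those of the points off the last marked points, and the
last marked points themselves, which are ordinary points of the curves `F_s^(2k+1)`. -/
def SurfaceModel (k : ℕ) (c : ℝ) (a : ℕ → ℂ) (n : ℕ) (φ : ℂ × ℂ → ℙ ℂ (Fin 3 → ℂ)) (z : ℂ × ℂ) :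
    Prop :=
  TowerModel k c a n (2 * k + 1) φ z ∨ ∃ s < n, φ = fiberPar k c a (2 * k + 1) s ∧ z = (0, 0)

section Lifts

variable {n k : ℕ} {c : ℝ} {a : ℕ → ℂ}

theorem SurfaceModel.last (hk : 2 ≤ k) {s : ℕ} (hs : s < n) (d : ℂ) :
    SurfaceModel k c a n (fiberPar k c a (2 * k + 1) s) (d, 0) := by
  by_cases hd : d = 0
  · exact .inr ⟨s, hs, rfl, by rw [hd]⟩
  · exact .inl (.fiber s _ d hs (by omega) le_rfl hd)

/-- The map `τ` lifts near the point with model `φ`, `z`. -/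
def HasLift (k : ℕ) (c : ℝ) (a : ℕ → ℂ) (n : ℕ) (τ : ℂ × ℂ → ℂ × ℂ) (Z : Set (ℂ × ℂ))
    (φ : ℂ × ℂ → ℙ ℂ (Fin 3 → ℂ)) (z : ℂ × ℂ) : Prop :=
  ∃ ψ G, SurfaceModel k c a n ψ (G z) ∧ GermCovers τ Z φ z ψ G

variable {τ : ℂ × ℂ → ℂ × ℂ} {Z : Set (ℂ × ℂ)}

theorem TowerStep.hasLift_first {s s' : ℕ} {ε : ℂ} (h : TowerStep k c a τ Z s s' ε)
    (hs' : s' < n) (hε : ε ≠ 0) {x : ℂ} (hx : x ≠ 0) :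
    HasLift k c a n τ Z (towerPar c s) (0, x) := by
  obtain ⟨Θ, -, h⟩ := h
  refine ⟨_, Θ, ?_, (h x).1⟩
  rw [(h x).2.1]
  exact .inl (.first s' _ hs' (mul_ne_zero hε hx))

theorem TowerStep.hasLift_fiber {s s' : ℕ} {ε : ℂ} (h : TowerStep k c a τ Z s s' ε) (hk : 2 ≤ k)
    (hs' : s' < n) (hε : ε ≠ 0) {j : ℕ} (hj : 2 ≤ j) (hj' : j ≤ 2 * k + 1) {d : ℂ} (hd : d ≠ 0) :
    HasLift k c a n τ Z (fiberPar k c a j s) (d, 0) := by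
  obtain ⟨G, h1, h2, -⟩ := h.fiber_lift (by omega) hε hj hj' d
  refine ⟨_, G, ?_, h1⟩
  rw [h2]
  exact .inl (.fiber s' j _ hs' hj hj' (div_ne_zero hd (pow_ne_zero _ hε)))

theorem TowerStep.hasLift_last {s s' : ℕ} {ε : ℂ} (h : TowerStep k c a τ Z s s' ε) (hk : 2 ≤ k)
    (hs' : s' < n) (hε : ε ≠ 0) (d : ℂ) :
    HasLift k c a n τ Z (fiberPar k c a (2 * k + 1) s) (d, 0) := by
  obtain ⟨G, h1, h2, -⟩ := h.fiber_lift (by omega) hε (by omega) le_rfl d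
  refine ⟨_, G, ?_, h1⟩
  rw [h2]
  exact .last hk hs' _

theorem TowerStep.hasLift_corner {s s' : ℕ} {ε : ℂ} (h : TowerStep k c a τ Z s s' ε) (hk : 2 ≤ k)
    (hs' : s' < n) (hε : ε ≠ 0) {j : ℕ} (hj : 1 ≤ j) (hj' : j < 2 * k + 1) :
    HasLift k c a n τ Z (cornerPar k c a j s) (0, 0) := by
  obtain ⟨G, h1, h2⟩ := h.corner_lift (by omega) hε hj (by omega)
  refine ⟨_, G, ?_, h1⟩
  rw [h2]
  exact .inl (.corner s' j hs' hj hj')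

theorem surfaceModel_affine (z : ℂ × ℂ) : SurfaceModel k c a n (stdPar 0) z :=
  .inl (.plane 0 z fun s _ h => stdPar_mark_ne_affine s z h.symm)

theorem exists_towerStep_swap (hc : c ∈ admissible n) (hk : 2 ≤ k) (hk' : Even k) {s : ℕ}
    (hs : s < n) : ∃ s' < n, ∃ ε ≠ 0, TowerStep k c a Prod.swap univ s s' ε := by
  rcases Nat.eq_zero_or_pos s with rfl | h1
  · exact ⟨n - 1, by omega, 1, one_ne_zero, towerStep_swap_zero a hc⟩
  rcases Nat.eq_or_lt_of_le (show s + 1 ≤ n from hs) with h2 | h2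
  · obtain rfl : s = n - 1 := by omega
    exact ⟨0, by omega, 1, one_ne_zero, towerStep_swap_last a hc⟩
  · exact ⟨n - 1 - s, by omega, -1, by simp, towerStep_swap_mid a hc hk hk' h1 h2⟩

theorem hasLift_swap_lineCorner (hc : c ∈ admissible n) {s : ℕ} (hs : s < n) :
    HasLift k c a n Prod.swap univ (lineCornerPar c s) (0, 0) := by
  have hn := two_le_of_admissible hc
  rcases Nat.eq_zero_or_pos s with rfl | h1
  · refine ⟨lineCornerPar c (n - 1), fun w => w, .inl (.lineCorner _ (by omega)), contDiffAt_id,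
      .of_forall fun w u _ h => ?_⟩
    rw [lineCornerPar_zero, stdPar_two_eq_iff] at h
    rw [lineCornerPar_pos (by omega), stdPar_one_eq_iff, orbit_last hc, zero_add]
    exact h.symm
  rcases Nat.eq_or_lt_of_le (show s + 1 ≤ n from hs) with h2 | h2
  · obtain rfl : s = n - 1 := by omega
    refine ⟨lineCornerPar c 0, fun w => w, .inl (.lineCorner _ (by omega)), contDiffAt_id,
      .of_forall fun w u _ h => ?_⟩
    rw [lineCornerPar_pos (by omega), stdPar_one_eq_iff, orbit_last hc, zero_add] at h
    rw [lineCornerPar_zero, stdPar_two_eq_iff]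
    exact h.symm
  · have hw := orbit_ne_zero hc h1 h2
    have hw' := orbit_mul_orbit_rev hc h1 h2
    set y := orbit (c : ℂ) s with hy
    have cV : ContDiff ℂ ω fun w : ℂ × ℂ => y * (y + w.2) := by fun_prop
    have hV : y * (y + ((0, 0) : ℂ × ℂ).2) ≠ 0 := by simpa using hw
    refine ⟨lineCornerPar c (n - 1 - s), fun w => (-w.1 * y, -w.2 / (y * (y + w.2))), ?_,
      (contDiffAt_fst.neg.mul contDiffAt_const).prodMk
        (contDiffAt_snd.neg.div cV.contDiffAt hV), ?_⟩
    · simpa using .inl (.lineCorner _ (by omega))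
    · filter_upwards [cV.continuous.continuousAt.eventually_ne hV] with w h3 u _ h
      rw [lineCornerPar_pos h1, stdPar_one_eq_iff, ← hy] at h
      rw [lineCornerPar_pos (by omega), stdPar_one_eq_iff, show orbit (c : ℂ) (n - 1 - s) = 1 / y by
        rw [eq_div_iff hw, mul_comm, hw']]
      obtain ⟨e1, e2⟩ := h
      have h4 := right_ne_zero_of_mul h3
      simp only [Prod.fst_swap, Prod.snd_swap] at e1 e2 ⊢
      refine ⟨?_, ?_⟩
      · field_simp
        linear_combination e2
      · field_simp
        linear_combination y * e1

/-- The exchange of the coordinates lifts. -/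
theorem SurfaceModel.hasLift_swap (hc : c ∈ admissible n) (hk : 2 ≤ k) (hk' : Even k)
    {φ : ℂ × ℂ → ℙ ℂ (Fin 3 → ℂ)} {z : ℂ × ℂ} (h : SurfaceModel k c a n φ z) :
    HasLift k c a n Prod.swap univ φ z := by
  have hn := two_le_of_admissible hc
  rcases h with h | ⟨s, hs, rfl, rfl⟩
  · cases h with
    | plane i z h =>
      match i with
      | 0 =>
        refine ⟨stdPar 0, Prod.swap, surfaceModel_affine _,
          (contDiff_snd.prodMk contDiff_fst).contDiffAt,
          .of_forall fun w u _ h => ?_⟩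
        rw [stdPar_zero_eq_iff] at h ⊢
        rw [h]
      | 1 =>
        refine ⟨stdPar 2, fun w => w, .inl (.plane 2 z fun s hs hm => ?_), contDiffAt_id,
          .of_forall fun w u _ h => ?_⟩
        · have hm : stdPar 2 z = markPt c s := hm
          rcases Nat.eq_zero_or_pos s with rfl | h1
          · rw [stdPar_two_eq_markPt_zero_iff] at hm
            refine h (n - 1) (by omega) ((stdPar_one_eq_markPt_iff (by omega)).2 ?_)
            rw [hm, orbit_last hc]
            rfl
          · rw [stdPar_two_eq_markPt_iff h1] at hm
            have h2 : s + 1 < n := by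
              by_contra h2
              obtain rfl : s = n - 1 := by omega
              rw [orbit_last hc, mul_zero] at hm
              exact zero_ne_one hm.2
            refine h (n - 1 - s) (by omega) ((stdPar_one_eq_markPt_iff (by omega)).2 ?_)
            refine Prod.ext hm.1 (mul_right_cancel₀ (orbit_ne_zero hc h1 h2) ?_)
            rw [hm.2, mul_comm, orbit_mul_orbit_rev hc h1 h2]
        · rw [stdPar_one_eq_iff] at h
          rw [stdPar_two_eq_iff]
          exact h.symm
      | 2 =>
        refine ⟨stdPar 1, fun w => w, .inl (.plane 1 z fun s hs hm => ?_), contDiffAt_id,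
          .of_forall fun w u _ h => ?_⟩
        · have hm : stdPar 1 z = markPt c s := hm
          rcases Nat.eq_zero_or_pos s with rfl | h1
          · exact stdPar_one_ne_markPt_zero hm
          rw [stdPar_one_eq_markPt_iff h1] at hm
          by_cases h2 : s + 1 < n
          · refine h (n - 1 - s) (by omega) ((stdPar_two_eq_markPt_iff (by omega)).2 ?_)
            rw [hm]
            exact ⟨rfl, orbit_mul_orbit_rev hc h1 h2⟩
          · obtain rfl : s = n - 1 := by omega
            refine h 0 (by omega) (stdPar_two_eq_markPt_zero_iff.2 ?_)
            rw [hm, orbit_last hc]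
            rfl
        · rw [stdPar_two_eq_iff] at h
          rw [stdPar_one_eq_iff]
          exact h.symm
    | first s x hs hx =>
      obtain ⟨s', hs', ε, hε, h⟩ := exists_towerStep_swap (a := a) hc hk hk' hs
      exact h.hasLift_first hs' hε hx
    | lineCorner s hs => exact hasLift_swap_lineCorner hc hs
    | fiber s j d hs hj hjM hd =>
      obtain ⟨s', hs', ε, hε, h⟩ := exists_towerStep_swap (a := a) hc hk hk' hs
      exact h.hasLift_fiber hk hs' hε hj hjM hd
    | corner s j hs hj hjM =>
      obtain ⟨s', hs', ε, hε, h⟩ := exists_towerStep_swap (a := a) hc hk hk' hs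
      exact h.hasLift_corner hk hs' hε hj hjM
  · obtain ⟨s', hs', ε, hε, h⟩ := exists_towerStep_swap (a := a) hc hk hk' hs
    exact h.hasLift_last hk hs' hε 0

theorem hasLift_sigma_lineCorner (hc : c ∈ admissible n) {s : ℕ} (hs : s < n) :
    HasLift k c a n (sigmaMap k c a) sigmaDom (lineCornerPar c s) (0, 0) := by
  rcases Nat.eq_zero_or_pos s with rfl | h1
  · obtain ⟨G, hG, hG0⟩ := sigma_zero_lineCorner (k := k) c a
    refine ⟨_, G, ?_, hG⟩
    rw [hG0]
    exact .inl (.lineCorner 0 hs)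
  · have hw := orbit_add_orbit_sub hc h1 hs
    have cV : ContDiff ℂ ω fun w : ℂ × ℂ => -1 + w.1 * hFun k a (w.1 * w.2) :=
      contDiff_const.add (contDiff_fst.mul ((contDiff_hFun k a).comp
        (contDiff_fst.mul contDiff_snd)))
    have hV : -1 + ((0, 0) : ℂ × ℂ).1 * hFun k a (((0, 0) : ℂ × ℂ).1 * ((0, 0) : ℂ × ℂ).2) ≠ 0 := by
      simp
    refine ⟨lineCornerPar c (n - s), fun w => (w.1 / (-1 + w.1 * hFun k a (w.1 * w.2)),
      w.2 * (-1 + w.1 * hFun k a (w.1 * w.2))), ?_,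
      (contDiffAt_fst.div cV.contDiffAt hV).prodMk (contDiffAt_snd.mul cV.contDiffAt), ?_⟩
    · simpa using .inl (.lineCorner _ (by omega))
    · filter_upwards [cV.continuous.continuousAt.eventually_ne hV] with w h3 u _ h
      rw [lineCornerPar_pos h1, stdPar_one_eq_iff] at h
      rw [lineCornerPar_pos (by omega), stdPar_one_eq_iff]
      obtain ⟨e1, e2⟩ := h
      simp only at e1 e2
      have e4 : u.1⁻¹ = w.1 * w.2 := (eq_inv_of_mul_eq_one_left e1).symm
      have e5 : -1 + w.1 * hFun k a (w.1 * w.2) + 1 = w.1 * hFun k a (w.1 * w.2) := by ring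
      simp only [sigmaMap, e4]
      generalize -1 + w.1 * hFun k a (w.1 * w.2) = V at h3 e5 ⊢
      have e6 : w.1 / V * (w.2 * V) = w.1 * w.2 := by field_simp
      rw [e6]
      exact ⟨e1, by linear_combination -e2 + c * e1 - hw - w.2 * e5⟩

theorem hasLift_sigma_plane (hc : c ∈ admissible n) (hk : 2 ≤ k) (i : Fin 3) (z : ℂ × ℂ)
    (h : ∀ s < n, stdPar i z ≠ markPt c s) :
    HasLift k c a n (sigmaMap k c a) sigmaDom (stdPar i) z := by
  have hn := two_le_of_admissible hc
  have aff : ∀ z : ℂ × ℂ, HasLift k c a n (sigmaMap k c a) sigmaDom (stdPar 0) z := by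
    rintro ⟨x, y⟩
    by_cases hx : x = 0
    · subst hx
      obtain ⟨G, hG, hG0⟩ := sigma_zero_affine (k := k) c a (by omega) y
      refine ⟨_, G, ?_, hG⟩
      rw [show G (0, y) = ((G (0, y)).1, 0) from Prod.ext rfl hG0]
      exact .last hk (by omega) _
    · have c1 : ContDiffAt ℂ ω (fun w : ℂ × ℂ => hFun k a w.1⁻¹) (x, y) :=
        ContDiffAt.comp (x, y) (g := hFun k a) (contDiff_hFun k a).contDiffAt
          (contDiffAt_fst.inv hx)
      refine ⟨stdPar 0, sigmaMap k c a, surfaceModel_affine _, contDiffAt_fst.prodMk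
        ((contDiffAt_snd.neg.add (contDiffAt_const.mul contDiffAt_fst)).add c1),
        .of_forall fun w u _ hw => ?_⟩
      rw [stdPar_zero_eq_iff] at hw ⊢
      rw [hw]
  match i with
  | 0 => exact aff z
  | 1 =>
    have c1 : ContDiff ℂ ω fun w : ℂ × ℂ => hFun k a w.1 := (contDiff_hFun k a).comp contDiff_fst
    refine ⟨stdPar 1, fun w => (w.1, c - w.2 + w.1 * hFun k a w.1),
      .inl (.plane 1 _ fun s hs hm => ?_), ContDiff.contDiffAt (contDiff_fst.prodMk
      ((contDiff_const.sub contDiff_snd).add (contDiff_fst.mul c1))), .of_forall fun w u _ hw => ?_⟩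
    · have hm : stdPar 1 (z.1, c - z.2 + z.1 * hFun k a z.1) = markPt c s := hm
      rcases Nat.eq_zero_or_pos s with rfl | h1
      · exact stdPar_one_ne_markPt_zero hm
      rw [stdPar_one_eq_markPt_iff h1, Prod.mk.injEq] at hm
      refine h (n - s) (by omega) ((stdPar_one_eq_markPt_iff (by omega)).2 (Prod.ext hm.1 ?_))
      obtain ⟨h2, h3⟩ := hm
      rw [h2, zero_mul, add_zero] at h3
      linear_combination -h3 - orbit_add_orbit_sub hc h1 hs
    · rw [stdPar_one_eq_iff] at hw ⊢
      obtain ⟨e1, e2⟩ := hw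
      have e3 : u.1⁻¹ = w.1 := (eq_inv_of_mul_eq_one_left e1).symm
      simp only [sigmaMap, e3]
      exact ⟨e1, by linear_combination -e2 + c * e1⟩
  | 2 =>
    by_cases hx : z.2 = 0
    · have ht : z.1 ≠ 0 := fun ht =>
        h 0 (by omega) (stdPar_two_eq_markPt_zero_iff.2 (Prod.ext ht hx))
      obtain ⟨ψ, G, hψ, cG, hG⟩ := aff (z.2 / z.1, 1 / z.1)
      have c1 : ContDiffAt ℂ ω (fun w : ℂ × ℂ => (w.2 / w.1, 1 / w.1)) z :=
        (contDiffAt_snd.div contDiffAt_fst ht).prodMk (contDiffAt_const.div contDiffAt_fst ht)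
      refine ⟨ψ, fun w => G (w.2 / w.1, 1 / w.1), hψ, ContDiffAt.comp z (g := G) cG c1, ?_⟩
      filter_upwards [c1.continuousAt.eventually hG, continuousAt_fst.eventually_ne ht]
        with w h1 h2 u hu hw
      refine h1 u hu ?_
      rw [stdPar_two_eq_iff] at hw
      rw [stdPar_zero_eq_iff]
      refine Prod.ext ?_ ?_
      · rw [← hw.1]; field_simp
      · rw [← hw.2]; field_simp
    · have c1 : ContDiffAt ℂ ω (fun w : ℂ × ℂ => hFun k a (w.1 / w.2)) z :=
        ContDiffAt.comp z (g := hFun k a) (contDiff_hFun k a).contDiffAt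
          (contDiffAt_fst.div contDiffAt_snd hx)
      refine ⟨stdPar 1, fun w => (w.1 / w.2, (-1 + c * w.2 + w.1 * hFun k a (w.1 / w.2)) / w.2),
        .inl (.plane 1 _ fun s hs hm => ?_), (contDiffAt_fst.div contDiffAt_snd hx).prodMk
        (((contDiffAt_const.add (contDiffAt_const.mul contDiffAt_snd)).add
          (contDiffAt_fst.mul c1)).div contDiffAt_snd hx), ?_⟩
      · have hm : stdPar 1 (z.1 / z.2, (-1 + c * z.2 + z.1 * hFun k a (z.1 / z.2)) / z.2) =
          markPt c s := hm
        rcases Nat.eq_zero_or_pos s with rfl | h1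
        · exact stdPar_one_ne_markPt_zero hm
        rw [stdPar_one_eq_markPt_iff h1, Prod.mk.injEq] at hm
        obtain ⟨h2, h3⟩ := hm
        have h2 : z.1 = 0 := by simpa [hx] using h2
        refine h (n - s) (by omega) ((stdPar_two_eq_markPt_iff (by omega)).2 ⟨h2, ?_⟩)
        rw [h2, zero_mul, add_zero, div_eq_iff hx] at h3
        linear_combination h3 + z.2 * orbit_add_orbit_sub hc h1 hs
      · filter_upwards [continuousAt_snd.eventually_ne hx] with w h2 u hu hw
        rw [stdPar_two_eq_iff] at hw
        rw [stdPar_one_eq_iff]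
        obtain ⟨e1, e2⟩ := hw
        have hu1 : u.1 ≠ 0 := hu
        have ht : w.1 ≠ 0 := left_ne_zero_of_mul (a := w.1) (b := u.2) (by rw [e2]; simp)
        have e3 : u.1⁻¹ = w.1 / w.2 := by rw [← e1]; field_simp
        simp only [sigmaMap, e3]
        refine ⟨?_, ?_⟩
        · field_simp
          exact e1
        · field_simp
          linear_combination -e2 + c * e1

/-- The second involution lifts. -/
theorem SurfaceModel.hasLift_sigma (hc : c ∈ admissible n) (hk : 2 ≤ k) (hk' : Even k)
    {φ : ℂ × ℂ → ℙ ℂ (Fin 3 → ℂ)} {z : ℂ × ℂ} (h : SurfaceModel k c a n φ z) :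
    HasLift k c a n (sigmaMap k c a) sigmaDom φ z := by
  have hn := two_le_of_admissible hc
  have last : ∀ s < n, ∀ d, HasLift k c a n (sigmaMap k c a) sigmaDom
      (fiberPar k c a (2 * k + 1) s) (d, 0) := by
    intro s hs d
    rcases Nat.eq_zero_or_pos s with rfl | h1
    · obtain ⟨G, hG⟩ := sigma_zero_last c a (k := k) (by omega) d
      exact ⟨_, G, surfaceModel_affine _, hG⟩
    · exact (towerStep_sigma a hc hk hk' h1 hs).hasLift_last hk (by omega) (by simp) d
  rcases h with h | ⟨s, hs, rfl, rfl⟩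
  · cases h with
    | plane i z h => exact hasLift_sigma_plane hc hk i z h
    | first s x hs hx =>
      rcases Nat.eq_zero_or_pos s with rfl | h1
      · obtain ⟨G, hG, hG0, -⟩ := sigma_zero_first (k := k) c a hx
        refine ⟨_, G, ?_, hG⟩
        rw [hG0]
        exact .inl (.first 0 x hs hx)
      · exact (towerStep_sigma a hc hk hk' h1 hs).hasLift_first (by omega) (by simp) hx
    | lineCorner s hs => exact hasLift_sigma_lineCorner hc hs
    | fiber s j d hs hj hjM hd =>
      rcases Nat.eq_or_lt_of_le hjM with rfl | hjM'
      · exact last s hs d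
      rcases Nat.eq_zero_or_pos s with rfl | h1
      · obtain ⟨G, hG, hG0, -⟩ := sigma_zero_fiber c a hk hj (by omega) hd
        refine ⟨_, G, ?_, hG⟩
        rw [hG0]
        exact .inl (.fiber 0 _ _ hs (by omega) (by omega) (div_ne_zero one_ne_zero hd))
      · exact (towerStep_sigma a hc hk hk' h1 hs).hasLift_fiber hk (by omega) (by simp) hj hjM hd
    | corner s j hs hj hjM =>
      rcases Nat.eq_zero_or_pos s with rfl | h1
      · obtain ⟨G, hG, hG0⟩ := sigma_zero_corner c a (k := k) hj (by omega)
        refine ⟨_, G, ?_, hG⟩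
        rw [hG0]
        exact .inl (.corner 0 _ hs (by omega) (by omega))
      · exact (towerStep_sigma a hc hk hk' h1 hs).hasLift_corner hk (by omega) (by simp) hj hjM
  · exact last s hs 0

end Lifts

section Existence

variable (k : ℕ) (a : ℕ → ℂ) {n : ℕ} {c : ℝ} (hc : c ∈ admissible n)

theorem exists_surfaceModel (hk : k ≠ 0) (p : XSurf k a hc) :
    ∃ φ z, SurfaceModel k c a n φ z ∧ RealizedAt k a hc (2 * k + 1) p φ z := by
  rcases exists_model k a hc hk (by omega) p with ⟨s, rfl⟩ | ⟨φ, z, h1, h2⟩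
  · exact ⟨_, _, .inr ⟨s, s.2, rfl, rfl⟩, realizedAt_pt k a hc hk (2 * k) s⟩
  · exact ⟨φ, z, .inl h1, h2⟩

theorem SurfaceModel.exists_realizedAt (hk : k ≠ 0) {φ : ℂ × ℂ → ℙ ℂ (Fin 3 → ℂ)} {z : ℂ × ℂ}
    (h : SurfaceModel k c a n φ z) : ∃ p, RealizedAt k a hc (2 * k + 1) p φ z := by
  rcases h with h | ⟨s, hs, rfl, rfl⟩
  · obtain ⟨p, -, hp⟩ := _root_.exists_realizedAt k a hc hk (by omega) h
    exact ⟨p, hp⟩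
  · exact ⟨_, realizedAt_pt k a hc hk (2 * k) ⟨s, hs⟩⟩

theorem affineDense_surface {Z : Set (ℂ × ℂ)} (hZ : {u : ℂ × ℂ | u.1 ≠ 0 ∧ u.2 ≠ 0} ⊆ Z) :
    AffineDense (X := (stage k a hc (2 * k + 1)).toComplexSurface) (toPlane k a hc (2 * k + 1)) Z :=
  (affineDense_stage k a hc (2 * k + 1)).mono hZ

/-- Lifts near all points glue to a global lift. -/
theorem exists_lift (hk : k ≠ 0) {τ : ℂ × ℂ → ℂ × ℂ} {Z : Set (ℂ × ℂ)}
    (hZ : {u : ℂ × ℂ | u.1 ≠ 0 ∧ u.2 ≠ 0} ⊆ Z)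
    (h : ∀ φ z, SurfaceModel k c a n φ z → HasLift k c a n τ Z φ z) :
    ∃ F : XSurf k a hc → XSurf k a hc, ContMDiff 𝓘(ℂ, ℂ × ℂ) 𝓘(ℂ, ℂ × ℂ) ω F ∧
      ∀ p, CoversAt (X := (stage k a hc (2 * k + 1)).toComplexSurface)
        (toPlane k a hc (2 * k + 1)) τ Z F p := by
  refine (affineDense_surface k a hc hZ).exists_extension fun p => ?_
  obtain ⟨φ, z, hφ, hp⟩ := exists_surfaceModel k a hc hk p
  obtain ⟨ψ, G, hψ, hG⟩ := h φ z hφ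
  obtain ⟨p', hp'⟩ := hψ.exists_realizedAt k a hc hk
  exact ⟨φ, z, ψ, G, p', hp, hp', hG⟩

/-- `R` and `S` are the holomorphic involutions of `𝒳` which lift the exchange of the coordinates
and `sigmaMap`. -/
structure IsLiftPair (R S : XSurf k a hc → XSurf k a hc) : Prop where
  contMDiff_swap : ContMDiff 𝓘(ℂ, ℂ × ℂ) 𝓘(ℂ, ℂ × ℂ) ω R
  contMDiff_sigma : ContMDiff 𝓘(ℂ, ℂ × ℂ) 𝓘(ℂ, ℂ × ℂ) ω S
  covers_swap : ∀ p, CoversAt (X := (stage k a hc (2 * k + 1)).toComplexSurface)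
    (toPlane k a hc (2 * k + 1)) Prod.swap univ R p
  covers_sigma : ∀ p, CoversAt (X := (stage k a hc (2 * k + 1)).toComplexSurface)
    (toPlane k a hc (2 * k + 1)) (sigmaMap k c a) sigmaDom S p

theorem eq_id_of_covers {F : XSurf k a hc → XSurf k a hc} (hF : Continuous F) {Z : Set (ℂ × ℂ)}
    (hZ : {u : ℂ × ℂ | u.1 ≠ 0 ∧ u.2 ≠ 0} ⊆ Z)
    (h : ∀ p, CoversAt (X := (stage k a hc (2 * k + 1)).toComplexSurface)
      (toPlane k a hc (2 * k + 1)) (fun u => u) Z F p) : F = id :=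
  (affineDense_surface k a hc hZ).eq_of_covers hF continuous_id h fun _ _ _ hu => hu

theorem exists_isLiftPair (hk : 2 ≤ k) (hk' : Even k) : ∃ R S, IsLiftPair k a hc R S := by
  obtain ⟨R, hR, hR'⟩ := exists_lift k a hc (by omega) (subset_univ _)
    fun φ z h => h.hasLift_swap hc hk hk'
  obtain ⟨S, hS, hS'⟩ := exists_lift k a hc (by omega) (Z := sigmaDom) (fun u hu => hu.1)
    fun φ z h => h.hasLift_sigma hc hk hk'
  exact ⟨R, S, hR, hS, hR', hS'⟩

variable {k a hc} {R S : XSurf k a hc → XSurf k a hc}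

namespace IsLiftPair

theorem swap_swap (h : IsLiftPair k a hc R S) (p : XSurf k a hc) : R (R p) = p := by
  refine congrFun (eq_id_of_covers k a hc (F := R ∘ R)
    (h.contMDiff_swap.continuous.comp h.contMDiff_swap.continuous) (subset_univ _) ?_) p
  intro p u hu hp
  exact h.covers_swap _ _ (mem_univ _) (h.covers_swap p u hu hp)

theorem sigma_sigma (h : IsLiftPair k a hc R S) (p : XSurf k a hc) : S (S p) = p := by
  refine congrFun (eq_id_of_covers k a hc (F := S ∘ S)
    (h.contMDiff_sigma.continuous.comp h.contMDiff_sigma.continuous) (Z := sigmaDom)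
    (fun u hu => hu.1) ?_) p
  intro p u hu hp
  have := h.covers_sigma _ _ (show sigmaMap k c a u ∈ sigmaDom from hu) (h.covers_sigma p u hu hp)
  rwa [sigmaMap_sigmaMap] at this

/-- The automorphism `S ∘ R`. -/
noncomputable def diffeo (h : IsLiftPair k a hc R S) :
    XSurf k a hc ≃ₘ^ω⟮𝓘(ℂ, ℂ × ℂ), 𝓘(ℂ, ℂ × ℂ)⟯ XSurf k a hc where
  toFun p := S (R p)
  invFun p := R (S p)
  left_inv p := by
    change R (S (S (R p))) = p
    rw [h.sigma_sigma, h.swap_swap]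
  right_inv p := by
    change S (R (R (S p))) = p
    rw [h.swap_swap, h.sigma_sigma]
  contMDiff_toFun := h.contMDiff_sigma.comp h.contMDiff_swap
  contMDiff_invFun := h.contMDiff_swap.comp h.contMDiff_sigma

theorem isInducedBy (h : IsLiftPair k a hc R S) : IsInducedBy k a hc (S ∘ R) := by
  intro p z hz hp
  rw [fMap_eq_sigmaMap]
  exact h.covers_sigma _ _ (show z.swap ∈ sigmaDom from hz) (h.covers_swap p z (mem_univ _) hp)

theorem eq_of_isInducedBy (h : IsLiftPair k a hc R S) {F : XSurf k a hc → XSurf k a hc}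
    (hF : Continuous F) (hF' : IsInducedBy k a hc F) : F = S ∘ R :=
  (affineDense_surface k a hc (Z := {u | u.2 ≠ 0}) fun _ hu => hu.2).eq_of_covers
    (τ := fMap k c a) hF (h.contMDiff_sigma.continuous.comp h.contMDiff_swap.continuous)
    (fun p u hu hp => hF' p u hu hp) (fun p u hu hp => h.isInducedBy p u hu hp)

end IsLiftPair

end Existence

/-! ### The derivative along the curves `F_s^j` -/

section Derivative

variable (k : ℕ) (a : ℕ → ℂ) {n : ℕ} {c : ℝ} (hc : c ∈ admissible n)

/-- `DerivBetween` for self-maps of `𝒳`. -/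
abbrev SurfaceDeriv (F : XSurf k a hc → XSurf k a hc) (φ : ℂ × ℂ → ℙ ℂ (Fin 3 → ℂ)) (z : ℂ × ℂ)
    (ψ : ℂ × ℂ → ℙ ℂ (Fin 3 → ℂ)) (z' : ℂ × ℂ) (A : ℂ × ℂ →L[ℂ] ℂ × ℂ) : Prop :=
  DerivBetween (X := (stage k a hc (2 * k + 1)).toComplexSurface) (toPlane k a hc (2 * k + 1))
    F φ z ψ z' A

variable {k a hc}

/-- The hypothesis that the intermediate point exists on `𝒳` is needed: otherwise the derivative at
it carries no information. -/
theorem SurfaceModel.deriv_comp (hk : k ≠ 0) {F F' : XSurf k a hc → XSurf k a hc}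
    {φ φ' φ'' : ℂ × ℂ → ℙ ℂ (Fin 3 → ℂ)} {z z' z'' : ℂ × ℂ} {s t s' t' : ℂ}
    (hp : SurfaceModel k c a n φ' z') (h' : SurfaceDeriv k a hc F' φ' z' φ'' z'' (diagMap s' t'))
    (h : SurfaceDeriv k a hc F φ z φ' z' (diagMap s t)) :
    SurfaceDeriv k a hc (F' ∘ F) φ z φ'' z'' (diagMap (s' * s) (t' * t)) := by
  obtain ⟨p, hp⟩ := hp.exists_realizedAt k a hc hk
  rw [← diagMap_comp]
  exact h'.comp h hp

theorem surfaceDeriv_id (φ : ℂ × ℂ → ℙ ℂ (Fin 3 → ℂ)) (z : ℂ × ℂ) :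
    SurfaceDeriv k a hc id φ z φ z (diagMap 1 1) := by
  rw [diagMap_one]
  exact (affineDense_surface k a hc subset_rfl).derivBetween (τ := fun u => u) continuous_id
    (fun _ _ _ hu => hu) (G := fun w => w) ⟨contDiffAt_id, .of_forall fun _ _ _ hw => hw⟩ rfl
    (hasFDerivAt_id z)

theorem surfaceDeriv_iterate (hk : k ≠ 0) {F : XSurf k a hc → XSurf k a hc}
    {φ : ℕ → ℂ × ℂ → ℙ ℂ (Fin 3 → ℂ)} {z : ℕ → ℂ × ℂ} {s t : ℕ → ℂ} (m : ℕ)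
    (hφ : ∀ i < m, SurfaceModel k c a n (φ i) (z i))
    (h : ∀ i < m, SurfaceDeriv k a hc F (φ i) (z i) (φ (i + 1)) (z (i + 1)) (diagMap (s i) (t i))) :
    SurfaceDeriv k a hc F^[m] (φ 0) (z 0) (φ m) (z m)
      (diagMap (∏ i ∈ Finset.range m, s i) (∏ i ∈ Finset.range m, t i)) := by
  induction m with
  | zero => simpa using surfaceDeriv_id (φ 0) (z 0)
  | succ m ih =>
    rw [Function.iterate_succ', Finset.prod_range_succ, Finset.prod_range_succ,
      mul_comm (∏ i ∈ _, s i), mul_comm (∏ i ∈ _, t i)]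
    exact (hφ m (Nat.lt_succ_self m)).deriv_comp hk (h m (Nat.lt_succ_self m))
      (ih (fun i hi => hφ i (hi.trans (Nat.lt_succ_self m)))
        fun i hi => h i (hi.trans (Nat.lt_succ_self m)))

namespace IsLiftPair

variable {R S : XSurf k a hc → XSurf k a hc}

theorem deriv_swap (h : IsLiftPair k a hc R S) {φ ψ : ℂ × ℂ → ℙ ℂ (Fin 3 → ℂ)} {z z' : ℂ × ℂ}
    {G : ℂ × ℂ → ℂ × ℂ} {A : ℂ × ℂ →L[ℂ] ℂ × ℂ} (hG : GermCovers Prod.swap univ φ z ψ G)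
    (hz : G z = z') (hA : HasFDerivAt G A z) : SurfaceDeriv k a hc R φ z ψ z' A :=
  (affineDense_surface k a hc (subset_univ _)).derivBetween h.contMDiff_swap.continuous
    h.covers_swap hG hz hA

theorem deriv_sigma (h : IsLiftPair k a hc R S) {φ ψ : ℂ × ℂ → ℙ ℂ (Fin 3 → ℂ)} {z z' : ℂ × ℂ}
    {G : ℂ × ℂ → ℂ × ℂ} {A : ℂ × ℂ →L[ℂ] ℂ × ℂ}
    (hG : GermCovers (sigmaMap k c a) sigmaDom φ z ψ G)
    (hz : G z = z') (hA : HasFDerivAt G A z) : SurfaceDeriv k a hc S φ z ψ z' A :=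
  (affineDense_surface k a hc (Z := sigmaDom) fun _ hu => hu.1).derivBetween
    h.contMDiff_sigma.continuous h.covers_sigma hG hz hA

/-- The exchange of the coordinates takes the curves over the `s`-th point to those over the
`(n - 1 - s)`-th one, with `x ↦ ε x + ⋯`, where `ε = 1` for `s = 0`, `n - 1`, and `ε = -1` otherwise;
the other involution takes those to the curves over the `(s + 1)`-th point, with `x ↦ -x + ⋯`. -/
theorem exists_steps (a : ℕ → ℂ) (hc : c ∈ admissible n) (hk : 2 ≤ k) (hk' : Even k) {s : ℕ}
    (hs : s + 1 < n) :
    ∃ s' < n, ∃ ε : ℂ, ε ≠ 0 ∧ -1 * ε = (if s = 0 then -1 else 1) ∧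
      TowerStep k c a Prod.swap univ s s' ε ∧
      TowerStep k c a (sigmaMap k c a) sigmaDom s' (s + 1) (-1) := by
  have hσ := towerStep_sigma a hc hk hk' (s := n - 1 - s) (by omega) (by omega)
  rw [show n - (n - 1 - s) = s + 1 by omega] at hσ
  refine ⟨n - 1 - s, by omega, ?_⟩
  by_cases h0 : s = 0
  · subst h0
    exact ⟨1, one_ne_zero, by simp, by simpa using towerStep_swap_zero a hc, hσ⟩
  · exact ⟨-1, by simp, by simp [h0], towerStep_swap_mid a hc hk hk' (by omega) hs, hσ⟩

theorem deriv_first (h : IsLiftPair k a hc R S) (hk : 2 ≤ k) (hk' : Even k) {s : ℕ}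
    (hs : s + 1 < n) {x : ℂ} (hx : x ≠ 0) :
    SurfaceDeriv k a hc (S ∘ R) (towerPar c s) (0, x) (towerPar c (s + 1))
      (0, (if s = 0 then -1 else 1) * x) (diagMap 1 (if s = 0 then -1 else 1)) := by
  obtain ⟨s', hs', ε, hε, he, ⟨Θ, -, h1⟩, ⟨Θ', -, h2⟩⟩ := exists_steps a hc hk hk' hs
  have d1 := h.deriv_swap (h1 x).1 (h1 x).2.1 (h1 x).2.2
  have d2 := h.deriv_sigma (h2 (ε * x)).1 (h2 (ε * x)).2.1 (h2 (ε * x)).2.2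
  have := SurfaceModel.deriv_comp (by omega) (.inl (.first s' _ hs' (mul_ne_zero hε hx))) d2 d1
  rwa [mul_one, ← mul_assoc, he] at this

theorem deriv_first_last (h : IsLiftPair k a hc R S) (hk : 2 ≤ k) {x : ℂ} (hx : x ≠ 0) :
    SurfaceDeriv k a hc (S ∘ R) (towerPar c (n - 1)) (0, x) (towerPar c 0) (0, x)
      (diagMap (-1) 1) := by
  have hn := two_le_of_admissible hc
  obtain ⟨Θ, -, h1⟩ := towerStep_swap_last (k := k) a hc
  obtain ⟨G, hG, hG0, hG'⟩ := sigma_zero_first (k := k) c a hx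
  have d1 := h.deriv_swap (h1 x).1 (h1 x).2.1 (h1 x).2.2
  rw [one_mul] at d1
  have := SurfaceModel.deriv_comp (by omega) (.inl (.first 0 _ (by omega) hx))
    (h.deriv_sigma hG hG0 hG') d1
  rwa [mul_one, mul_one] at this

theorem deriv_fiber (h : IsLiftPair k a hc R S) (hk : 2 ≤ k) (hk' : Even k) {s : ℕ}
    (hs : s + 1 < n) {j : ℕ} (hj : 3 ≤ j) (hj' : j ≤ 2 * k) {d : ℂ} (hd : d ≠ 0) :
    SurfaceDeriv k a hc (S ∘ R) (fiberPar k c a j s) (d, 0) (fiberPar k c a j (s + 1))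
      ((if s = 0 then -1 else 1) ^ (j - 1) * d, 0)
      (diagMap ((if s = 0 then -1 else 1) ^ (j - 1)) (if s = 0 then -1 else 1)) := by
  obtain ⟨s', hs', ε, hε, he, h1, h2⟩ := exists_steps a hc hk hk' hs
  have hm : (-1 : ℂ) ≠ 0 := by simp
  obtain ⟨G, hG, hG0, hG'⟩ := h1.fiber_lift (by omega) hε (show 2 ≤ j by omega)
    (by omega) d
  obtain ⟨G', hG1, hG1', hG2⟩ := h2.fiber_lift (by omega) hm (show 2 ≤ j by omega)
    (by omega) (d / ε ^ (j - 1))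
  have := SurfaceModel.deriv_comp (by omega)
    (.inl (.fiber s' j _ hs' (by omega) (by omega) (div_ne_zero hd (pow_ne_zero _ hε))))
    (h.deriv_sigma hG1 hG1' (hG2 hj hj')) (h.deriv_swap hG hG0 (hG' hj hj'))
  have e : ∀ i : ℕ, (if s = 0 then (-1 : ℂ) else 1) ^ i = 1 / (-1) ^ i * (1 / ε ^ i) := by
    intro i
    rw [div_mul_div_comm, one_mul, ← mul_pow, he]
    split_ifs
    · rcases neg_one_pow_eq_or ℂ i with h | h <;> simp [h]
    · simp
  rw [← e, he, show d / ε ^ (j - 1) / (-1) ^ (j - 1) =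
    1 / (-1) ^ (j - 1) * (1 / ε ^ (j - 1)) * d by ring, ← e] at this
  exact this

theorem deriv_fiber_last (h : IsLiftPair k a hc R S) (hk : 2 ≤ k) {j : ℕ} (hj : 3 ≤ j)
    (hj' : j ≤ 2 * k) {d : ℂ} (hd : d ≠ 0) :
    SurfaceDeriv k a hc (S ∘ R) (fiberPar k c a j (n - 1)) (d, 0)
      (fiberPar k c a (2 * k + 2 - j) 0) (1 / d, 0) (diagMap (-1 / d ^ 2) 1) := by
  have hn := two_le_of_admissible hc
  obtain ⟨G, hG, hG0, hG'⟩ := (towerStep_swap_last (k := k) a hc).fiber_lift (by omega)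
    one_ne_zero (show 2 ≤ j by omega) (by omega) d
  obtain ⟨G', hG1, hG1', hG2⟩ := sigma_zero_fiber c a hk (show 2 ≤ j by omega) hj' hd
  have hG' := hG' hj hj'
  rw [one_pow, div_one] at hG0 hG'
  have := SurfaceModel.deriv_comp (by omega)
    (.inl (.fiber 0 j _ (by omega) (by omega) (by omega) hd))
    (h.deriv_sigma hG1 hG1' hG2) (h.deriv_swap hG hG0 hG')
  rwa [mul_one, mul_one] at this

end IsLiftPair

/-- A chain of curves over the points `f^s e_2`, `0 ≤ s < n`, along which the first step of `F` is
`(e, e')` in suitable coordinates and the next ones are the identity, and a last step back to the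
curves over `e_2`. -/
theorem surfaceDeriv_chain (hk : k ≠ 0) {F : XSurf k a hc → XSurf k a hc}
    {φ : ℕ → ℂ × ℂ → ℙ ℂ (Fin 3 → ℂ)} {z z' : ℂ × ℂ} {e e' : ℂ}
    (hφ : ∀ s, 1 ≤ s → s < n → SurfaceModel k c a n (φ s) z')
    (h0 : SurfaceDeriv k a hc F (φ 0) z (φ 1) z' (diagMap e e'))
    (h1 : ∀ s, 1 ≤ s → s + 1 < n → SurfaceDeriv k a hc F (φ s) z' (φ (s + 1)) z' (diagMap 1 1))
    {s : ℕ} (hs : 1 ≤ s) (hsn : s < n) :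
    SurfaceDeriv k a hc F^[s] (φ 0) z (φ s) z' (diagMap e e') := by
  induction s, hs using Nat.le_induction with
  | base => exact h0
  | succ s hs ih =>
    rw [Function.iterate_succ']
    have := (hφ s hs (by omega)).deriv_comp hk (h1 s hs hsn) (ih (by omega))
    rwa [one_mul, one_mul] at this

theorem tangentToId_of_deriv {F : XSurf k a hc → XSurf k a hc} {φ : ℂ × ℂ → ℙ ℂ (Fin 3 → ℂ)}
    {z : ℂ × ℂ} (h : SurfaceDeriv k a hc F φ z φ z (diagMap 1 1)) {p : XSurf k a hc}
    (hp : RealizedAt k a hc (2 * k + 1) p φ z) :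
    (stage k a hc (2 * k + 1)).TangentToId F p := by
  rw [diagMap_one] at h
  exact h.tangentToId hp

namespace IsLiftPair

variable {R S : XSurf k a hc → XSurf k a hc}

/-- The points of the orbit of `p` are like `p`. -/
theorem tangentToId_iterate (h : IsLiftPair k a hc R S) {p : XSurf k a hc} {m : ℕ}
    (hp : (stage k a hc (2 * k + 1)).TangentToId (S ∘ R)^[m] p) (i : ℕ) :
    (stage k a hc (2 * k + 1)).TangentToId (S ∘ R)^[m] ((S ∘ R)^[i] p) := by
  have c1 : ∀ i, ContMDiff 𝓘(ℂ, ℂ × ℂ) 𝓘(ℂ, ℂ × ℂ) ω (S ∘ R)^[i] :=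
    fun i => (h.contMDiff_sigma.comp h.contMDiff_swap).iterate i
  have c2 : ∀ i, ContMDiff 𝓘(ℂ, ℂ × ℂ) 𝓘(ℂ, ℂ × ℂ) ω (R ∘ S)^[i] :=
    fun i => (h.contMDiff_swap.comp h.contMDiff_sigma).iterate i
  have l1 : Function.LeftInverse (R ∘ S) (S ∘ R) := h.diffeo.left_inv
  have l2 : Function.LeftInverse (S ∘ R) (R ∘ S) := h.diffeo.right_inv
  exact hp.conj (c1 i) (c2 i) (l1.iterate i) (l2.iterate i)
    fun x => (Function.Commute.iterate_iterate_self (S ∘ R) m i).eq x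

/-- The orbit of a point of `F_0^1` under `f^s`, `s ≤ n`, with the derivatives. -/
theorem deriv_first_period (h : IsLiftPair k a hc R S) (hk : 2 ≤ k) (hk' : Even k) {x : ℂ}
    (hx : x ≠ 0) : (∀ s, 1 ≤ s → s < n → SurfaceDeriv k a hc (S ∘ R)^[s] (towerPar c 0) (0, x)
      (towerPar c s) (0, -1 * x) (diagMap 1 (-1))) ∧
    SurfaceDeriv k a hc (S ∘ R)^[n] (towerPar c 0) (0, x) (towerPar c 0) (0, -1 * x)
      (diagMap (-1) (-1)) := by
  have hn := two_le_of_admissible hc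
  have hx' : -1 * x ≠ 0 := mul_ne_zero (by simp) hx
  have hφ : ∀ s, 1 ≤ s → s < n → SurfaceModel k c a n (towerPar c s) (0, -1 * x) :=
    fun s _ hs => .inl (.first s _ hs hx')
  have key : ∀ s, 1 ≤ s → s < n → SurfaceDeriv k a hc (S ∘ R)^[s] (towerPar c 0) (0, x)
      (towerPar c s) (0, -1 * x) (diagMap 1 (-1)) := by
    intro s hs hsn
    refine surfaceDeriv_chain (by omega) hφ ?_ ?_ hs hsn
    · simpa using h.deriv_first hk hk' (s := 0) (by omega) hx
    · intro s hs hsn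
      simpa [show s ≠ 0 by omega] using h.deriv_first hk hk' hsn hx'
  refine ⟨key, ?_⟩
  have := (hφ (n - 1) (by omega) (by omega)).deriv_comp (by omega) (h.deriv_first_last hk hx')
    (key (n - 1) (by omega) (by omega))
  rwa [← Function.iterate_succ', Nat.succ_eq_add_one, Nat.sub_add_cancel (by omega), mul_one,
    one_mul] at this

/-- The orbit of a point of `F_0^j` under `f^s`, `s ≤ n`, with the derivatives; `f^n` takes it to
`F_0^(2k+2-j)`. -/
theorem deriv_fiber_period (h : IsLiftPair k a hc R S) (hk : 2 ≤ k) (hk' : Even k) {j : ℕ}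
    (hj : 3 ≤ j) (hj' : j ≤ 2 * k) {d : ℂ} (hd : d ≠ 0) :
    (∀ s, 1 ≤ s → s < n → SurfaceDeriv k a hc (S ∘ R)^[s] (fiberPar k c a j 0) (d, 0)
      (fiberPar k c a j s) ((-1) ^ (j - 1) * d, 0) (diagMap ((-1) ^ (j - 1)) (-1))) ∧
    SurfaceDeriv k a hc (S ∘ R)^[n] (fiberPar k c a j 0) (d, 0)
      (fiberPar k c a (2 * k + 2 - j) 0) (1 / ((-1) ^ (j - 1) * d), 0)
      (diagMap (-1 / ((-1) ^ (j - 1) * d) ^ 2 * (-1) ^ (j - 1)) (-1)) := by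
  have hn := two_le_of_admissible hc
  have hd' : (-1) ^ (j - 1) * d ≠ 0 := mul_ne_zero (pow_ne_zero _ (by simp)) hd
  have hφ : ∀ s, 1 ≤ s → s < n →
      SurfaceModel k c a n (fiberPar k c a j s) ((-1) ^ (j - 1) * d, 0) :=
    fun s _ hs => .inl (.fiber s j _ hs (by omega) (by omega) hd')
  have key : ∀ s, 1 ≤ s → s < n → SurfaceDeriv k a hc (S ∘ R)^[s] (fiberPar k c a j 0) (d, 0)
      (fiberPar k c a j s) ((-1) ^ (j - 1) * d, 0) (diagMap ((-1) ^ (j - 1)) (-1)) := by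
    intro s hs hsn
    refine surfaceDeriv_chain (by omega) hφ ?_ ?_ hs hsn
    · simpa using h.deriv_fiber hk hk' (s := 0) (by omega) hj hj' hd
    · intro s hs hsn
      simpa [show s ≠ 0 by omega] using h.deriv_fiber hk hk' hsn hj hj' hd'
  refine ⟨key, ?_⟩
  have := (hφ (n - 1) (by omega) (by omega)).deriv_comp (by omega)
    (h.deriv_fiber_last hk hj hj' hd') (key (n - 1) (by omega) (by omega))
  rwa [← Function.iterate_succ', Nat.succ_eq_add_one, Nat.sub_add_cancel (by omega),
    one_mul] at this

theorem tangentToId_first (h : IsLiftPair k a hc R S) (hk : 2 ≤ k) (hk' : Even k) {s : ℕ}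
    (hs : s < n) {x : ℂ} (hx : x ≠ 0) {p : XSurf k a hc}
    (hp : RealizedAt k a hc (2 * k + 1) p (towerPar c s) (0, x)) :
    (stage k a hc (2 * k + 1)).TangentToId (S ∘ R)^[2 * n] p := by
  have key : ∀ {x : ℂ} (_ : x ≠ 0) {p : XSurf k a hc}
      (_ : RealizedAt k a hc (2 * k + 1) p (towerPar c 0) (0, x)),
      (stage k a hc (2 * k + 1)).TangentToId (S ∘ R)^[2 * n] p := by
    intro x hx p hp
    have hx' : -1 * x ≠ 0 := mul_ne_zero (by simp) hx
    have := SurfaceModel.deriv_comp (by omega) (.inl (.first 0 _ (by omega) hx'))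
      (h.deriv_first_period hk hk' hx').2 (h.deriv_first_period hk hk' hx).2
    rw [← Function.iterate_add, ← two_mul] at this
    refine tangentToId_of_deriv ?_ hp
    simpa using this
  rcases Nat.eq_zero_or_pos s with rfl | h1
  · exact key hx hp
  · have hx' : -1 * x ≠ 0 := mul_ne_zero (by simp) hx
    have hm : SurfaceModel k c a n (towerPar c 0) (0, -1 * x) := .inl (.first 0 _ (by omega) hx')
    obtain ⟨q, hq⟩ := hm.exists_realizedAt k a hc (by omega)
    have h2 := (h.deriv_first_period hk hk' hx').1 s h1 hs
    rw [show -1 * (-1 * x) = x by ring] at h2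
    rw [← h2.apply_eq hq hp]
    exact h.tangentToId_iterate (key hx' hq) s

/-- The derivatives of the two passages, from `F_0^j` to `F_0^(2k+2-j)` and back, are inverse to each
other, as `d ↦ e / d` is an involution for `e = (-1)^(j-1)`. -/
theorem tangentToId_fiber (h : IsLiftPair k a hc R S) (hk : 2 ≤ k) (hk' : Even k) {s : ℕ}
    (hs : s < n) {j : ℕ} (hj : 3 ≤ j) (hj' : j ≤ 2 * k - 1) {d : ℂ} (hd : d ≠ 0) {p : XSurf k a hc}
    (hp : RealizedAt k a hc (2 * k + 1) p (fiberPar k c a j s) (d, 0)) :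
    (stage k a hc (2 * k + 1)).TangentToId (S ∘ R)^[2 * n] p := by
  obtain ⟨e, he, he2, heJ⟩ : ∃ e : ℂ, (-1) ^ (j - 1) = e ∧ e * e = 1 ∧
      (-1) ^ (2 * k + 2 - j - 1) = e := by
    refine ⟨_, rfl, ?_, ?_⟩
    · rw [← pow_add, ← two_mul, pow_mul]
      simp
    · obtain ⟨i, rfl⟩ : ∃ i, j = i + 1 := ⟨j - 1, by omega⟩
      obtain ⟨l, hl⟩ : ∃ l, 2 * k = i + l := ⟨2 * k - i, by omega⟩
      have h1 : (-1 : ℂ) ^ i * (-1) ^ l = 1 := by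
        rw [← pow_add, ← hl, pow_mul]
        simp
      have h2 : (-1 : ℂ) ^ i * (-1) ^ i = 1 := by
        rw [← pow_add, ← two_mul, pow_mul]
        simp
      rw [show 2 * k + 2 - (i + 1) - 1 = l by omega, Nat.add_sub_cancel]
      exact mul_left_cancel₀ (pow_ne_zero i (by simp)) (h1.trans h2.symm)
  have he0 : e ≠ 0 := left_ne_zero_of_mul (he2.trans_ne one_ne_zero)
  have key : ∀ {d : ℂ} (_ : d ≠ 0) {p : XSurf k a hc}
      (_ : RealizedAt k a hc (2 * k + 1) p (fiberPar k c a j 0) (d, 0)),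
      (stage k a hc (2 * k + 1)).TangentToId (S ∘ R)^[2 * n] p := by
    intro d hd p hp
    have hd' : 1 / (e * d) ≠ 0 := div_ne_zero one_ne_zero (mul_ne_zero he0 hd)
    have h1 := (h.deriv_fiber_period hk hk' hj (by omega) hd).2
    have h2 := (h.deriv_fiber_period hk hk' (j := 2 * k + 2 - j) (by omega) (by omega) hd').2
    rw [he] at h1
    rw [heJ, show 2 * k + 2 - (2 * k + 2 - j) = j by omega] at h2
    have := SurfaceModel.deriv_comp (by omega)
      (.inl (.fiber 0 _ _ (by omega) (by omega) (by omega) hd')) h2 h1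
    rw [← Function.iterate_add, ← two_mul] at this
    refine tangentToId_of_deriv ?_ hp
    have e1 : 1 / (e * (1 / (e * d))) = d := by field_simp
    have e2 : -1 / (e * (1 / (e * d))) ^ 2 * e * (-1 / (e * d) ^ 2 * e) = 1 := by
      field_simp
    rwa [e1, e2, show (-1 : ℂ) * -1 = 1 by norm_num] at this
  rcases Nat.eq_zero_or_pos s with rfl | h1
  · exact key hd hp
  · have hd' : e * d ≠ 0 := mul_ne_zero he0 hd
    have hm : SurfaceModel k c a n (fiberPar k c a j 0) (e * d, 0) :=
      .inl (.fiber 0 j _ (by omega) (by omega) (by omega) hd')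
    obtain ⟨q, hq⟩ := hm.exists_realizedAt k a hc (by omega)
    have h2 := (h.deriv_fiber_period hk hk' hj (by omega) hd').1 s h1 hs
    rw [he, ← mul_assoc, he2, one_mul] at h2
    rw [← h2.apply_eq hq hp]
    exact h.tangentToId_iterate (key hd' hq) s

end IsLiftPair

end Derivative

/-! ### The derivative along the line at infinity -/

section LineAtInfinity

/-- The action of `f` on the line at infinity. -/
noncomputable def lineMap (c : ℝ) (y : ℂ) : ℂ := c - 1 / y

/-- At the value `0`, where `1 / 0 = 0`, the junk value does no harm to injectivity. -/
theorem lineMap_injective (c : ℝ) : Function.Injective (lineMap c) := by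
  intro y y' h
  simpa [lineMap] using h

/-- The points of the line at infinity whose orbits never meet `[0 : 1 : 0]`. -/
def regularLine (c : ℝ) : Set ℂ := {y | ∀ i, (lineMap c)^[i] y ≠ 0}

theorem countable_compl_regularLine (c : ℝ) : (regularLine c)ᶜ.Countable := by
  have : (regularLine c)ᶜ = ⋃ i, {y | (lineMap c)^[i] y = 0} := by
    ext y
    simp [regularLine]
  rw [this]
  refine countable_iUnion fun i => Set.Subsingleton.countable fun y hy y' hy' => ?_
  exact (lineMap_injective c).iterate i (hy.trans hy'.symm)

theorem iterate_mem_regularLine {c : ℝ} {y : ℂ} (hy : y ∈ regularLine c) (i : ℕ) :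
    (lineMap c)^[i] y ∈ regularLine c := by
  intro m
  rw [← Function.iterate_add_apply]
  exact hy _

variable {n : ℕ} {c : ℝ}

theorem iterate_orbit (s i : ℕ) (hs : 1 ≤ s) :
    (lineMap c)^[i] (orbit (c : ℂ) s) = orbit (c : ℂ) (s + i) := by
  induction i with
  | zero => rfl
  | succ i ih => rw [Function.iterate_succ_apply', ih, ← add_assoc, orbit_succ (by omega), lineMap]

theorem ne_orbit_of_mem_regularLine (hc : c ∈ admissible n) {y : ℂ} (hy : y ∈ regularLine c)
    {s : ℕ} (h1 : 1 ≤ s) (h2 : s < n) : y ≠ orbit (c : ℂ) s := by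
  rintro rfl
  refine hy (n - 1 - s) ?_
  rw [iterate_orbit s _ h1, show s + (n - 1 - s) = n - 1 by omega, orbit_last hc]

theorem stdPar_one_ne_markPt (hc : c ∈ admissible n) {y : ℂ} (hy : y ∈ regularLine c)
    {s : ℕ} (hs : s < n) : stdPar 1 (0, y) ≠ markPt c s := by
  intro h
  rcases Nat.eq_zero_or_pos s with rfl | h1
  · exact stdPar_one_ne_markPt_zero h
  · rw [stdPar_one_eq_markPt_iff h1] at h
    exact ne_orbit_of_mem_regularLine hc hy h1 hs (congrArg Prod.snd h)

theorem stdPar_two_ne_markPt (hc : c ∈ admissible n) {y : ℂ} (hy : y ∈ regularLine c)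
    {s : ℕ} (hs : s < n) : stdPar 2 (0, y) ≠ markPt c s := by
  intro h
  rcases Nat.eq_zero_or_pos s with rfl | h1
  · rw [stdPar_two_eq_markPt_zero_iff] at h
    exact hy 0 (congrArg Prod.snd h)
  · rw [stdPar_two_eq_markPt_iff h1] at h
    have h2 : s + 1 < n := by
      by_contra h2
      obtain rfl : s = n - 1 := by omega
      rw [orbit_last hc, mul_zero] at h
      exact zero_ne_one h.2
    refine ne_orbit_of_mem_regularLine hc hy (s := n - 1 - s) (by omega) (by omega) ?_
    refine mul_right_cancel₀ (orbit_ne_zero hc h1 h2) (h.2.trans ?_)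
    rw [mul_comm, orbit_mul_orbit_rev hc h1 h2]

/-- With `c = 2 cos θ` the orbits of `lineMap` are quotients `u_{i+1} / u_i` of solutions of the
linear recurrence `u_{i+1} = c u_i - u_{i-1}`, which have period `2n`. -/
theorem lineMap_period (hc : c ∈ admissible n) {y : ℂ} (hy : y ∈ regularLine c) :
    (lineMap c)^[2 * n] y = y ∧ ∏ i ∈ Finset.range (2 * n), (lineMap c)^[i] y = 1 := by
  obtain ⟨θ, hcθ, h0, h1, hs, -, -⟩ := exists_angle hc
  have hn := two_le_of_admissible hc
  have hsin : (Real.sin θ : ℂ) ≠ 0 := by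
    have := hs 1 le_rfl (by omega)
    rw [Nat.cast_one, one_mul] at this
    exact_mod_cast this
  set u : ℕ → ℂ := fun m => y * (Real.sin (m * θ) : ℝ) - (Real.sin (m * θ - θ) : ℝ) with hu
  have u0 : u 0 = Real.sin θ := by simp [hu]
  have u1 : u 1 = y * Real.sin θ := by simp [hu]
  have hrec : ∀ m, u (m + 2) = c * u (m + 1) - u m := by
    intro m
    have e1 : Real.sin (((m + 2 : ℕ) : ℝ) * θ) =
        c * Real.sin (((m + 1 : ℕ) : ℝ) * θ) - Real.sin (m * θ) := by
      rw [hcθ, show ((m + 2 : ℕ) : ℝ) * θ = ((m + 1 : ℕ) : ℝ) * θ + θ by push_cast; ring,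
        show (m : ℝ) * θ = ((m + 1 : ℕ) : ℝ) * θ - θ by push_cast; ring, Real.sin_add,
        Real.sin_sub]
      ring
    have e2 : Real.sin (((m + 2 : ℕ) : ℝ) * θ - θ) =
        c * Real.sin (((m + 1 : ℕ) : ℝ) * θ - θ) - Real.sin (m * θ - θ) := by
      rw [hcθ, show ((m + 2 : ℕ) : ℝ) * θ - θ = m * θ + θ by push_cast; ring,
        show ((m + 1 : ℕ) : ℝ) * θ - θ = m * θ by push_cast; ring, Real.sin_add, Real.sin_sub]
      ring
    simp only [hu]
    rw [e1, e2]
    push_cast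
    ring
  have key : ∀ m, u m ≠ 0 ∧ (lineMap c)^[m] y = u (m + 1) / u m := by
    intro m
    induction m with
    | zero =>
      rw [u0]
      refine ⟨hsin, ?_⟩
      rw [u1, mul_div_cancel_right₀ _ hsin]
      rfl
    | succ m ih =>
      obtain ⟨i1, i2⟩ := ih
      have i3 : u (m + 1) ≠ 0 := fun h => hy m (by rw [i2, h, zero_div])
      refine ⟨i3, ?_⟩
      rw [Function.iterate_succ_apply', i2, lineMap, hrec]
      field_simp
  have hprod : ∀ m, ∏ i ∈ Finset.range m, (lineMap c)^[i] y = u m / u 0 := by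
    intro m
    induction m with
    | zero => simp [(key 0).1]
    | succ m ih =>
      have h2 := (key m).1
      have h3 := (key 0).1
      rw [Finset.prod_range_succ, ih, (key m).2]
      field_simp
  have s2 : Real.sin (((2 * n : ℕ) : ℝ) * θ) = 0 := by
    rw [show ((2 * n : ℕ) : ℝ) * θ = 2 * (n * θ) by push_cast; ring, Real.sin_two_mul, h0]
    ring
  have c2 : Real.cos (((2 * n : ℕ) : ℝ) * θ) = 1 := by
    rw [show ((2 * n : ℕ) : ℝ) * θ = 2 * (n * θ) by push_cast; ring, Real.cos_two_mul, h1]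
    ring
  have e1 : u (2 * n) = u 0 := by
    rw [u0]
    simp only [hu]
    rw [Real.sin_sub, s2, c2]
    simp
  have e2 : u (2 * n + 1) = u 1 := by
    rw [u1]
    simp only [hu]
    rw [show ((2 * n + 1 : ℕ) : ℝ) * θ = ((2 * n : ℕ) : ℝ) * θ + θ by push_cast; ring,
      Real.sin_add, add_sub_cancel_right, s2, c2]
    simp
  refine ⟨?_, ?_⟩
  · rw [(key _).2, e1, e2]
    exact (key 0).2.symm
  · rw [hprod, e1, div_self (key 0).1]

variable {k : ℕ} {a : ℕ → ℂ} {hc : c ∈ admissible n} {R S : XSurf k a hc → XSurf k a hc}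

/-- The coefficient of `dt` in the second component vanishes as `h(0) = 0`. -/
theorem sigma_line (hk : 2 ≤ k) {y : ℂ} (hy : y ≠ 0) :
    ∃ G, GermCovers (sigmaMap k c a) sigmaDom (stdPar 2) (0, y) (stdPar 1) G ∧
      G (0, y) = (0, lineMap c y) ∧ HasFDerivAt G (diagMap (y⁻¹) (y⁻¹ * y⁻¹)) (0, y) := by
  have c0 : ContDiffAt ℂ ω (fun w : ℂ × ℂ => w.2⁻¹) (0, y) := contDiffAt_snd.inv hy
  have c1 : ContDiffAt ℂ ω (fun w : ℂ × ℂ => hFun k a (w.1 * w.2⁻¹)) (0, y) :=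
    ContDiffAt.comp (0, y) (g := hFun k a) (contDiff_hFun k a).contDiffAt (contDiffAt_fst.mul c0)
  have c2 : ContDiffAt ℂ ω (fun w : ℂ × ℂ => w.2⁻¹ * hFun k a (w.1 * w.2⁻¹)) (0, y) := c0.mul c1
  have h0 : hFun k a 0 = 0 := by
    obtain ⟨h₂, -, hh⟩ := exists_hFun_eq k a hk
    rw [hh]
    simp
  refine ⟨fun w => (w.1 * w.2⁻¹, c - w.2⁻¹ + w.1 * (w.2⁻¹ * hFun k a (w.1 * w.2⁻¹))),
    ⟨(contDiffAt_fst.mul c0).prodMk ((contDiffAt_const.sub c0).add (contDiffAt_fst.mul c2)), ?_⟩,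
    by simp [lineMap], hasFDerivAt_diag (hasFDerivAt_fst_mul c0 rfl) ?_⟩
  · filter_upwards [continuousAt_snd.eventually_ne (x := ((0 : ℂ), y)) hy] with w h2 u hu hw
    rw [stdPar_two_eq_iff] at hw
    rw [stdPar_one_eq_iff]
    obtain ⟨e1, e2⟩ := hw
    have hu1 : u.1 ≠ 0 := hu
    have ht : w.1 ≠ 0 := left_ne_zero_of_mul (a := w.1) (b := u.2) (by rw [e2]; simp)
    have e3 : u.1⁻¹ = w.1 * w.2⁻¹ := by rw [← e1]; field_simp
    simp only [sigmaMap, e3]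
    refine ⟨?_, ?_⟩
    · field_simp
      exact e1
    · generalize hFun k a (w.1 * w.2⁻¹) = H
      field_simp
      linear_combination -e2 + c * e1
  · have h2 : HasFDerivAt (fun w : ℂ × ℂ => w.2) (ContinuousLinearMap.snd ℂ ℂ ℂ) ((0 : ℂ), y) :=
      hasFDerivAt_snd
    have h3 := HasDerivAt.comp_hasFDerivAt ((0 : ℂ), y) (h₂ := fun x => x⁻¹) (hasDerivAt_inv hy) h2
    have h4 := ((hasFDerivAt_const (c : ℂ) ((0 : ℂ), y)).fun_sub h3).fun_add
      (hasFDerivAt_fst_mul c2 rfl)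
    refine HasFDerivAt.congr_fderiv h4 ?_
    ext
    · simp [h0]
    · simp
      ring

theorem IsLiftPair.deriv_line (h : IsLiftPair k a hc R S) (hk : 2 ≤ k) {y : ℂ}
    (hy : y ∈ regularLine c) :
    SurfaceDeriv k a hc (S ∘ R) (stdPar 1) (0, y) (stdPar 1) (0, lineMap c y)
      (diagMap (y⁻¹) (y⁻¹ * y⁻¹)) := by
  have d1 : SurfaceDeriv k a hc R (stdPar 1) (0, y) (stdPar 2) (0, y) (diagMap 1 1) := by
    rw [diagMap_one]
    refine h.deriv_swap (G := fun w => w) ⟨contDiffAt_id, .of_forall fun w u _ hw => ?_⟩ rfl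
      (hasFDerivAt_id _)
    rw [stdPar_one_eq_iff] at hw
    rw [stdPar_two_eq_iff]
    exact hw.symm
  obtain ⟨G, hG, hG0, hG'⟩ := sigma_line (c := c) (a := a) hk (hy 0)
  have := SurfaceModel.deriv_comp (by omega)
    (.inl (.plane 2 (0, y) fun s hs hm => stdPar_two_ne_markPt hc hy hs hm.symm.symm))
    (h.deriv_sigma hG hG0 hG') d1
  rwa [mul_one, mul_one] at this

theorem IsLiftPair.tangentToId_line (h : IsLiftPair k a hc R S) (hk : 2 ≤ k) {y : ℂ}
    (hy : y ∈ regularLine c) {p : XSurf k a hc}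
    (hp : RealizedAt k a hc (2 * k + 1) p (stdPar 1) (0, y)) :
    (stage k a hc (2 * k + 1)).TangentToId (S ∘ R)^[2 * n] p := by
  obtain ⟨e1, e2⟩ := lineMap_period hc hy
  have := surfaceDeriv_iterate (F := S ∘ R) (φ := fun _ => stdPar 1)
    (z := fun i => (0, (lineMap c)^[i] y)) (by omega) (2 * n)
    (fun i _ => .inl (.plane 1 _ fun s hs hm =>
      stdPar_one_ne_markPt hc (iterate_mem_regularLine hy i) hs hm))
    (fun i _ => by
      rw [Function.iterate_succ_apply']
      exact h.deriv_line hk (iterate_mem_regularLine hy i))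
  rw [Finset.prod_mul_distrib, Finset.prod_inv_distrib, e2, inv_one, mul_one, e1] at this
  exact tangentToId_of_deriv this hp

end LineAtInfinity

/-! ### Conclusion -/

section Conclusion

variable {n k : ℕ} {c : ℝ} {a : ℕ → ℂ} {hc : c ∈ admissible n}
  {R S : XSurf k a hc → XSurf k a hc}

/-- The points of `𝒫` at which the derivative was computed are dense in `𝒫`. -/
theorem IsLiftPair.tangentToId (h : IsLiftPair k a hc R S) (hk : 2 ≤ k) (hk' : Even k)
    {p : XSurf k a hc} (hp : p ∈ parabolicSet k a hc) :
    (stage k a hc (2 * k + 1)).TangentToId (S ∘ R)^[2 * n] p := by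
  have cF : ContMDiff 𝓘(ℂ, ℂ × ℂ) 𝓘(ℂ, ℂ × ℂ) ω (S ∘ R)^[2 * n] :=
    (h.contMDiff_sigma.comp h.contMDiff_swap).iterate _
  rcases hp with hp | ⟨s, j, rfl | ⟨h3, h4⟩, hp⟩
  · refine TangentToId.of_mem_closure cF ?_ (lineAtInfinity_subset_closure k a hc
      (countable_compl_regularLine c) (fun y hy s hs => stdPar_one_ne_markPt hc hy hs) _ hp)
    rintro q ⟨-, ⟨t, y⟩, ⟨rfl, hy⟩, hq⟩
    exact h.tangentToId_line hk hy hq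
  · refine TangentToId.of_mem_closure cF ?_
      (first_subset_closure k a hc (by omega) s (by omega) hp)
    rintro q ⟨-, ⟨t, x⟩, ⟨rfl, hx⟩, hq⟩
    exact h.tangentToId_first hk hk' s.2 hx hq
  · refine TangentToId.of_mem_closure cF ?_
      (fiber_subset_closure k a hc (by omega) (by omega) s (by omega) hp)
    rintro q ⟨-, ⟨d, x⟩, ⟨hd, rfl⟩, hq⟩
    exact h.tangentToId_fiber hk hk' s.2 h3 h4 hd hq

end Conclusion

theorem theorem8p1 (n k : ℕ) (hk : 2 ≤ k) (hk_even : Even k) (a : ℕ → ℂ) (c : ℝ)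
    (hc : c ∈ admissible n) :
    (∃ F : XSurf k a hc ≃ₘ^ω⟮𝓘(ℂ, ℂ × ℂ), 𝓘(ℂ, ℂ × ℂ)⟯ XSurf k a hc, IsInducedBy k a hc F) ∧
    ∀ F : XSurf k a hc ≃ₘ^ω⟮𝓘(ℂ, ℂ × ℂ), 𝓘(ℂ, ℂ × ℂ)⟯ XSurf k a hc, IsInducedBy k a hc F →
      ∀ p ∈ parabolicSet k a hc, F^[2 * n] p = p ∧
        HasMFDerivAt 𝓘(ℂ, ℂ × ℂ) 𝓘(ℂ, ℂ × ℂ) F^[2 * n] p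
          (ContinuousLinearMap.id ℂ (ℂ × ℂ)) := by
  obtain ⟨R, S, h⟩ := exists_isLiftPair k a hc hk hk_even
  refine ⟨⟨h.diffeo, h.isInducedBy⟩, fun F hF p hp => ?_⟩
  have ht := h.tangentToId hk hk_even hp
  rw [← h.eq_of_isInducedBy F.contMDiff_toFun.continuous hF] at ht
  exact ⟨ht.apply_eq, ht.hasMFDerivAt⟩
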